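/- Let $d\ge 1$ be an integer, $1\le p,q<\infty$, $|x|_\infty=\max_k|x_k|$ on $\mathbb Z^d$, and let $w=(w(i))_{i\in\mathbb Z^d}$ be a discrete $A_q$-weight, i.e. a positive sequence for which there is $C>0$ such that, for all $a\in\mathbb Z^d$ and all integers $N\ge 1$, with $Q=a+[0,N-1]^d\subset\mathbb Z^d$, $$\Big(N^{-d}\sum_{i\in Q}w(i)\Big)\Big(N^{-d}\sum_{i\in Q}w(i)^{-1/(q-1)}\Big)^{q-1}\le C\quad\text{if } 1<q<\infty,\qquad N^{-d}\sum_{i\in Q}w(i)\le C\inf_{i\in Q}w(i)\quad\text{if } q=1.$$ Let $\ell^q_w$ be the space of complex sequences $c=(c(i))_{i\in\mathbb Z^d}$ with $\|c\|_{q,w}=\big(\sum_i|c(i)|^q w(i)\big)^{1/q}<\infty$, and $\mathcal B(\ell^q_w)$ the algebra of all bounded linear operators on $\ell^q_w$. Let $u=(u(i,j))_{i,j\in\mathbb Z^d}$ be either $u(i,j)=(1+|i-j|_\infty)^\alpha$ with $\alpha>d(1-1/p)$, or $u(i,j)=\exp(|i-j|_\infty^\delta)$ with $\delta\in(0,1)$,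 and let $\mathcal B_{p,u}$ be the class of complex matrices $A=(a(i,j))_{i,j\in\mathbb Z^d}$ with $$\|A\|_{\mathcal B_{p,u}}=\Big(\sum_{k\in\mathbb Z^d}\Big(\sup_{|i-j|_\infty\ge|k|_\infty}|a(i,j)|\,u(i,j)\Big)^p\Big)^{1/p}<\infty .$$ Then $\mathcal B_{p,u}$ is an inverse-closed subalgebra of $\mathcal B(\ell^q_w)$. That is: every $A\in\mathcal B_{p,u}$ defines a bounded operator on $\ell^q_w$ by $(Ac)(i)=\sum_j a(i,j)c(j)$ (absolutely convergent series); this identifies $\mathcal B_{p,u}$ bijectively with a unital subalgebra of $\mathcal B(\ell^q_w)$, the composition of operators corresponding to the (absolutely convergent) matrix product; and if $A\in\mathcal B_{p,u}$ is invertible in $\mathcal B(\ell^q_w)$, then $A^{-1}$ is again given by a matrix in $\mathcal B_{p,u}$. -/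

import Mathlib

noncomputable section

/-! ### The weighted sequence space `ℓ^q_w` -/

/-- A sequence `c` is weighted `q`-summable: `∑ |c(i)|^q w(i) < ∞`. -/
def MemWlp {ι : Type*} (q : ℝ) (w : ι → ℝ) (c : ι → ℂ) : Prop :=
  Summable fun i => ‖c i‖ ^ q * w i

/-- Minkowski's inequality in the weighted sequence space. -/
theorem wlp_minkowski {ι : Type*} {q : ℝ} (hq : 1 ≤ q) {w : ι → ℝ} (hw : ∀ i, 0 < w i)
    {c e : ι → ℂ} (hc : MemWlp q w c) (he : MemWlp q w e) :
    MemWlp q w (c + e) ∧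
      (∑' i, ‖(c + e) i‖ ^ q * w i) ^ (1 / q) ≤
        (∑' i, ‖c i‖ ^ q * w i) ^ (1 / q) + (∑' i, ‖e i‖ ^ q * w i) ^ (1 / q) := by
  have hq0 : q ≠ 0 := by positivity
  have key : ∀ (x : ℝ) (i : ι), 0 ≤ x → x ^ q * w i = (x * w i ^ (1 / q)) ^ q := by
    intro x i hx
    rw [Real.mul_rpow hx (Real.rpow_nonneg (hw i).le _), ← Real.rpow_mul (hw i).le,
      one_div_mul_cancel hq0, Real.rpow_one]
  have h1 : (fun i => ‖c i‖ ^ q * w i) = fun i => (‖c i‖ * w i ^ (1 / q)) ^ q :=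
    funext fun i => key _ i (norm_nonneg _)
  have h2 : (fun i => ‖e i‖ ^ q * w i) = fun i => (‖e i‖ * w i ^ (1 / q)) ^ q :=
    funext fun i => key _ i (norm_nonneg _)
  have hn : ∀ (a : ι → ℂ) (i : ι), 0 ≤ ‖a i‖ * w i ^ (1 / q) := fun a i =>
    mul_nonneg (norm_nonneg _) (Real.rpow_nonneg (hw i).le _)
  unfold MemWlp at *
  rw [h1] at hc
  rw [h2] at he
  obtain ⟨hs, hle⟩ := Real.Lp_add_le_tsum_of_nonneg hq (hn c) (hn e) hc he
  have hdom : ∀ i, ‖(c + e) i‖ ^ q * w i ≤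
      (‖c i‖ * w i ^ (1 / q) + ‖e i‖ * w i ^ (1 / q)) ^ q := by
    intro i
    rw [← add_mul, ← key _ i (by positivity)]
    exact mul_le_mul_of_nonneg_right
      (Real.rpow_le_rpow (norm_nonneg _) (norm_add_le _ _) (by positivity)) (hw i).le
  have hnn : ∀ i, 0 ≤ ‖(c + e) i‖ ^ q * w i := fun i =>
    mul_nonneg (Real.rpow_nonneg (norm_nonneg _) _) (hw i).le
  have hsum : Summable fun i => ‖(c + e) i‖ ^ q * w i := Summable.of_nonneg_of_le hnn hdom hs
  refine ⟨hsum, ?_⟩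
  rw [h1, h2]
  exact (Real.rpow_le_rpow (tsum_nonneg hnn) (hsum.tsum_le_tsum hdom hs)
    (by positivity)).trans hle

section Space

variable {ι : Type*} (q : ℝ) (w : ι → ℝ) [Fact (1 ≤ q)] [Fact (∀ i, 0 < w i)]

/-- The weighted `q`-summable sequences, as a subspace of all sequences. -/
def wlpSubmodule : Submodule ℂ (ι → ℂ) where
  carrier := {c | MemWlp q w c}
  add_mem' hc he := (wlp_minkowski (Fact.out : 1 ≤ q) (Fact.out : ∀ i, 0 < w i) hc he).1
  zero_mem' := by
    have hq : (1 : ℝ) ≤ q := Fact.out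
    simp [MemWlp, Real.zero_rpow (show q ≠ 0 by positivity), summable_zero]
  smul_mem' a c hc := by
    have : (fun i => ‖(a • c) i‖ ^ q * w i) = fun i => ‖a‖ ^ q * (‖c i‖ ^ q * w i) := by
      funext i
      simp [Real.mul_rpow, mul_assoc]
    simp only [Set.mem_ofPred_eq, MemWlp]
    rw [this]
    exact Summable.mul_left _ hc

/-- The space `ℓ^q_w`. It is a type of its own, so that its topology is the one of the norm
`‖c‖_{q,w}` and not the topology of pointwise convergence. -/
def Wlp : Type _ := wlpSubmodule q w

instance : AddCommGroup (Wlp q w) := inferInstanceAs (AddCommGroup (wlpSubmodule q w))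

instance : Module ℂ (Wlp q w) := inferInstanceAs (Module ℂ (wlpSubmodule q w))

instance : CoeFun (Wlp q w) (fun _ => ι → ℂ) := ⟨fun c => c.1⟩

/-- The norm `‖c‖_{q,w} = (∑ |c(i)|^q w(i))^{1/q}`. -/
instance : Norm (Wlp q w) := ⟨fun c => (∑' i, ‖c i‖ ^ q * w i) ^ (1 / q)⟩

theorem wlp_core : NormedSpace.Core ℂ (Wlp q w) where
  norm_nonneg c := Real.rpow_nonneg (tsum_nonneg fun i =>
    mul_nonneg (Real.rpow_nonneg (norm_nonneg _) _) ((Fact.out : ∀ i, 0 < w i) i).le) _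
  norm_smul a c := by
    have hq : (1 : ℝ) ≤ q := Fact.out
    have hw : ∀ i, 0 < w i := Fact.out
    have h : ∀ i, ‖(a • c) i‖ ^ q * w i = ‖a‖ ^ q * (‖c i‖ ^ q * w i) := by
      intro i
      have : (a • c) i = a * c i := rfl
      rw [this, norm_mul, Real.mul_rpow (norm_nonneg _) (norm_nonneg _), mul_assoc]
    change (∑' i, ‖(a • c) i‖ ^ q * w i) ^ (1 / q) =
      ‖a‖ * (∑' i, ‖c i‖ ^ q * w i) ^ (1 / q)
    simp_rw [h]
    rw [tsum_mul_left, Real.mul_rpow (by positivity) (tsum_nonneg fun i =>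
      mul_nonneg (by positivity) (hw i).le), ← Real.rpow_mul (norm_nonneg _),
      mul_one_div_cancel (by positivity), Real.rpow_one]
  norm_triangle c e :=
    (wlp_minkowski (Fact.out : 1 ≤ q) (Fact.out : ∀ i, 0 < w i) c.2 e.2).2
  norm_eq_zero_iff c := by
    have hq : (1 : ℝ) ≤ q := Fact.out
    have hw : ∀ i, 0 < w i := Fact.out
    have hnn : ∀ i, 0 ≤ ‖c i‖ ^ q * w i := fun i => mul_nonneg (by positivity) (hw i).le
    change (∑' i, ‖c i‖ ^ q * w i) ^ (1 / q) = 0 ↔ c = 0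
    constructor
    · intro h
      have h0 : ∑' i, ‖c i‖ ^ q * w i = 0 :=
        ((Real.rpow_eq_zero (tsum_nonneg hnn) (by positivity)).1 h)
      have hs : HasSum (fun i => ‖c i‖ ^ q * w i) 0 := h0 ▸ (show Summable _ from c.2).hasSum
      have hz := (hasSum_zero_iff_of_nonneg hnn).1 hs
      refine Subtype.ext (funext fun i => ?_)
      have hi : ‖c i‖ ^ q * w i = 0 := congrFun hz i
      have hi' := (mul_eq_zero.1 hi).resolve_right (hw i).ne'
      exact norm_eq_zero.1 ((Real.rpow_eq_zero (norm_nonneg _) (by positivity)).1 hi')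
    · rintro rfl
      have h : ∀ i, ‖(0 : Wlp q w) i‖ ^ q * w i = 0 := by
        intro i
        have : (0 : Wlp q w) i = 0 := rfl
        rw [this, norm_zero, Real.zero_rpow (by positivity), zero_mul]
      simp_rw [h]
      rw [tsum_zero, Real.zero_rpow (by positivity)]

instance : NormedAddCommGroup (Wlp q w) := NormedAddCommGroup.ofCore (wlp_core q w)

instance : NormedSpace ℂ (Wlp q w) := NormedSpace.ofCore (wlp_core q w)

theorem wlp_norm_def (c : Wlp q w) : ‖c‖ = (∑' i, ‖c i‖ ^ q * w i) ^ (1 / q) := rfl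

end Space

/-! ### Discrete Muckenhoupt weights -/

/-- The discrete cube `a + [0, N - 1]^d`. -/
def discreteCube {d : ℕ} (a : Fin d → ℤ) (N : ℕ) : Finset (Fin d → ℤ) :=
  Finset.Icc a fun k => a k + (N : ℤ) - 1

/-- The average `N^{-d} ∑_{i ∈ a + [0, N - 1]^d} f(i)`. -/
def cubeAverage {d : ℕ} (f : (Fin d → ℤ) → ℝ) (a : Fin d → ℤ) (N : ℕ) : ℝ :=
  ((N : ℝ) ^ d)⁻¹ * ∑ i ∈ discreteCube a N, f i

/-- Discrete Muckenhoupt `A_q`-weights on `ℤ^d`, for `1 ≤ q < ∞`. -/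
def IsDiscreteAqWeight {d : ℕ} (q : ℝ) (w : (Fin d → ℤ) → ℝ) : Prop :=
  (∀ i, 0 < w i) ∧
    ((1 < q ∧ ∃ C : ℝ, 0 < C ∧ ∀ (a : Fin d → ℤ) (N : ℕ), 1 ≤ N →
        cubeAverage w a N * cubeAverage (fun i => w i ^ (-(1 / (q - 1)))) a N ^ (q - 1) ≤ C) ∨
      (q = 1 ∧ ∃ C : ℝ, 0 < C ∧ ∀ (a : Fin d → ℤ) (N : ℕ), 1 ≤ N →
        ∀ i ∈ discreteCube a N, cubeAverage w a N ≤ C * w i))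

/-! ### The class `𝓑_{p,u}` of infinite matrices

The norm on `Fin d → ℤ` is the maximum norm `|·|_∞`. -/

/-- `sup_{|i-j|_∞ ≥ |k|_∞} |a(i,j)| u(i,j)`, with values in `[0, ∞]`. -/
def beurlingSup {d : ℕ} (u : (Fin d → ℤ) → (Fin d → ℤ) → ℝ)
    (A : Matrix (Fin d → ℤ) (Fin d → ℤ) ℂ) (k : Fin d → ℤ) : ENNReal :=
  ⨆ (i : Fin d → ℤ) (j : Fin d → ℤ) (_ : ‖k‖ ≤ ‖i - j‖), ENNReal.ofReal (‖A i j‖ * u i j)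

/-- The norm of `𝓑_{p,u}`, for finite `p`, with values in `[0, ∞]`. -/
def beurlingNorm {d : ℕ} (p : ℝ) (u : (Fin d → ℤ) → (Fin d → ℤ) → ℝ)
    (A : Matrix (Fin d → ℤ) (Fin d → ℤ) ℂ) : ENNReal :=
  (∑' k : Fin d → ℤ, beurlingSup u A k ^ p) ^ (1 / p)

/-- The class `𝓑_{p,u}`. -/
def BeurlingClass {d : ℕ} (p : ℝ) (u : (Fin d → ℤ) → (Fin d → ℤ) → ℝ) :
    Set (Matrix (Fin d → ℤ) (Fin d → ℤ) ℂ) :=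
  {A | beurlingNorm p u A < ⊤}

/-- The polynomial weight matrix `(1 + |i - j|_∞)^α`. -/
def polynomialWeight (d : ℕ) (α : ℝ) (i j : Fin d → ℤ) : ℝ := (1 + ‖i - j‖) ^ α

/-- The subexponential weight matrix `exp(|i - j|_∞^δ)`. -/
def subexponentialWeight (d : ℕ) (δ : ℝ) (i j : Fin d → ℤ) : ℝ := Real.exp (‖i - j‖ ^ δ)

/-! ### Matrices as operators, and inverse-closedness -/

/-- The bounded operator `T` on `ℓ^q_w` is given by the matrix `A`:
`(T c)(i) = ∑_j A(i,j) c(j)`, the series converging absolutely. -/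
def IsMatrixOf {ι : Type*} {q : ℝ} {w : ι → ℝ} [Fact (1 ≤ q)] [Fact (∀ i, 0 < w i)]
    (A : Matrix ι ι ℂ) (T : Wlp q w →L[ℂ] Wlp q w) : Prop :=
  ∀ (c : Wlp q w) (i : ι), HasSum (fun j => A i j * c j) (T c i)

/-- A subalgebra is inverse-closed if it contains the inverse of each of its elements that is
invertible in the whole algebra. -/
def IsInverseClosed {𝕜 B : Type*} [CommSemiring 𝕜] [Semiring B] [Algebra 𝕜 B]
    (S : Subalgebra 𝕜 B) : Prop :=
  ∀ a : Bˣ, (a : B) ∈ S → ((a⁻¹ : Bˣ) : B) ∈ S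

end

/-! A matrix `A` is dominated entrywise by convolution with the kernel h(x) = sup_j |A(x+j, j)|, and
its norm in the class is the ℓ^p norm of the radially decreasing majorant of h·u
(`mem_beurlingClass_iff`). Two facts give boundedness and the algebra property. In z = x + y the
larger summand has norm at least |z|/2, so the majorant of a convolution is controlled by dilated
majorants (`radialSum_conv_le`). A kernel with summable majorant is a superposition of normalised
indicators of balls, and the A_q condition bounds these uniformly on ℓ^q_w
(`CubeBound.tsum_kernel_le`).

Let T be the operator of A and G its inverse. First, the kernel of G has a summable majorant without
any weight (`radialSum_opMatrix_inverse_lt_top`). Tile the lattice by cubes of side N and cut each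
column of G off near the cube of its index, which gives P. On sequences supported in one cube, TP -
1 is the commutator of T with a cut-off of Lipschitz constant 1/N, composed with G. For large N this
error is small as a kernel on the lattice of cubes, and the Neumann series G = ∑ P(1 - TP)^k bounds
the entries of G.

Second, the weight is recovered (`KernelInverse.radialSum_lt_top`). Truncating G to a band of width
R gives f ≤ f_R + f∗e for the kernel f of G, where e is small. The weights satisfy u(x+y) ≤ u(x)v(y)
for |y| ≤ |x| with a weaker v: the constant 2^α, or exp((2^δ-1)|y|^δ). In f∗e the weighted norm of f
is therefore multiplied only by a multiple of (∑ e·v)^p and can be absorbed; truncating u by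
constants ensures that what is absorbed is finite. This needs f in the class of v beforehand. For
constant v that is the first stage. In the subexponential case v is replaced by equivalent
submultiplicative weights that tend to 1, so that the smallness of e without weight is enough
(`KernelInverse.radialSum_one_lt_top`). The bound α > d(1-1/p) enters through Hölder duality: it
embeds the class into the kernels with summable majorant. -/

open Filter Topology
open scoped ENNReal

/-! ### Radial majorants on the integer lattice -/

/-- The supremum of a kernel outside the open ball of radius `r`. -/
noncomputable def radialSup {d : ℕ} (f : (Fin d → ℤ) → ℝ≥0∞) (r : ℝ) : ℝ≥0∞ :=
  ⨆ (x : Fin d → ℤ) (_ : r ≤ ‖x‖), f x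

/-- The `p`-th power sum of the radially decreasing majorant of a kernel. -/
noncomputable def radialSum {d : ℕ} (p : ℝ) (f : (Fin d → ℤ) → ℝ≥0∞) : ℝ≥0∞ :=
  ∑' k : Fin d → ℤ, radialSup f ‖k‖ ^ p

/-- The convolution of two kernels. -/
noncomputable def kernelConv {d : ℕ} (f g : (Fin d → ℤ) → ℝ≥0∞) (z : Fin d → ℤ) : ℝ≥0∞ :=
  ∑' x, f x * g (z - x)

section Radial

variable {d : ℕ} {f g : (Fin d → ℤ) → ℝ≥0∞}

theorem radialSup_antitone (f : (Fin d → ℤ) → ℝ≥0∞) : Antitone (radialSup f) :=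
  fun _ _ h => iSup_mono fun _ => iSup_mono' fun hx => ⟨h.trans hx, le_rfl⟩

theorem le_radialSup {x : Fin d → ℤ} {r : ℝ} (h : r ≤ ‖x‖) : f x ≤ radialSup f r :=
  le_iSup₂ (f := fun (x : Fin d → ℤ) (_ : r ≤ ‖x‖) => f x) x h

theorem radialSup_le {r : ℝ} {b : ℝ≥0∞} (h : ∀ x, r ≤ ‖x‖ → f x ≤ b) : radialSup f r ≤ b :=
  iSup₂_le h

theorem radialSup_mono (h : ∀ x, f x ≤ g x) (r : ℝ) : radialSup f r ≤ radialSup g r :=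
  radialSup_le fun x hx => (h x).trans (le_radialSup hx)

theorem radialSup_le_zero (r : ℝ) : radialSup f r ≤ radialSup f 0 :=
  radialSup_le fun x _ => le_radialSup (norm_nonneg x)

theorem radialSup_add_le (r : ℝ) :
    radialSup (fun x => f x + g x) r ≤ radialSup f r + radialSup g r :=
  radialSup_le fun _ hx => add_le_add (le_radialSup hx) (le_radialSup hx)

theorem radialSup_const_mul_le (a : ℝ≥0∞) (r : ℝ) :
    radialSup (fun x => a * f x) r ≤ a * radialSup f r :=
  radialSup_le fun _ hx => mul_le_mul_right (le_radialSup hx) a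

theorem radialSup_of_antitone {H : ℝ → ℝ≥0∞} (hH : Antitone H) (r : ℝ) :
    radialSup (fun x : Fin d → ℤ => H ‖x‖) r ≤ H r :=
  radialSup_le fun _ hx => hH hx

theorem radialSum_one (f : (Fin d → ℤ) → ℝ≥0∞) : radialSum 1 f = ∑' k : Fin d → ℤ, radialSup f ‖k‖ := by
  simp [radialSum]

theorem radialSum_mono {p : ℝ} (hp : 0 ≤ p) (h : ∀ x, f x ≤ g x) :
    radialSum p f ≤ radialSum p g :=
  ENNReal.tsum_le_tsum fun _ => ENNReal.rpow_le_rpow (radialSup_mono h _) hp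

theorem tsum_le_radialSum (f : (Fin d → ℤ) → ℝ≥0∞) : ∑' x, f x ≤ radialSum 1 f := by
  rw [radialSum_one]
  exact ENNReal.tsum_le_tsum fun x => le_radialSup le_rfl

theorem add_rpow_le_two_mul {p : ℝ} (hp : 1 ≤ p) (a b : ℝ≥0∞) :
    (a + b) ^ p ≤ 2 ^ p * (a ^ p + b ^ p) :=
  (ENNReal.rpow_add_le_mul_rpow_add_rpow a b hp).trans
    (mul_le_mul_left (ENNReal.rpow_le_rpow_of_exponent_le (by norm_num) (by linarith)) _)

theorem radialSum_add_le {p : ℝ} (hp : 1 ≤ p) :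
    radialSum p (fun x => f x + g x) ≤ 2 ^ p * (radialSum p f + radialSum p g) := by
  unfold radialSum
  rw [← ENNReal.tsum_add, ← ENNReal.tsum_mul_left]
  exact ENNReal.tsum_le_tsum fun x => (ENNReal.rpow_le_rpow (radialSup_add_le _)
    (by linarith)).trans (add_rpow_le_two_mul hp _ _)

theorem radialSum_const_mul_le {p : ℝ} (hp : 0 ≤ p) (a : ℝ≥0∞) :
    radialSum p (fun x => a * f x) ≤ a ^ p * radialSum p f := by
  unfold radialSum
  rw [← ENNReal.tsum_mul_left]
  refine ENNReal.tsum_le_tsum fun x => ?_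
  rw [← ENNReal.mul_rpow_of_nonneg _ _ hp]
  exact ENNReal.rpow_le_rpow (radialSup_const_mul_le _ _) hp

theorem radialSup_zero_le_radialSum {p : ℝ} : radialSup f 0 ^ p ≤ radialSum p f := by
  have := ENNReal.le_tsum (f := fun k : Fin d → ℤ => radialSup f ‖k‖ ^ p) 0
  simpa [radialSum] using this

theorem radialSup_lt_top {p : ℝ} (hp : 1 ≤ p) (h : radialSum p f < ∞) (r : ℝ) :
    radialSup f r < ∞ := by
  refine (radialSup_le_zero r).trans_lt ?_
  have := (radialSup_zero_le_radialSum (f := f)).trans_lt h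
  exact (ENNReal.rpow_lt_top_iff_of_pos (by linarith)).1 this

/-- The lattice points in the closed ball of radius `M`. -/
noncomputable def latticeBall (d M : ℕ) : Finset (Fin d → ℤ) :=
  Finset.Icc (fun _ => -(M : ℤ)) (fun _ => (M : ℤ))

theorem mem_latticeBall {M : ℕ} {x : Fin d → ℤ} : x ∈ latticeBall d M ↔ ‖x‖ ≤ M := by
  rw [latticeBall, Finset.mem_Icc, pi_norm_le_iff_of_nonneg (by positivity)]
  simp only [Pi.le_def, ← forall_and, Int.norm_eq_abs, ← abs_le]
  refine forall_congr' fun i => ?_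
  rw [← Int.cast_abs]
  exact_mod_cast Iff.rfl

theorem card_latticeBall (d M : ℕ) : (latticeBall d M).card = (2 * M + 1) ^ d := by
  rw [latticeBall, Pi.card_Icc]
  simp only [Int.card_Icc, Finset.prod_const, Finset.card_univ, Fintype.card_fin]
  congr 1
  omega

/-- Division of lattice points with rounding towards the origin. -/
def latticeDiv (M : ℕ) (k : Fin d → ℤ) : Fin d → ℤ := fun i => (k i).tdiv M

/-- This is why the rounding is towards the origin: rounding down would send -1 to -1 and increase
the quotient. -/
theorem norm_latticeDiv_le {M : ℕ} (hM : 1 ≤ M) (k : Fin d → ℤ) :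
    ‖latticeDiv M k‖ ≤ ‖k‖ / M := by
  have hM' : (0 : ℝ) < M := by exact_mod_cast hM
  rw [pi_norm_le_iff_of_nonneg (by positivity)]
  intro i
  rw [le_div_iff₀ hM']
  refine le_trans ?_ (norm_le_pi_norm k i)
  rw [Int.norm_eq_abs, Int.norm_eq_abs, ← Int.cast_abs, ← Int.cast_abs]
  have h : |(k i).tdiv M| * M ≤ |k i| := by
    have := Nat.div_mul_le_self (k i).natAbs M
    rw [Int.abs_eq_natAbs, Int.abs_eq_natAbs, Int.natAbs_tdiv]
    exact_mod_cast this
  exact_mod_cast h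

/-- A point is determined by its quotient and its remainder, and the remainders lie in a ball with
(2M+1)^d points. -/
theorem tsum_comp_latticeDiv_le {M : ℕ} (hM : 1 ≤ M) (F : (Fin d → ℤ) → ℝ≥0∞) :
    ∑' k, F (latticeDiv M k) ≤ ((2 * M + 1) ^ d : ℕ) * ∑' k, F k := by
  have hmod : ∀ k : Fin d → ℤ, (fun i => (k i).tmod M) ∈ latticeBall d M := by
    intro k
    rw [latticeBall, Finset.mem_Icc]
    have : ∀ i, |(k i).tmod M| ≤ M := by
      intro i
      have h1 : (k i).natAbs % M < M := Nat.mod_lt _ hM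
      rw [Int.abs_eq_natAbs, Int.natAbs_tmod]
      exact_mod_cast h1.le
    exact ⟨fun i => (abs_le.1 (this i)).1, fun i => (abs_le.1 (this i)).2⟩
  let e : (Fin d → ℤ) → (Fin d → ℤ) × latticeBall d M :=
    fun k => (latticeDiv M k, ⟨_, hmod k⟩)
  have he : Function.Injective e := by
    intro k l h
    simp only [e, Prod.mk.injEq, Subtype.mk.injEq] at h
    funext i
    rw [← Int.mul_tdiv_add_tmod (k i) M, ← Int.mul_tdiv_add_tmod (l i) M]
    have h1 := congrFun h.1 i
    have h2 := congrFun h.2 i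
    simp only [latticeDiv] at h1
    rw [h1, h2]
  calc ∑' k, F (latticeDiv M k) = ∑' k, (fun y : (Fin d → ℤ) × latticeBall d M => F y.1) (e k) := rfl
    _ ≤ ∑' y : (Fin d → ℤ) × latticeBall d M, F y.1 := ENNReal.tsum_comp_le_tsum_of_injective he _
    _ = _ := by
      rw [ENNReal.tsum_prod (f := fun a (_ : latticeBall d M) => F a), ← ENNReal.tsum_mul_left]
      refine tsum_congr fun a => ?_
      rw [tsum_fintype, Finset.sum_const, Finset.card_univ, Fintype.card_coe, card_latticeBall]
      simp

/-- Dilating a decreasing radial function costs a constant factor. The case M = 2 pays for the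
splitting in convolutions. -/
theorem tsum_antitone_div_le {M : ℕ} (hM : 1 ≤ M) {H : ℝ → ℝ≥0∞} (hH : Antitone H) :
    ∑' k : Fin d → ℤ, H (‖k‖ / M) ≤ ((2 * M + 1) ^ d : ℕ) * ∑' k : Fin d → ℤ, H ‖k‖ :=
  (ENNReal.tsum_le_tsum fun k => hH (norm_latticeDiv_le hM k)).trans
    (tsum_comp_latticeDiv_le hM fun k => H ‖k‖)

theorem tsum_antitone_half_le {H : ℝ → ℝ≥0∞} (hH : Antitone H) :
    ∑' k : Fin d → ℤ, H (‖k‖ / 2) ≤ (5 ^ d : ℕ) * ∑' k : Fin d → ℤ, H ‖k‖ := by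
  have := tsum_antitone_div_le (d := d) (M := 2) (by norm_num) hH
  simpa using this

/-- The basic inequality for convolutions with a weight `W` that is submultiplicative up to the
weight `V` of the smaller argument. -/
theorem radialSup_conv_le {W V : (Fin d → ℤ) → ℝ≥0∞}
    (hW : ∀ x y : Fin d → ℤ, ‖y‖ ≤ ‖x‖ → W (x + y) ≤ W x * V y) (r : ℝ) :
    radialSup (fun z => kernelConv f g z * W z) r ≤
      radialSup (fun x => f x * W x) (r / 2) * (∑' y, g y * V y) +
      radialSup (fun x => g x * W x) (r / 2) * (∑' y, f y * V y) := by
  refine radialSup_le fun z hz => ?_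
  unfold kernelConv
  rw [← ENNReal.tsum_mul_right, ← (Equiv.subLeft z).tsum_eq (fun y => g y * V y),
    ← ENNReal.tsum_mul_left, ← ENNReal.tsum_mul_left, ← ENNReal.tsum_add]
  refine ENNReal.tsum_le_tsum fun x => ?_
  simp only [Equiv.subLeft_apply]
  have htri : ‖z‖ ≤ ‖x‖ + ‖z - x‖ := by
    simpa using norm_add_le x (z - x)
  -- The larger of the two summands has norm at least ‖z‖/2 and takes the weight `W`; the smaller
  -- one only takes `V`.
  rcases le_total ‖z - x‖ ‖x‖ with h | h
  · refine le_trans ?_ le_self_add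
    have h1 := hW x (z - x) h
    rw [add_sub_cancel] at h1
    calc f x * g (z - x) * W z ≤ f x * g (z - x) * (W x * V (z - x)) := by gcongr
      _ = f x * W x * (g (z - x) * V (z - x)) := by ring
      _ ≤ _ := by gcongr; exact le_radialSup (f := fun x => f x * W x) (by linarith)
  · refine le_trans ?_ le_add_self
    have h1 := hW (z - x) x h
    rw [sub_add_cancel] at h1
    calc f x * g (z - x) * W z ≤ f x * g (z - x) * (W (z - x) * V x) := by gcongr
      _ = g (z - x) * W (z - x) * (f x * V x) := by ring
      _ ≤ _ := by gcongr; exact le_radialSup (f := fun x => g x * W x) (by linarith)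

/-- In each term only one kernel carries the strong weight `W`, and the other enters through a plain
sum against `V`. This asymmetry makes the later absorption possible. -/
theorem radialSum_conv_le {p : ℝ} (hp : 1 ≤ p) {W V : (Fin d → ℤ) → ℝ≥0∞}
    (hW : ∀ x y : Fin d → ℤ, ‖y‖ ≤ ‖x‖ → W (x + y) ≤ W x * V y) :
    radialSum p (fun z => kernelConv f g z * W z) ≤ 2 ^ p * (5 ^ d : ℕ) *
      (radialSum p (fun x => f x * W x) * (∑' y, g y * V y) ^ p +
       radialSum p (fun x => g x * W x) * (∑' y, f y * V y) ^ p) := by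
  have hp0 : 0 ≤ p := by linarith
  have anti : ∀ h : (Fin d → ℤ) → ℝ≥0∞, Antitone fun r => radialSup h r ^ p :=
    fun h a b hab => ENNReal.rpow_le_rpow (radialSup_antitone _ hab) hp0
  have half : ∀ h : (Fin d → ℤ) → ℝ≥0∞,
      ∑' k : Fin d → ℤ, radialSup h (‖k‖ / 2) ^ p ≤ (5 ^ d : ℕ) * radialSum p h :=
    fun h => tsum_antitone_half_le (anti h)
  calc radialSum p (fun z => kernelConv f g z * W z)
      ≤ ∑' k : Fin d → ℤ, 2 ^ p *
        (radialSup (fun x => f x * W x) (‖k‖ / 2) ^ p * (∑' y, g y * V y) ^ p +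
         radialSup (fun x => g x * W x) (‖k‖ / 2) ^ p * (∑' y, f y * V y) ^ p) := by
        refine ENNReal.tsum_le_tsum fun k => ?_
        rw [← ENNReal.mul_rpow_of_nonneg _ _ hp0, ← ENNReal.mul_rpow_of_nonneg _ _ hp0]
        exact (ENNReal.rpow_le_rpow (radialSup_conv_le hW _) hp0).trans (add_rpow_le_two_mul hp _ _)
    _ ≤ 2 ^ p * ((5 ^ d : ℕ) * radialSum p (fun x => f x * W x) * (∑' y, g y * V y) ^ p +
       (5 ^ d : ℕ) * radialSum p (fun x => g x * W x) * (∑' y, f y * V y) ^ p) := by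
        rw [ENNReal.tsum_mul_left, ENNReal.tsum_add, ENNReal.tsum_mul_right, ENNReal.tsum_mul_right]
        gcongr
        · exact half _
        · exact half _
    _ = _ := by ring

theorem radialSum_one_conv_le :
    radialSum 1 (kernelConv f g) ≤ 4 * (5 ^ d : ℕ) * (radialSum 1 f * radialSum 1 g) := by
  have h := radialSum_conv_le (d := d) (f := f) (g := g) (p := 1) le_rfl (W := fun _ => 1)
    (V := fun _ => 1) (fun _ _ _ => by simp)
  simp only [mul_one, ENNReal.rpow_one] at h
  calc radialSum 1 (kernelConv f g) ≤ _ := h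
    _ ≤ 2 * (5 ^ d : ℕ) * (radialSum 1 f * radialSum 1 g + radialSum 1 g * radialSum 1 f) := by
      gcongr <;> exact tsum_le_radialSum _
    _ = _ := by ring

/-- Dominated convergence for the counting measure. That H(X) tends to 0 uses the infinitely many
diagonal points of norm X, hence d ≠ 0. -/
theorem tendsto_tsum_antitone_max [NeZero d] {H : ℝ → ℝ≥0∞} (hH : Antitone H)
    (hs : ∑' k : Fin d → ℤ, H ‖k‖ ≠ ∞) :
    Tendsto (fun X : ℕ => ∑' k : Fin d → ℤ, H (max ‖k‖ X)) atTop (𝓝 0) := by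
  have hinj : Function.Injective fun (X : ℕ) => (fun _ : Fin d => (X : ℤ)) := by
    intro a b h
    have := congrFun h 0
    simpa using this
  have h0 : Tendsto (fun X : ℕ => H X) atTop (𝓝 0) := by
    have := (ENNReal.tendsto_cofinite_zero_of_tsum_ne_top hs).comp hinj.tendsto_cofinite
    rw [Nat.cofinite_eq_atTop] at this
    refine this.congr fun X => ?_
    simp [pi_norm_const]
  have hint : ∫⁻ k : Fin d → ℤ, H ‖k‖ ∂MeasureTheory.Measure.count ≠ ∞ := by
    rwa [MeasureTheory.lintegral_count]
  have := MeasureTheory.tendsto_lintegral_filter_of_dominated_convergence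
    (μ := (MeasureTheory.Measure.count : MeasureTheory.Measure (Fin d → ℤ)))
    (F := fun (X : ℕ) (k : Fin d → ℤ) => H (max ‖k‖ X)) (f := fun _ => 0) (l := atTop)
    (fun k => H ‖k‖) (Eventually.of_forall fun X => measurable_of_countable _)
    (Eventually.of_forall fun X => Eventually.of_forall fun k => hH (le_max_left _ _)) hint
    (Eventually.of_forall fun k => tendsto_of_tendsto_of_tendsto_of_le_of_le
      tendsto_const_nhds h0 (fun _ => zero_le) fun X => hH (le_max_right _ _))
  simpa [MeasureTheory.lintegral_count] using this

theorem summable_one_add_norm_rpow {s : ℝ} (hs : (d : ℝ) < s) :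
    Summable fun k : Fin d → ℤ => (1 + ‖k‖) ^ (-s) := by
  let b := Pi.basisFun ℝ (Fin d)
  let L : Submodule ℤ (Fin d → ℝ) := Submodule.span ℤ (Set.range b)
  have hr : Module.finrank ℤ L = d := by
    have := Module.finrank_eq_card_basis (b.restrictScalars ℤ)
    rw [this]; simp
  have h := ZLattice.summable_norm_rpow L (-s) (by rw [hr]; linarith)
  have hmem : ∀ k : Fin d → ℤ, (fun i => (k i : ℝ)) ∈ L := by
    intro k
    have : (fun i => (k i : ℝ)) = ∑ i, k i • b i := by
      funext i
      simp [b, Finset.sum_apply, Pi.single_apply]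
    rw [this]
    exact Submodule.sum_mem _ fun i _ => Submodule.smul_mem _ _ (Submodule.subset_span ⟨i, rfl⟩)
  let e : (Fin d → ℤ) → L := fun k => ⟨_, hmem k⟩
  have he : Function.Injective e := by
    intro k l hkl
    funext i
    have : (k i : ℝ) = l i := congrFun (congrArg Subtype.val hkl) i
    exact_mod_cast this
  have hn : ∀ k, ‖e k‖ = ‖k‖ := by
    intro k
    change ‖fun i => (k i : ℝ)‖ = ‖k‖
    simp only [Pi.norm_def]
    congr 1
  have h2 := h.comp_injective he
  -- The comparison fails only at the origin, where the real power `0 ^ (-s)` takes the value `0`.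
  refine Summable.of_norm_bounded_eventually h2 ?_
  have : {k : Fin d → ℤ | ¬ ‖(1 + ‖k‖) ^ (-s)‖ ≤ ((fun z : L => ‖z‖ ^ (-s)) ∘ e) k} ⊆ {0} := by
    intro k hk
    by_contra hk0
    apply hk
    have hpos : 0 < ‖k‖ := norm_pos_iff.2 hk0
    simp only [Function.comp, hn]
    rw [Real.norm_of_nonneg (by positivity)]
    exact Real.rpow_le_rpow_of_nonpos hpos (by linarith) (by
      have : (0 : ℝ) ≤ d := by positivity
      linarith)
  exact (Set.finite_singleton _).subset this

end Radial

/-! ### Consequences of the Muckenhoupt condition -/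

/-- The form in which the Muckenhoupt condition is used: cube averages are bounded from
`ℓ^q_w` of a cube to the constants. -/
def CubeBound {d : ℕ} (q : ℝ) (W : (Fin d → ℤ) → ℝ≥0∞) (C : ℝ≥0∞) : Prop :=
  ∀ (a : Fin d → ℤ) (N : ℕ), 1 ≤ N → ∀ c : (Fin d → ℤ) → ℝ≥0∞,
    (∑ i ∈ discreteCube a N, c i) ^ q * ∑ i ∈ discreteCube a N, W i ≤
      C * ((N : ℝ≥0∞) ^ d) ^ q * ∑ i ∈ discreteCube a N, c i ^ q * W i

/-- Hölder's inequality for c·w^{1/q} and w^{-1/q}; the conjugate exponent q/(q-1) turns the second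
factor into the dual weight of the A_q condition. -/
theorem holder_weight_sum {ι : Type*} {q : ℝ} (hq : 1 < q) {w : ι → ℝ} (hw : ∀ i, 0 < w i)
    (s : Finset ι) (c : ι → ℝ≥0∞) :
    (∑ i ∈ s, c i) ^ q ≤ (∑ i ∈ s, c i ^ q * ENNReal.ofReal (w i)) *
      (∑ i ∈ s, ENNReal.ofReal (w i ^ (-(1 / (q - 1))))) ^ (q - 1) := by
  have hq0 : 0 < q := by linarith
  have hq1 : 0 < q - 1 := by linarith
  have hpq : q.HolderConjugate (q / (q - 1)) := Real.HolderConjugate.conjExponent hq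
  have key := ENNReal.inner_le_Lp_mul_Lq s (fun i => c i * ENNReal.ofReal (w i) ^ (1 / q))
    (fun i => ENNReal.ofReal (w i) ^ (-(1 / q))) hpq
  have hne0 : ∀ i, ENNReal.ofReal (w i) ≠ 0 := fun i => by simpa using hw i
  have h1 : ∀ i, c i * ENNReal.ofReal (w i) ^ (1 / q) * ENNReal.ofReal (w i) ^ (-(1 / q)) = c i := by
    intro i
    rw [mul_assoc, ← ENNReal.rpow_add _ _ (hne0 i) ENNReal.ofReal_ne_top]
    simp
  have h2 : ∀ i, (c i * ENNReal.ofReal (w i) ^ (1 / q)) ^ q = c i ^ q * ENNReal.ofReal (w i) := by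
    intro i
    rw [ENNReal.mul_rpow_of_nonneg _ _ hq0.le, ← ENNReal.rpow_mul, one_div_mul_cancel hq0.ne',
      ENNReal.rpow_one]
  have h3 : ∀ i, (ENNReal.ofReal (w i) ^ (-(1 / q))) ^ (q / (q - 1)) =
      ENNReal.ofReal (w i ^ (-(1 / (q - 1)))) := by
    intro i
    rw [← ENNReal.rpow_mul, ENNReal.ofReal_rpow_of_pos (hw i)]
    congr 2
    field_simp
  simp only [h1, h2, h3] at key
  calc (∑ i ∈ s, c i) ^ q ≤ _ := ENNReal.rpow_le_rpow key hq0.le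
    _ = _ := by
      rw [ENNReal.mul_rpow_of_nonneg _ _ hq0.le, ← ENNReal.rpow_mul, ← ENNReal.rpow_mul,
        one_div_mul_cancel hq0.ne', ENNReal.rpow_one]
      congr 2
      field_simp

theorem IsDiscreteAqWeight.exists_cubeBound {d : ℕ} {q : ℝ} {w : (Fin d → ℤ) → ℝ}
    (hw : IsDiscreteAqWeight q w) :
    ∃ C : ℝ≥0∞, C ≠ ∞ ∧ CubeBound q (fun i => ENNReal.ofReal (w i)) C := by
  obtain ⟨hpos, ⟨hq, C, hC, h⟩ | ⟨rfl, C, hC, h⟩⟩ := hw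
  · refine ⟨ENNReal.ofReal C, ENNReal.ofReal_ne_top, fun a N hN c => ?_⟩
    have hN0 : (0 : ℝ) < (N : ℝ) ^ d := by positivity
    set s := discreteCube a N
    have hS : 0 ≤ ∑ i ∈ s, w i := Finset.sum_nonneg fun i _ => (hpos i).le
    have hT : 0 ≤ ∑ i ∈ s, w i ^ (-(1 / (q - 1))) :=
      Finset.sum_nonneg fun i _ => Real.rpow_nonneg (hpos i).le _
    have h1 : (∑ i ∈ s, w i ^ (-(1 / (q - 1)))) ^ (q - 1) * ∑ i ∈ s, w i ≤
        C * ((N : ℝ) ^ d) ^ q := by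
      have h0 := h a N hN
      simp only [cubeAverage] at h0
      rw [Real.mul_rpow (by positivity) hT, Real.inv_rpow hN0.le] at h0
      have h2 : ((N : ℝ) ^ d) ^ q = (N : ℝ) ^ d * ((N : ℝ) ^ d) ^ (q - 1) := by
        rw [Real.rpow_sub_one hN0.ne']; field_simp
      rw [h2]
      have h3 : 0 < ((N : ℝ) ^ d) ^ (q - 1) := Real.rpow_pos_of_pos hN0 _
      calc _ = ((N : ℝ) ^ d * ((N : ℝ) ^ d) ^ (q - 1)) * (((N : ℝ) ^ d)⁻¹ * ∑ i ∈ s, w i *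
            1) * ((((N : ℝ) ^ d) ^ (q - 1))⁻¹ * (∑ i ∈ s, w i ^ (-(1 / (q - 1)))) ^ (q - 1)) := by
            simp only [mul_one]
            field_simp
        _ ≤ _ := by
            simp only [mul_one]
            rw [mul_assoc, mul_comm C]
            exact mul_le_mul_of_nonneg_left h0 (by positivity)
    have h2 := ENNReal.ofReal_le_ofReal h1
    rw [ENNReal.ofReal_mul (Real.rpow_nonneg hT _), ENNReal.ofReal_mul hC.le,
      ← ENNReal.ofReal_rpow_of_nonneg hT (by linarith),
      ← ENNReal.ofReal_rpow_of_nonneg hN0.le (by linarith), ENNReal.ofReal_pow (by positivity),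
      ENNReal.ofReal_natCast, ENNReal.ofReal_sum_of_nonneg (fun i _ => (hpos i).le),
      ENNReal.ofReal_sum_of_nonneg (fun i _ => Real.rpow_nonneg (hpos i).le _)] at h2
    calc _ ≤ _ := mul_le_mul_left (holder_weight_sum hq hpos s c) _
      _ = (∑ i ∈ s, c i ^ q * ENNReal.ofReal (w i)) *
        ((∑ i ∈ s, ENNReal.ofReal (w i ^ (-(1 / (q - 1))))) ^ (q - 1) *
          ∑ i ∈ s, ENNReal.ofReal (w i)) := by rw [mul_assoc]
      _ ≤ _ := by rw [mul_comm]; gcongr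
  · refine ⟨ENNReal.ofReal C, ENNReal.ofReal_ne_top, fun a N hN c => ?_⟩
    have hN0 : (0 : ℝ) < (N : ℝ) ^ d := by positivity
    simp only [ENNReal.rpow_one]
    rw [Finset.sum_mul, Finset.mul_sum]
    refine Finset.sum_le_sum fun i hi => ?_
    have h0 := h a N hN i hi
    rw [cubeAverage, inv_mul_le_iff₀ hN0] at h0
    have h2 := ENNReal.ofReal_le_ofReal h0
    rw [ENNReal.ofReal_sum_of_nonneg (fun i _ => (hpos i).le), ENNReal.ofReal_mul hN0.le,
      ENNReal.ofReal_mul hC.le, ENNReal.ofReal_pow (by positivity), ENNReal.ofReal_natCast] at h2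
    calc _ ≤ _ := mul_le_mul_right h2 (c i)
      _ = _ := by ring

/-! ### Ball sums and convolution kernels on the weighted space -/

section Averages

variable {d : ℕ} {q : ℝ} {W : (Fin d → ℤ) → ℝ≥0∞} {C : ℝ≥0∞}

theorem mem_discreteCube {a i : Fin d → ℤ} {N : ℕ} :
    i ∈ discreteCube a N ↔ ∀ k, a k ≤ i k ∧ i k < a k + N := by
  rw [discreteCube, Finset.mem_Icc, Pi.le_def, Pi.le_def, ← forall_and]
  refine forall_congr' fun k => ?_
  constructor <;> rintro ⟨h1, h2⟩ <;> constructor <;> omega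

theorem card_discreteCube (a : Fin d → ℤ) (N : ℕ) : (discreteCube a N).card = N ^ d := by
  rw [discreteCube, Pi.card_Icc]
  simp

theorem sum_discreteCube (a : Fin d → ℤ) (N : ℕ) (h : (Fin d → ℤ) → ℝ≥0∞) :
    ∑ i ∈ discreteCube a N, h i = ∑ s ∈ discreteCube 0 N, h (a + s) := by
  refine Finset.sum_nbij' (fun i => i - a) (fun s => a + s) ?_ ?_ ?_ ?_ ?_
  · intro i hi
    rw [mem_discreteCube] at hi ⊢
    intro k
    have := hi k
    simp only [Pi.sub_apply, Pi.zero_apply]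
    omega
  · intro i hi
    rw [mem_discreteCube] at hi ⊢
    intro k
    have := hi k
    simp only [Pi.add_apply, Pi.zero_apply] at this ⊢
    omega
  · intro i _; simp
  · intro i _; simp
  · intro i _; simp

/-- Every lattice point lies in exactly N^d of the translated cubes. -/
theorem tsum_sum_discreteCube (b : Fin d → ℤ) (N : ℕ) (h : (Fin d → ℤ) → ℝ≥0∞) :
    ∑' a, ∑ i ∈ discreteCube (a + b) N, h i = (N : ℝ≥0∞) ^ d * ∑' i, h i := by
  have h0 : ∀ a, ∑ i ∈ discreteCube (a + b) N, h i = ∑ s ∈ discreteCube 0 N, h (a + b + s) :=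
    fun a => sum_discreteCube _ _ _
  simp only [h0]
  rw [Summable.tsum_finsetSum fun _ _ => ENNReal.summable]
  have : ∀ s ∈ discreteCube (0 : Fin d → ℤ) N, ∑' a, h (a + b + s) = ∑' i, h i := by
    intro s _
    simp_rw [add_assoc]
    exact (Equiv.addRight (b + s)).tsum_eq h
  rw [Finset.sum_congr rfl this, Finset.sum_const, card_discreteCube]
  simp

/-- The sums over the balls of radius `r` are bounded on `ℓ^q_w`. -/
theorem CubeBound.tsum_ball_le (hC : CubeBound q W C) (hq : 1 ≤ q) (r : ℕ)
    (c : (Fin d → ℤ) → ℝ≥0∞) :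
    ∑' i, (∑ s ∈ latticeBall d r, c (i + s)) ^ q * W i ≤
      C * 3 ^ d * (((3 * (r + 1) : ℕ) : ℝ≥0∞) ^ d) ^ q * ∑' i, c i ^ q * W i := by
  set L := r + 1 with hL
  set g : (Fin d → ℤ) → ℝ≥0∞ := fun i => ∑ s ∈ latticeBall d r, c (i + s) with hg
  have hLd0 : (L : ℝ≥0∞) ^ d ≠ 0 := by simp [hL]
  have hLdt : (L : ℝ≥0∞) ^ d ≠ ∞ := ENNReal.pow_ne_top (ENNReal.natCast_ne_top _)
  set b : Fin d → ℤ := fun _ => -(r : ℤ) with hb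
  -- All balls of radius r centred in a cube of side r + 1 lie in one cube of side 3(r + 1), so a
  -- single cube average controls them.
  have hgi : ∀ a, ∀ i ∈ discreteCube a L, g i ≤ ∑ j ∈ discreteCube (a + b) (3 * L), c j := by
    intro a i hi
    rw [mem_discreteCube] at hi
    have : g i = ∑ j ∈ (latticeBall d r).image (i + ·), c j := by
      rw [Finset.sum_image fun x _ y _ h => add_left_cancel h]
    rw [this]
    refine Finset.sum_le_sum_of_subset fun j hj => ?_
    obtain ⟨s, hs, rfl⟩ := Finset.mem_image.1 hj
    rw [latticeBall, Finset.mem_Icc] at hs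
    rw [mem_discreteCube]
    intro k
    have h1 := hi k
    have h2 := hs.1 k
    have h3 := hs.2 k
    simp only [Pi.add_apply, hb] at *
    push_cast
    omega
  have hsub : ∀ a, discreteCube a L ⊆ discreteCube (a + b) (3 * L) := by
    intro a i hi
    rw [mem_discreteCube] at hi ⊢
    intro k
    have h1 := hi k
    simp only [Pi.add_apply, hb] at *
    push_cast
    omega
  have hcube : ∀ a, ∑ i ∈ discreteCube a L, g i ^ q * W i ≤
      C * (((3 * L : ℕ) : ℝ≥0∞) ^ d) ^ q * ∑ i ∈ discreteCube (a + b) (3 * L), c i ^ q * W i := by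
    intro a
    refine le_trans ?_ (hC (a + b) (3 * L) (by omega) c)
    rw [Finset.mul_sum]
    refine le_trans (Finset.sum_le_sum fun i hi => ?_) (Finset.sum_le_sum_of_subset (hsub a))
    gcongr
    exact hgi a i hi
  -- Summing over all translates counts points L^d times on the left and (3L)^d times on the right;
  -- the quotient is the factor 3^d.
  have key := ENNReal.tsum_le_tsum hcube
  rw [ENNReal.tsum_mul_left, tsum_sum_discreteCube] at key
  have h0 := tsum_sum_discreteCube (0 : Fin d → ℤ) L (fun i => g i ^ q * W i)
  simp only [add_zero] at h0
  rw [h0] at key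
  rw [← ENNReal.mul_le_mul_iff_right hLd0 hLdt]
  refine key.trans (le_of_eq ?_)
  push_cast
  rw [mul_pow]
  ring

theorem exists_nat_norm_eq (k : Fin d → ℤ) : ∃ n : ℕ, ‖k‖ = n := by
  rcases isEmpty_or_nonempty (Fin d) with h | h
  · exact ⟨0, by simp [Subsingleton.elim k 0]⟩
  · obtain ⟨i, -, hi⟩ := Finset.exists_mem_eq_sup Finset.univ Finset.univ_nonempty fun i => ‖k i‖₊
    exact ⟨(k i).natAbs, by
      rw [Pi.norm_def, hi, coe_nnnorm, Int.norm_eq_abs, Nat.cast_natAbs, Int.cast_abs]⟩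

/-- A kernel is dominated by a superposition of normalised indicator functions of balls. -/
theorem le_tsum_radialSup (f : (Fin d → ℤ) → ℝ≥0∞) (x : Fin d → ℤ) :
    f x ≤ 2 ^ d * ∑' k : Fin d → ℤ, radialSup f ‖k‖ *
      (((⌊‖k‖⌋₊ + 1 : ℕ) : ℝ≥0∞) ^ d)⁻¹ * (if ‖x‖ ≤ 2 * ‖k‖ then 1 else 0) := by
  obtain ⟨n, hn⟩ := exists_nat_norm_eq x
  -- The cube [m, n]^d consists of points k with ‖x‖/2 ≤ ‖k‖ ≤ ‖x‖, for which the indicator is one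
  -- and the majorant at ‖k‖ is at least f(x). It has (n/2 + 1)^d points (integer division), at
  -- least a 2^{-d} fraction of (n + 1)^d.
  set m := n - n / 2 with hm
  set s : Finset (Fin d → ℤ) := discreteCube (fun _ => (m : ℤ)) (n / 2 + 1) with hs
  rcases isEmpty_or_nonempty (Fin d) with hd | hd
  · have h0 : ∀ y : Fin d → ℤ, y = 0 := fun y => Subsingleton.elim y 0
    have hd0 : d = 0 := by
      by_contra h
      exact hd.elim ⟨0, Nat.pos_of_ne_zero h⟩
    subst hd0
    rw [tsum_eq_single 0 (fun y hy => absurd (h0 y) hy), h0 x,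
      if_pos (by rw [norm_zero, mul_zero])]
    simpa using le_radialSup (f := f) (x := 0) (r := ‖(0 : Fin 0 → ℤ)‖) le_rfl
  have hnorm : ∀ k ∈ s, (m : ℝ) ≤ ‖k‖ ∧ ‖k‖ ≤ n := by
    intro k hk
    rw [hs, mem_discreteCube] at hk
    constructor
    · obtain ⟨i⟩ := hd
      refine le_trans ?_ (norm_le_pi_norm k i)
      rw [Int.norm_eq_abs]
      refine le_trans ?_ (le_abs_self _)
      exact_mod_cast (hk i).1
    · rw [pi_norm_le_iff_of_nonneg (by positivity)]
      intro i
      have h1 := hk i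
      rw [Int.norm_eq_abs, abs_of_nonneg (by
        have : (0 : ℤ) ≤ k i := by omega
        exact_mod_cast this)]
      have : k i ≤ n := by omega
      exact_mod_cast this
  have hterm : ∀ k ∈ s, f x * (((n + 1 : ℕ) : ℝ≥0∞) ^ d)⁻¹ ≤ radialSup f ‖k‖ *
      (((⌊‖k‖⌋₊ + 1 : ℕ) : ℝ≥0∞) ^ d)⁻¹ * (if ‖x‖ ≤ 2 * ‖k‖ then 1 else 0) := by
    intro k hk
    obtain ⟨h1, h2⟩ := hnorm k hk
    rw [if_pos, mul_one]
    · gcongr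
      · exact le_radialSup (by rw [hn]; exact h2)
      · exact Nat.floor_le_of_le h2
    · rw [hn]
      have : (n : ℝ) ≤ 2 * m := by
        have : n ≤ 2 * m := by omega
        exact_mod_cast this
      linarith
  have hcard : ((n + 1 : ℕ) : ℝ≥0∞) ^ d ≤ 2 ^ d * s.card := by
    rw [hs, card_discreteCube]
    have : (n + 1) ^ d ≤ 2 ^ d * (n / 2 + 1) ^ d := by
      rw [← mul_pow]
      exact Nat.pow_le_pow_left (by omega) d
    exact_mod_cast this
  have hp0 : ((n + 1 : ℕ) : ℝ≥0∞) ^ d ≠ 0 := by simp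
  have hpt : ((n + 1 : ℕ) : ℝ≥0∞) ^ d ≠ ∞ := ENNReal.pow_ne_top (ENNReal.natCast_ne_top _)
  calc f x = ((n + 1 : ℕ) : ℝ≥0∞) ^ d * (f x * (((n + 1 : ℕ) : ℝ≥0∞) ^ d)⁻¹) := by
        rw [mul_left_comm, ENNReal.mul_inv_cancel hp0 hpt, mul_one]
    _ ≤ 2 ^ d * s.card * (f x * (((n + 1 : ℕ) : ℝ≥0∞) ^ d)⁻¹) := by gcongr
    _ = 2 ^ d * ∑ k ∈ s, f x * (((n + 1 : ℕ) : ℝ≥0∞) ^ d)⁻¹ := by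
        rw [Finset.sum_const, nsmul_eq_mul, mul_assoc]
    _ ≤ _ := by
        gcongr
        exact (Finset.sum_le_sum hterm).trans (ENNReal.sum_le_tsum _)

/-- Jensen's inequality for the power q with the unnormalised weights `D`. -/
theorem tsum_mul_rpow_le {ι : Type*} {q : ℝ} (hq : 1 ≤ q) (D a : ι → ℝ≥0∞) :
    (∑' k, D k * a k) ^ q ≤ (∑' k, D k) ^ (q - 1) * ∑' k, D k * a k ^ q := by
  have hq0 : 0 < q := by linarith
  have hinv : q⁻¹ ≤ 1 := inv_le_one_of_one_le₀ hq
  have h1 : ∑' k, D k * a k ≤ (∑' k, D k) ^ (1 - q⁻¹) * (∑' k, D k * a k ^ q) ^ q⁻¹ := by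
    rw [ENNReal.tsum_eq_iSup_sum]
    refine iSup_le fun s => (ENNReal.inner_le_weight_mul_Lp_of_nonneg s hq D a).trans ?_
    gcongr
    · exact ENNReal.sum_le_tsum _
    · exact ENNReal.sum_le_tsum _
  calc _ ≤ _ := ENNReal.rpow_le_rpow h1 hq0.le
    _ = _ := by
      rw [ENNReal.mul_rpow_of_nonneg _ _ hq0.le, ← ENNReal.rpow_mul, ← ENNReal.rpow_mul,
        inv_mul_cancel₀ hq0.ne', ENNReal.rpow_one]
      congr 2
      field_simp

/-- Kernels with summable radial majorant act boundedly on `ℓ^q_w`. -/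
theorem CubeBound.tsum_kernel_le (hC : CubeBound q W C) (hq : 1 ≤ q)
    (f c : (Fin d → ℤ) → ℝ≥0∞) :
    ∑' i, (∑' j, f (i - j) * c j) ^ q * W i ≤
      ((12 : ℝ≥0∞) ^ d) ^ q * 3 ^ d * C * radialSum 1 f ^ q * ∑' i, c i ^ q * W i := by
  have hq0 : 0 ≤ q := by linarith
  set D : (Fin d → ℤ) → ℝ≥0∞ := fun k => radialSup f ‖k‖ with hD
  set ν : (Fin d → ℤ) → ℕ := fun k => ⌊‖k‖⌋₊ with hν
  have hνk : ∀ k, ‖k‖ = ν k := by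
    intro k
    obtain ⟨n, hn⟩ := exists_nat_norm_eq k
    simp [hν, hn]
  set g : ℕ → (Fin d → ℤ) → ℝ≥0∞ := fun r i => ∑ s ∈ latticeBall d r, c (i + s) with hg
  set a : (Fin d → ℤ) → (Fin d → ℤ) → ℝ≥0∞ :=
    fun i k => (((ν k + 1 : ℕ) : ℝ≥0∞) ^ d)⁻¹ * g (2 * ν k) i with ha
  have hball : ∀ i k, ∑' j, (if ‖i - j‖ ≤ 2 * ‖k‖ then 1 else 0) * c j = g (2 * ν k) i := by
    intro i k
    rw [← (Equiv.addLeft i).tsum_eq, tsum_eq_sum (s := latticeBall d (2 * ν k))]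
    · refine Finset.sum_congr rfl fun s hs => ?_
      rw [mem_latticeBall] at hs
      rw [if_pos, one_mul]
      · rfl
      · rw [Equiv.coe_addLeft, sub_add_cancel_left, norm_neg, hνk k]
        exact_mod_cast hs
    · intro s hs
      rw [mem_latticeBall] at hs
      rw [if_neg, zero_mul]
      rw [Equiv.coe_addLeft, sub_add_cancel_left, norm_neg, hνk k]
      exact_mod_cast hs
  have hpt : ∀ i, ∑' j, f (i - j) * c j ≤ 2 ^ d * ∑' k, D k * a i k := by
    intro i
    calc ∑' j, f (i - j) * c j
        ≤ ∑' j, ∑' k, 2 ^ d * (D k * (((ν k + 1 : ℕ) : ℝ≥0∞) ^ d)⁻¹ *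
            ((if ‖i - j‖ ≤ 2 * ‖k‖ then 1 else 0) * c j)) := by
          refine ENNReal.tsum_le_tsum fun j => ?_
          refine (mul_le_mul_left (le_tsum_radialSup f (i - j)) _).trans (le_of_eq ?_)
          rw [ENNReal.tsum_mul_left, mul_assoc, ← ENNReal.tsum_mul_right]
          congr 1
          exact tsum_congr fun k => by rw [mul_assoc]
      _ = _ := by
          rw [ENNReal.tsum_comm, ← ENNReal.tsum_mul_left]
          refine tsum_congr fun k => ?_
          rw [ENNReal.tsum_mul_left, ENNReal.tsum_mul_left, hball, ha, mul_assoc]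
  -- The radius 2ν(k) costs (3(2ν(k)+1))^d ≤ 6^d (ν(k)+1)^d, which the normalisation of the ball sum
  -- cancels; the bound is uniform in k.
  have hak : ∀ k, ∑' i, a i k ^ q * W i ≤
      C * 3 ^ d * ((6 : ℝ≥0∞) ^ d) ^ q * ∑' i, c i ^ q * W i := by
    intro k
    have hp0 : ((ν k + 1 : ℕ) : ℝ≥0∞) ^ d ≠ 0 := by simp
    have hpt : ((ν k + 1 : ℕ) : ℝ≥0∞) ^ d ≠ ∞ := ENNReal.pow_ne_top (ENNReal.natCast_ne_top _)
    have h1 : ((3 * (2 * ν k + 1) : ℕ) : ℝ≥0∞) ^ d ≤ 6 ^ d * ((ν k + 1 : ℕ) : ℝ≥0∞) ^ d := by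
      rw [← mul_pow]
      have : 3 * (2 * ν k + 1) ≤ 6 * (ν k + 1) := by omega
      gcongr
      exact_mod_cast this
    have h2 := hC.tsum_ball_le hq (2 * ν k) c
    calc ∑' i, a i k ^ q * W i
        = ((((ν k + 1 : ℕ) : ℝ≥0∞) ^ d)⁻¹) ^ q * ∑' i, g (2 * ν k) i ^ q * W i := by
          rw [← ENNReal.tsum_mul_left]
          refine tsum_congr fun i => ?_
          rw [ha, ENNReal.mul_rpow_of_nonneg _ _ hq0, mul_assoc]
      _ ≤ ((((ν k + 1 : ℕ) : ℝ≥0∞) ^ d)⁻¹) ^ q * (C * 3 ^ d *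
          ((6 : ℝ≥0∞) ^ d * ((ν k + 1 : ℕ) : ℝ≥0∞) ^ d) ^ q * ∑' i, c i ^ q * W i) := by
          gcongr
          refine h2.trans ?_
          gcongr
      _ = ((((ν k + 1 : ℕ) : ℝ≥0∞) ^ d)⁻¹ * ((ν k + 1 : ℕ) : ℝ≥0∞) ^ d) ^ q * (C * 3 ^ d *
          ((6 : ℝ≥0∞) ^ d) ^ q * ∑' i, c i ^ q * W i) := by
          rw [ENNReal.mul_rpow_of_nonneg _ _ hq0, ENNReal.mul_rpow_of_nonneg _ _ hq0]
          ring
      _ = _ := by rw [ENNReal.inv_mul_cancel hp0 hpt, ENNReal.one_rpow, one_mul]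
  have hDS : ∑' k, D k = radialSum 1 f := (radialSum_one f).symm
  have h12 : ((12 : ℝ≥0∞) ^ d) ^ q = ((2 : ℝ≥0∞) ^ d) ^ q * ((6 : ℝ≥0∞) ^ d) ^ q := by
    rw [← ENNReal.mul_rpow_of_nonneg _ _ hq0, ← mul_pow]
    norm_num
  have hSq : radialSum 1 f ^ q ≥ radialSum 1 f ^ (q - 1) * radialSum 1 f := by
    conv_lhs => rw [show q = (q - 1) + 1 by ring]
    rw [ENNReal.rpow_add_of_nonneg _ _ (by linarith) (by norm_num), ENNReal.rpow_one]
  calc ∑' i, (∑' j, f (i - j) * c j) ^ q * W i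
      ≤ ∑' i, ((2 : ℝ≥0∞) ^ d) ^ q * radialSum 1 f ^ (q - 1) *
          ∑' k, D k * (a i k ^ q * W i) := by
        refine ENNReal.tsum_le_tsum fun i => ?_
        calc _ ≤ (2 ^ d * ∑' k, D k * a i k) ^ q * W i := by gcongr; exact hpt i
          _ ≤ ((2 : ℝ≥0∞) ^ d) ^ q * ((∑' k, D k) ^ (q - 1) * ∑' k, D k * a i k ^ q) * W i := by
            rw [ENNReal.mul_rpow_of_nonneg _ _ hq0]
            gcongr
            exact tsum_mul_rpow_le hq _ _
          _ = _ := by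
            rw [hDS, mul_assoc, mul_assoc, mul_assoc, ← ENNReal.tsum_mul_right]
            simp only [mul_assoc]
    _ = ((2 : ℝ≥0∞) ^ d) ^ q * radialSum 1 f ^ (q - 1) * ∑' k, D k * ∑' i, a i k ^ q * W i := by
        rw [ENNReal.tsum_mul_left, ENNReal.tsum_comm]
        simp only [ENNReal.tsum_mul_left]
    _ ≤ ((2 : ℝ≥0∞) ^ d) ^ q * radialSum 1 f ^ (q - 1) * ∑' k, D k *
        (C * 3 ^ d * ((6 : ℝ≥0∞) ^ d) ^ q * ∑' i, c i ^ q * W i) := by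
        gcongr with k
        exact hak k
    _ = (((2 : ℝ≥0∞) ^ d) ^ q * ((6 : ℝ≥0∞) ^ d) ^ q) * 3 ^ d * C *
        (radialSum 1 f ^ (q - 1) * radialSum 1 f) * ∑' i, c i ^ q * W i := by
        rw [ENNReal.tsum_mul_right, hDS]
        ring
    _ ≤ _ := by
        rw [h12]
        gcongr

end Averages

/-! ### Operators on `ℓ^q_w` given by matrices -/

/-- The weighted norm of an arbitrary sequence, with values in `[0, ∞]`. -/
noncomputable def wlpENorm {ι : Type*} (q : ℝ) (w : ι → ℝ) (c : ι → ℂ) : ℝ≥0∞ :=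
  (∑' i, ‖c i‖ₑ ^ q * ENNReal.ofReal (w i)) ^ (1 / q)

section WlpGeneral

variable {ι : Type*} {q : ℝ} {w : ι → ℝ} [hq : Fact (1 ≤ q)]

theorem q_pos (q : ℝ) [Fact (1 ≤ q)] : 0 < q := zero_lt_one.trans_le Fact.out

theorem weight_pos (w : ι → ℝ) [hw : Fact (∀ i, 0 < w i)] (i : ι) : 0 < w i := hw.out i

theorem ofReal_norm_rpow_mul (c : ι → ℂ) (i : ι) :
    ENNReal.ofReal (‖c i‖ ^ q * w i) = ‖c i‖ₑ ^ q * ENNReal.ofReal (w i) := by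
  rw [ENNReal.ofReal_mul (by positivity), ← ENNReal.ofReal_rpow_of_nonneg (norm_nonneg _)
    (q_pos q).le, ofReal_norm]

theorem wlpENorm_rpow (c : ι → ℂ) :
    wlpENorm q w c ^ q = ∑' i, ‖c i‖ₑ ^ q * ENNReal.ofReal (w i) := by
  rw [wlpENorm, ← ENNReal.rpow_mul, one_div_mul_cancel (q_pos q).ne', ENNReal.rpow_one]

theorem wlpENorm_mono {c e : ι → ℂ} (h : ∀ i, ‖c i‖ₑ ≤ ‖e i‖ₑ) :
    wlpENorm q w c ≤ wlpENorm q w e := by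
  have := q_pos q
  unfold wlpENorm
  gcongr with i
  exact h i

theorem enorm_apply_mul_le (c : ι → ℂ) (i : ι) :
    ‖c i‖ₑ * ENNReal.ofReal (w i) ^ (1 / q) ≤ wlpENorm q w c := by
  have hq0 := q_pos q
  have h := ENNReal.le_tsum (f := fun i => ‖c i‖ₑ ^ q * ENNReal.ofReal (w i)) i
  have h2 := ENNReal.rpow_le_rpow h (z := 1 / q) (by positivity)
  rwa [ENNReal.mul_rpow_of_nonneg _ _ (by positivity), ← ENNReal.rpow_mul,
    mul_one_div_cancel hq0.ne', ENNReal.rpow_one] at h2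

theorem memWlp_single [DecidableEq ι] (j : ι) : MemWlp q w (Pi.single j 1) := by
  refine summable_of_hasFiniteSupport ((Set.finite_singleton j).subset fun i hi => ?_)
  by_contra h
  apply hi
  simp [Pi.single_eq_of_ne h, Real.zero_rpow (q_pos q).ne']

variable [hw : Fact (∀ i, 0 < w i)]

theorem memWlp_iff (c : ι → ℂ) : MemWlp q w c ↔ wlpENorm q w c < ∞ := by
  have hnn : ∀ i, 0 ≤ ‖c i‖ ^ q * w i := fun i => mul_nonneg (by positivity) (weight_pos w i).le
  rw [wlpENorm, ENNReal.rpow_lt_top_iff_of_pos (by simpa using q_pos q)]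
  simp_rw [← ofReal_norm_rpow_mul]
  constructor
  · intro h
    exact (Summable.tsum_ofReal_lt_top h)
  · intro h
    have := ENNReal.summable_toReal h.ne
    simp only [ENNReal.toReal_ofReal (hnn _)] at this
    exact this

theorem wlp_enorm_eq (c : Wlp q w) : ‖c‖ₑ = wlpENorm q w c := by
  have hnn : ∀ i, 0 ≤ ‖c i‖ ^ q * w i := fun i => mul_nonneg (by positivity) (weight_pos w i).le
  rw [← ofReal_norm, wlp_norm_def, wlpENorm, ← ENNReal.ofReal_rpow_of_nonneg (tsum_nonneg hnn)
    (by have := q_pos q; positivity), ENNReal.ofReal_tsum_of_nonneg hnn c.2]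
  simp only [ofReal_norm_rpow_mul]

@[simp] theorem wlp_add_apply (c e : Wlp q w) (i : ι) : (c + e) i = c i + e i := rfl

@[simp] theorem wlp_sub_apply (c e : Wlp q w) (i : ι) : (c - e) i = c i - e i := rfl

@[simp] theorem wlp_smul_apply (a : ℂ) (c : Wlp q w) (i : ι) : (a • c) i = a * c i := rfl

@[simp] theorem wlp_zero_apply (i : ι) : (0 : Wlp q w) i = 0 := rfl

theorem wlp_ext {c e : Wlp q w} (h : ∀ i, c i = e i) : c = e := Subtype.ext (funext h)

/-- The sequence with prescribed entries, if it lies in `ℓ^q_w`. -/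
def wlpMk (c : ι → ℂ) (h : MemWlp q w c) : Wlp q w := ⟨c, h⟩

@[simp] theorem wlpMk_apply (c : ι → ℂ) (h : MemWlp q w c) (i : ι) : wlpMk c h i = c i := rfl

/-- The evaluation functionals on `ℓ^q_w`. -/
noncomputable def wlpEval (i : ι) : Wlp q w →L[ℂ] ℂ :=
  LinearMap.mkContinuous
    { toFun := fun c => c i
      map_add' := fun _ _ => rfl
      map_smul' := fun _ _ => rfl } (w i ^ (1 / q))⁻¹ (by
    intro c
    have hwi : 0 < w i ^ (1 / q) := Real.rpow_pos_of_pos (weight_pos w i) _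
    have h := enorm_apply_mul_le (q := q) (w := w) c i
    rw [← wlp_enorm_eq, ENNReal.ofReal_rpow_of_pos (weight_pos w i), ← ofReal_norm, ← ofReal_norm,
      ← ENNReal.ofReal_mul (norm_nonneg _), ENNReal.ofReal_le_ofReal_iff (norm_nonneg _)] at h
    rw [inv_mul_eq_div, le_div_iff₀ hwi]
    exact h)

theorem wlp_sum_apply {β : Type*} (s : Finset β) (f : β → Wlp q w) (i : ι) :
    (∑ b ∈ s, f b) i = ∑ b ∈ s, f b i := by
  exact map_sum (wlpEval (q := q) (w := w) i) f s

variable [DecidableEq ι]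

/-- The unit sequences in `ℓ^q_w`. -/
def wlpSingle (j : ι) : Wlp q w := wlpMk (Pi.single j 1) (memWlp_single j)

theorem wlpSingle_apply (j i : ι) :
    (wlpSingle j : Wlp q w) i = (Pi.single j 1 : ι → ℂ) i := rfl

theorem wlpENorm_single (j : ι) :
    ‖(wlpSingle j : Wlp q w)‖ₑ = ENNReal.ofReal (w j) ^ (1 / q) := by
  rw [wlp_enorm_eq, wlpENorm, tsum_eq_single j]
  · simp [wlpSingle_apply]
  · intro i hi
    simp [wlpSingle_apply, Pi.single_eq_of_ne hi, q_pos q]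

/-- The norm of the remainder is the q-th root of a tail of a convergent series. Bounded operators
are therefore determined by their matrix entries. -/
theorem hasSum_wlpSingle (c : Wlp q w) : HasSum (fun j => c j • (wlpSingle j : Wlp q w)) c := by
  have hq0 := q_pos q
  have key : ∀ s : Finset ι, ‖c - ∑ j ∈ s, c j • (wlpSingle j : Wlp q w)‖ₑ =
      (∑' i : {x // x ∉ s}, ‖c i‖ₑ ^ q * ENNReal.ofReal (w i)) ^ (1 / q) := by
    intro s
    have happ : ∀ i, (c - ∑ j ∈ s, c j • (wlpSingle j : Wlp q w)) i = if i ∈ s then 0 else c i := by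
      intro i
      rw [wlp_sub_apply, wlp_sum_apply]
      simp only [wlp_smul_apply, wlpSingle_apply, Pi.single_apply, mul_ite, mul_one, mul_zero,
        Finset.sum_ite_eq]
      split_ifs <;> simp
    rw [wlp_enorm_eq, wlpENorm]
    congr 1
    simp only [happ]
    rw [← tsum_subtype_eq_of_support_subset (s := {x | x ∉ s})]
    · exact tsum_congr fun i => by rw [if_neg i.2]
    · intro i hi his
      apply hi
      simp [his, hq0]
  have hfin : ∑' i, ‖c i‖ₑ ^ q * ENNReal.ofReal (w i) ≠ ∞ := by
    rw [← wlpENorm_rpow, ← wlp_enorm_eq]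
    exact (ENNReal.rpow_lt_top_of_nonneg hq0.le enorm_ne_top).ne
  have h := (ENNReal.tendsto_tsum_compl_atTop_zero hfin).ennrpow_const (1 / q)
  rw [ENNReal.zero_rpow_of_pos (by positivity)] at h
  rw [HasSum, SummationFilter.unconditional_filter, tendsto_iff_edist_tendsto_0]
  refine h.congr fun s => ?_
  rw [edist_comm, edist_eq_enorm_sub, key]

theorem wlp_clm_ext {E : Type*} [NormedAddCommGroup E] [NormedSpace ℂ E] {T S : Wlp q w →L[ℂ] E}
    (h : ∀ j, T (wlpSingle j) = S (wlpSingle j)) : T = S := by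
  ext c
  have h1 := T.hasSum (hasSum_wlpSingle c)
  have h2 := S.hasSum (hasSum_wlpSingle c)
  simp only [map_smul, h] at h1 h2
  exact h1.unique h2

theorem IsMatrixOf.apply_single {A : Matrix ι ι ℂ} {T : Wlp q w →L[ℂ] Wlp q w}
    (h : IsMatrixOf A T) (i j : ι) : T (wlpSingle j) i = A i j := by
  refine (h (wlpSingle j) i).unique ?_
  have := hasSum_single (f := fun k => A i k * (wlpSingle j : Wlp q w) k) j fun k hk => by
    rw [wlpSingle_apply, Pi.single_eq_of_ne hk, mul_zero]
  simpa [wlpSingle_apply] using this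

end WlpGeneral

/-- The convolution kernel dominating a matrix. -/
noncomputable def matrixKernel {d : ℕ} (A : Matrix (Fin d → ℤ) (Fin d → ℤ) ℂ)
    (x : Fin d → ℤ) : ℝ≥0∞ := ⨆ j, ‖A (x + j) j‖ₑ

/-- The matrix product, as a series. -/
noncomputable def matrixProd {ι : Type*} (A B : Matrix ι ι ℂ) : Matrix ι ι ℂ :=
  fun i j => ∑' k, A i k * B k j

/-! ### Domination of matrices and their products by convolution kernels -/

section Kernel

variable {d : ℕ} {A B : Matrix (Fin d → ℤ) (Fin d → ℤ) ℂ}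

theorem enorm_le_matrixKernel (A : Matrix (Fin d → ℤ) (Fin d → ℤ) ℂ) (i j : Fin d → ℤ) :
    ‖A i j‖ₑ ≤ matrixKernel A (i - j) := by
  have := le_iSup (fun j' => ‖A (i - j + j') j'‖ₑ) j
  simpa [matrixKernel] using this

theorem matrixKernel_le {f : (Fin d → ℤ) → ℝ≥0∞} (h : ∀ i j, ‖A i j‖ₑ ≤ f (i - j))
    (x : Fin d → ℤ) : matrixKernel A x ≤ f x :=
  iSup_le fun j => by simpa using h (x + j) j

theorem matrixKernel_add_le (x : Fin d → ℤ) :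
    matrixKernel (A + B) x ≤ matrixKernel A x + matrixKernel B x :=
  matrixKernel_le (f := fun x => matrixKernel A x + matrixKernel B x) (fun i j =>
    (enorm_add_le _ _).trans (add_le_add (enorm_le_matrixKernel A i j)
      (enorm_le_matrixKernel B i j))) x

/-- No summability is needed, because a divergent series has the default sum `0`. -/
theorem enorm_tsum_le {ι : Type*} (f : ι → ℂ) : ‖∑' i, f i‖ₑ ≤ ∑' i, ‖f i‖ₑ := by
  by_cases h : Summable f
  · refine le_of_tendsto (h.hasSum.enorm) (Eventually.of_forall fun s => ?_)
    exact (enorm_sum_le s f).trans (ENNReal.sum_le_tsum s)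
  · simp [tsum_eq_zero_of_not_summable h]

theorem matrixKernel_prod_le (x : Fin d → ℤ) :
    matrixKernel (matrixProd A B) x ≤ kernelConv (matrixKernel A) (matrixKernel B) x := by
  refine matrixKernel_le (fun i j => ?_) x
  refine (enorm_tsum_le _).trans ?_
  unfold kernelConv
  rw [← (Equiv.subLeft i).tsum_eq]
  refine ENNReal.tsum_le_tsum fun k => ?_
  rw [enorm_mul]
  refine mul_le_mul' ((enorm_le_matrixKernel A _ _).trans (by simp))
    ((enorm_le_matrixKernel B _ _).trans (le_of_eq ?_))
  congr 1
  simp only [Equiv.subLeft_apply]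
  abel

end Kernel

section Operators

variable {d : ℕ} {q : ℝ} {w : (Fin d → ℤ) → ℝ} [hq : Fact (1 ≤ q)]

/-- The constant `K` bounds the operators with a summable radial majorant on `ℓ^q_w`. -/
def KernelBound (q : ℝ) (w : (Fin d → ℤ) → ℝ) (K : ℝ≥0∞) : Prop :=
  ∀ (f : (Fin d → ℤ) → ℝ≥0∞) (y z : (Fin d → ℤ) → ℂ),
    (∀ i, ‖z i‖ₑ ≤ ∑' j, f (i - j) * ‖y j‖ₑ) →
      wlpENorm q w z ≤ K * radialSum 1 f * wlpENorm q w y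

theorem CubeBound.exists_kernelBound {C : ℝ≥0∞} (hC : C ≠ ∞)
    (h : CubeBound q (fun i => ENNReal.ofReal (w i)) C) :
    ∃ K : ℝ≥0∞, K ≠ ∞ ∧ KernelBound q w K := by
  have hq0 := q_pos q
  refine ⟨(((12 : ℝ≥0∞) ^ d) ^ q * 3 ^ d * C) ^ (1 / q), ?_, fun f y z hz => ?_⟩
  · refine ENNReal.rpow_ne_top_of_nonneg (by positivity) (ENNReal.mul_ne_top
      (ENNReal.mul_ne_top (ENNReal.rpow_ne_top_of_nonneg hq0.le (ENNReal.pow_ne_top (by simp)))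
        (ENNReal.pow_ne_top (by simp))) hC)
  · have h1 := h.tsum_kernel_le hq.out f (fun j => ‖y j‖ₑ)
    have hp : 0 ≤ 1 / q := by positivity
    calc wlpENorm q w z
        ≤ (∑' i, (∑' j, f (i - j) * ‖y j‖ₑ) ^ q * ENNReal.ofReal (w i)) ^ (1 / q) := by
          unfold wlpENorm
          gcongr with i
          exact hz i
      _ ≤ _ := ENNReal.rpow_le_rpow h1 hp
      _ = _ := by
          rw [ENNReal.mul_rpow_of_nonneg _ _ hp, ENNReal.mul_rpow_of_nonneg _ _ hp,
            ← ENNReal.rpow_mul (radialSum 1 f), mul_one_div_cancel hq0.ne', ENNReal.rpow_one,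
            wlpENorm]

variable [hw : Fact (∀ i, 0 < w i)] {K : ℝ≥0∞} {A B : Matrix (Fin d → ℤ) (Fin d → ℤ) ℂ}

/-- If the sum at i were infinite, every multiple n of the unit sequence at i would be dominated by
it, and the norm bound would fail for large n. -/
theorem tsum_kernel_lt_top (hK : K ≠ ∞) (h : KernelBound q w K) {f : (Fin d → ℤ) → ℝ≥0∞}
    (hf : radialSum 1 f < ∞) (y : Wlp q w) (i : Fin d → ℤ) :
    ∑' j, f (i - j) * ‖y j‖ₑ < ∞ := by
  have hq0 := q_pos q
  by_contra hcon
  rw [not_lt, top_le_iff] at hcon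
  have hwi : ENNReal.ofReal (w i) ^ (1 / q) ≠ 0 := by
    have := weight_pos w i
    simp [this]
  have hfin : K * radialSum 1 f * ‖y‖ₑ < ∞ :=
    ENNReal.mul_lt_top (ENNReal.mul_lt_top hK.lt_top hf) enorm_lt_top
  obtain ⟨n, hn⟩ := ENNReal.exists_nat_mul_gt hwi hfin.ne
  have h1 := h f y (Pi.single i (n : ℂ)) (fun i' => by
    rcases eq_or_ne i' i with rfl | hne
    · simp [hcon]
    · simp [Pi.single_eq_of_ne hne])
  have h2 := enorm_apply_mul_le (q := q) (w := w) (Pi.single i (n : ℂ)) i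
  rw [← wlp_enorm_eq] at h1
  rw [Pi.single_eq_same] at h2
  have h3 : ‖(n : ℂ)‖ₑ = n := by
    rw [← ofReal_norm]; simp
  rw [h3] at h2
  exact absurd (h2.trans h1) (not_le.2 hn)

theorem summable_matrix_mul (hK : K ≠ ∞) (h : KernelBound q w K)
    (hA : radialSum 1 (matrixKernel A) < ∞) (c : Wlp q w) (i : Fin d → ℤ) :
    Summable fun j => A i j * c j := by
  have h1 : ∑' j, ‖A i j * c j‖ₑ < ∞ := by
    refine lt_of_le_of_lt (ENNReal.tsum_le_tsum fun j => ?_) (tsum_kernel_lt_top hK h hA c i)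
    rw [enorm_mul]
    gcongr
    exact enorm_le_matrixKernel A i j
  have h2 := ENNReal.summable_toReal h1.ne
  exact Summable.of_norm (by simpa only [toReal_enorm] using h2)

theorem enorm_tsum_matrix_le (c : (Fin d → ℤ) → ℂ) (i : Fin d → ℤ) :
    ‖∑' j, A i j * c j‖ₑ ≤ ∑' j, matrixKernel A (i - j) * ‖c j‖ₑ := by
  refine (enorm_tsum_le _).trans (ENNReal.tsum_le_tsum fun j => ?_)
  rw [enorm_mul]
  gcongr
  exact enorm_le_matrixKernel A i j

theorem exists_isMatrixOf (hK : K ≠ ∞) (h : KernelBound q w K)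
    (hA : radialSum 1 (matrixKernel A) < ∞) : ∃ T : Wlp q w →L[ℂ] Wlp q w, IsMatrixOf A T := by
  have hb : ∀ c : Wlp q w, wlpENorm q w (fun i => ∑' j, A i j * c j) ≤
      K * radialSum 1 (matrixKernel A) * ‖c‖ₑ := by
    intro c
    rw [wlp_enorm_eq]
    exact h _ _ _ fun i => enorm_tsum_matrix_le _ i
  have hfin : K * radialSum 1 (matrixKernel A) < ∞ := ENNReal.mul_lt_top hK.lt_top hA
  have hs := fun (c : Wlp q w) i => summable_matrix_mul hK h hA c i
  let L : Wlp q w →ₗ[ℂ] Wlp q w :=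
    { toFun := fun c => wlpMk (fun i => ∑' j, A i j * c j)
        ((memWlp_iff _).2 ((hb c).trans_lt (ENNReal.mul_lt_top hfin enorm_lt_top)))
      map_add' := fun c e => wlp_ext fun i => by
        simp only [wlpMk_apply, wlp_add_apply, mul_add]
        exact (hs c i).tsum_add (hs e i)
      map_smul' := fun a c => wlp_ext fun i => by
        simp only [wlpMk_apply, wlp_smul_apply, RingHom.id_apply, mul_left_comm _ a]
        exact tsum_mul_left }
  refine ⟨L.mkContinuous (K * radialSum 1 (matrixKernel A)).toReal fun c => ?_, fun c i => ?_⟩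
  · have h1 : ‖L c‖ₑ ≤ K * radialSum 1 (matrixKernel A) * ‖c‖ₑ := by
      rw [wlp_enorm_eq]; exact hb c
    have h2 := ENNReal.toReal_mono (ENNReal.mul_lt_top hfin enorm_lt_top).ne h1
    rwa [ENNReal.toReal_mul, toReal_enorm, toReal_enorm] at h2
  · exact (hs c i).hasSum

/-- Entries alone do not give the series representation. The summable majorant supplies an operator
given by the matrix `A`, and it agrees with `T` on the unit sequences. -/
theorem isMatrixOf_of_single (hK : K ≠ ∞) (h : KernelBound q w K)
    (hA : radialSum 1 (matrixKernel A) < ∞) {T : Wlp q w →L[ℂ] Wlp q w}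
    (hT : ∀ i j, T (wlpSingle j) i = A i j) : IsMatrixOf A T := by
  obtain ⟨S, hS⟩ := exists_isMatrixOf hK h hA
  have : T = S := wlp_clm_ext fun j => wlp_ext fun i => by rw [hT, hS.apply_single]
  rwa [this]

theorem IsMatrixOf.hasSum_mul_single {T S : Wlp q w →L[ℂ] Wlp q w} (hT : IsMatrixOf A T)
    (hS : IsMatrixOf B S) (i j : Fin d → ℤ) :
    HasSum (fun k => A i k * B k j) ((T * S) (wlpSingle j) i) := by
  have := hT (S (wlpSingle j)) i
  simp only [hS.apply_single] at this
  exact this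

theorem IsMatrixOf.mul_single {T S : Wlp q w →L[ℂ] Wlp q w} (hT : IsMatrixOf A T)
    (hS : IsMatrixOf B S) (i j : Fin d → ℤ) :
    (T * S) (wlpSingle j) i = matrixProd A B i j :=
  (hT.hasSum_mul_single hS i j).tsum_eq.symm

end Operators

/-! ### Multiplication operators and block decompositions -/

section Multiplication

variable {ι : Type*} {q : ℝ} {w : ι → ℝ} [hq : Fact (1 ≤ q)] [hw : Fact (∀ i, 0 < w i)]

theorem enorm_mul_le_of_norm_le_one {a : ℂ} (ha : ‖a‖ ≤ 1) (b : ℂ) : ‖a * b‖ₑ ≤ ‖b‖ₑ := by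
  rw [enorm_mul]
  refine mul_le_of_le_one_left' ?_
  rwa [← ofReal_norm, ENNReal.ofReal_le_one]

/-- Multiplication by a sequence bounded by one. -/
noncomputable def wlpMul (ψ : ι → ℂ) (hψ : ∀ i, ‖ψ i‖ ≤ 1) : Wlp q w →L[ℂ] Wlp q w :=
  have hb : ∀ c : Wlp q w, wlpENorm q w (fun i => ψ i * c i) ≤ ‖c‖ₑ := fun c =>
    (wlpENorm_mono fun i => enorm_mul_le_of_norm_le_one (hψ i) _).trans_eq (wlp_enorm_eq c).symm
  LinearMap.mkContinuous
    { toFun := fun c => wlpMk (fun i => ψ i * c i)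
        ((memWlp_iff _).2 ((hb c).trans_lt enorm_lt_top))
      map_add' := fun c e => wlp_ext fun i => mul_add _ _ _
      map_smul' := fun a c => wlp_ext fun i => mul_left_comm _ _ _ } 1 (by
    intro c
    rw [one_mul, ← toReal_enorm, ← toReal_enorm]
    refine ENNReal.toReal_mono enorm_ne_top ?_
    rw [wlp_enorm_eq]
    exact hb c)

@[simp] theorem wlpMul_apply (ψ : ι → ℂ) (hψ : ∀ i, ‖ψ i‖ ≤ 1) (c : Wlp q w) (i : ι) :
    wlpMul ψ hψ c i = ψ i * c i := rfl

theorem enorm_wlpMul_le (ψ : ι → ℂ) (hψ : ∀ i, ‖ψ i‖ ≤ 1) (c : Wlp q w) :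
    ‖wlpMul ψ hψ c‖ₑ ≤ ‖c‖ₑ := by
  rw [wlp_enorm_eq, wlp_enorm_eq]
  exact wlpENorm_mono fun i => enorm_mul_le_of_norm_le_one (hψ i) _

open Classical in
/-- The restriction of sequences to a set of indices. -/
noncomputable def wlpProj (s : Set ι) : Wlp q w →L[ℂ] Wlp q w :=
  wlpMul (fun i => if i ∈ s then 1 else 0) fun i => by split_ifs <;> simp

theorem wlpProj_apply_of_mem {s : Set ι} {i : ι} (h : i ∈ s) (c : Wlp q w) :
    wlpProj s c i = c i := by
  simp [wlpProj, h]

theorem wlpProj_apply_of_notMem {s : Set ι} {i : ι} (h : i ∉ s) (c : Wlp q w) :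
    wlpProj s c i = 0 := by
  simp [wlpProj, h]

theorem enorm_wlpProj_le (s : Set ι) (c : Wlp q w) : ‖wlpProj s c‖ₑ ≤ ‖c‖ₑ :=
  enorm_wlpMul_le _ _ c

theorem wlpProj_single_of_mem [DecidableEq ι] {s : Set ι} {j : ι} (h : j ∈ s) :
    wlpProj s (wlpSingle j : Wlp q w) = wlpSingle j := by
  refine wlp_ext fun i => ?_
  by_cases hi : i ∈ s
  · rw [wlpProj_apply_of_mem hi]
  · rw [wlpProj_apply_of_notMem hi, wlpSingle_apply, Pi.single_eq_of_ne]
    rintro rfl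
    exact hi h

theorem wlpProj_single_of_notMem [DecidableEq ι] {s : Set ι} {j : ι} (h : j ∉ s) :
    wlpProj s (wlpSingle j : Wlp q w) = 0 := by
  refine wlp_ext fun i => ?_
  by_cases hi : i ∈ s
  · rw [wlpProj_apply_of_mem hi, wlpSingle_apply, Pi.single_eq_of_ne, wlp_zero_apply]
    rintro rfl
    exact h hi
  · rw [wlpProj_apply_of_notMem hi, wlp_zero_apply]

/-- The expansion in unit sequences, regrouped along the fibres; for `blockIndex` this is the
decomposition into cubes. -/
theorem hasSum_wlpProj_fiber [DecidableEq ι] {β : Type*} (f : ι → β) (c : Wlp q w) :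
    HasSum (fun b => wlpProj (f ⁻¹' {b}) c) c := by
  have h := (Equiv.sigmaFiberEquiv f).hasSum_iff.2 (hasSum_wlpSingle c)
  refine h.sigma fun b => ?_
  have h2 := (wlpProj (q := q) (w := w) (f ⁻¹' {b})).hasSum (hasSum_wlpSingle c)
  simp only [map_smul] at h2
  have h3 := (hasSum_subtype_iff_of_support_subset (s := f ⁻¹' {b}) (fun j hj => by
    by_contra hcon
    apply hj
    change c j • wlpProj (f ⁻¹' {b}) (wlpSingle j) = 0
    rw [wlpProj_single_of_notMem hcon, smul_zero])).2 h2
  refine h3.congr_fun ?_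
  rintro ⟨j, hj⟩
  change c j • (wlpSingle j : Wlp q w) = c j • wlpProj (f ⁻¹' {b}) (wlpSingle j)
  rw [wlpProj_single_of_mem hj]

theorem HasSum.enorm_le_tsum {β E : Type*} [NormedAddCommGroup E] {f : β → E} {a : E}
    (h : HasSum f a) : ‖a‖ₑ ≤ ∑' b, ‖f b‖ₑ :=
  le_of_tendsto h.enorm (Eventually.of_forall fun s =>
    (enorm_sum_le s f).trans (ENNReal.sum_le_tsum s))

theorem enorm_map_le_tsum_fiber [DecidableEq ι] {β E : Type*} [NormedAddCommGroup E]
    [NormedSpace ℂ E] (f : ι → β) (T : Wlp q w →L[ℂ] E) (c : Wlp q w) :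
    ‖T c‖ₑ ≤ ∑' b, ‖T (wlpProj (f ⁻¹' {b}) c)‖ₑ :=
  (T.hasSum (hasSum_wlpProj_fiber f c)).enorm_le_tsum

end Multiplication

/-! ### Cubes of a tiling -/

section Blocks

variable {d : ℕ}

/-- The index of the cube of side length `N` that contains a lattice point. -/
def blockIndex (N : ℕ) (i : Fin d → ℤ) : Fin d → ℤ := fun k => i k / N

/-- The corner of a cube of side length `N`. -/
def blockCorner (N : ℕ) (n : Fin d → ℤ) : Fin d → ℤ := fun k => N * n k

/-- The cubes of side length `N` that tile the lattice. -/
noncomputable def block (N : ℕ) (n : Fin d → ℤ) : Finset (Fin d → ℤ) :=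
  discreteCube (blockCorner N n) N

theorem mem_block {N : ℕ} (hN : 1 ≤ N) {n i : Fin d → ℤ} : i ∈ block N n ↔ blockIndex N i = n := by
  rw [block, mem_discreteCube, funext_iff]
  refine forall_congr' fun k => ?_
  have hN' : (0 : ℤ) < N := by exact_mod_cast hN
  simp only [blockCorner, blockIndex]
  rw [Int.ediv_eq_iff_of_pos hN']
  constructor <;> rintro ⟨h1, h2⟩ <;> constructor <;> nlinarith

theorem norm_sub_blockCorner_le {N : ℕ} (hN : 1 ≤ N) {n i : Fin d → ℤ} (h : i ∈ block N n) :
    ‖i - blockCorner N n‖ ≤ N := by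
  rw [block, mem_discreteCube] at h
  rw [pi_norm_le_iff_of_nonneg (by positivity)]
  intro k
  have := h k
  rw [Pi.sub_apply, Int.norm_eq_abs, ← Int.cast_abs]
  have h2 : |i k - blockCorner N n k| ≤ N := abs_le.2 ⟨by omega, by omega⟩
  exact_mod_cast h2

theorem norm_blockCorner (N : ℕ) (n : Fin d → ℤ) : ‖blockCorner N n‖ = N * ‖n‖ := by
  have : blockCorner N n = (N : ℤ) • n := by
    funext k; simp [blockCorner]
  rw [this, norm_smul]
  simp

theorem blockCorner_sub (N : ℕ) (n l : Fin d → ℤ) :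
    blockCorner N n - blockCorner N l = blockCorner N (n - l) := by
  funext k; simp [blockCorner, mul_sub]

theorem norm_blockIndex_sub_ge {N : ℕ} (hN : 1 ≤ N) (i j : Fin d → ℤ) :
    ‖i - j‖ / N - 1 ≤ ‖blockIndex N i - blockIndex N j‖ := by
  have hN' : (0 : ℝ) < N := by exact_mod_cast hN
  have hNz : (0 : ℤ) < N := by exact_mod_cast hN
  rw [sub_le_iff_le_add, div_le_iff₀ hN', pi_norm_le_iff_of_nonneg (by positivity)]
  intro k
  have h1 := norm_le_pi_norm (blockIndex N i - blockIndex N j) k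
  refine le_trans ?_ (mul_le_mul_of_nonneg_right (add_le_add_left h1 1) hN'.le)
  simp only [Pi.sub_apply, blockIndex, Int.norm_eq_abs, ← Int.cast_abs]
  have : |i k - j k| ≤ (|i k / N - j k / N| + 1) * N := by
    have a1 := Int.mul_ediv_add_emod (i k) N
    have a2 := Int.mul_ediv_add_emod (j k) N
    have b1 := Int.emod_nonneg (i k) hNz.ne'
    have b2 := Int.emod_nonneg (j k) hNz.ne'
    have c1 := Int.emod_lt_of_pos (i k) hNz
    have c2 := Int.emod_lt_of_pos (j k) hNz
    have e1 := le_abs_self (i k / N - j k / N)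
    have e2 := neg_le_abs (i k / N - j k / N)
    rw [abs_le]
    constructor <;> nlinarith
  exact_mod_cast this

/-- A trapezoidal cut-off function, equal to one on a cube of the tiling. -/
noncomputable def blockCutoff (N : ℕ) (l i : Fin d → ℤ) : ℝ :=
  max 0 (min 1 (2 - ‖i - blockCorner N l‖ / N))

theorem blockCutoff_nonneg (N : ℕ) (l i : Fin d → ℤ) : 0 ≤ blockCutoff N l i := le_max_left _ _

theorem blockCutoff_le_one (N : ℕ) (l i : Fin d → ℤ) : blockCutoff N l i ≤ 1 :=
  max_le zero_le_one (min_le_left _ _)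

theorem blockCutoff_eq_one {N : ℕ} (hN : 1 ≤ N) {l i : Fin d → ℤ} (h : i ∈ block N l) :
    blockCutoff N l i = 1 := by
  have hN' : (0 : ℝ) < N := by exact_mod_cast hN
  have h1 : ‖i - blockCorner N l‖ / N ≤ 1 := (div_le_one hN').2 (norm_sub_blockCorner_le hN h)
  rw [blockCutoff, min_eq_left (by linarith), max_eq_right zero_le_one]

theorem norm_lt_of_blockCutoff_ne_zero {N : ℕ} (hN : 1 ≤ N) {l i : Fin d → ℤ}
    (h : blockCutoff N l i ≠ 0) : ‖i - blockCorner N l‖ < 2 * N := by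
  have hN' : (0 : ℝ) < N := by exact_mod_cast hN
  by_contra hcon
  rw [not_lt, ← le_div_iff₀ hN'] at hcon
  apply h
  rw [blockCutoff, max_eq_left]
  exact (min_le_right _ _).trans (by linarith)

/-- The cut-off has values in [0, 1] and Lipschitz constant 1/N. The latter makes commutators with
it small for large N. -/
theorem abs_blockCutoff_sub_le (N : ℕ) (l i j : Fin d → ℤ) :
    |blockCutoff N l i - blockCutoff N l j| ≤ min 1 (‖j - i‖ / N) := by
  refine le_min ?_ ?_
  · rw [abs_le]
    have := blockCutoff_nonneg N l i
    have := blockCutoff_nonneg N l j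
    have := blockCutoff_le_one N l i
    have := blockCutoff_le_one N l j
    constructor <;> linarith
  · have h1 : |blockCutoff N l i - blockCutoff N l j| ≤
        |(2 - ‖i - blockCorner N l‖ / N) - (2 - ‖j - blockCorner N l‖ / N)| :=
      (abs_max_sub_max_le_max 0 _ 0 _).trans (max_le (by simp) ((abs_min_sub_min_le_max 1 _ 1 _).trans
        (max_le (by simp) le_rfl)))
    refine h1.trans ?_
    have h2 : (2 - ‖i - blockCorner N l‖ / N) - (2 - ‖j - blockCorner N l‖ / N) =
        (‖j - blockCorner N l‖ - ‖i - blockCorner N l‖) / N := by ring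
    rw [h2, abs_div, Nat.abs_cast]
    gcongr
    simpa using abs_norm_sub_norm_le (j - blockCorner N l) (i - blockCorner N l)

end Blocks

/-! ### Radial sums on the lattice and on the lattice of cubes -/

section RadialMore

variable {d : ℕ} {f : (Fin d → ℤ) → ℝ≥0∞}

theorem radialSum_lt_top_of_band {p : ℝ} (hp : 0 < p) {c : ℝ≥0∞} (hc : c ≠ ∞) (R : ℕ)
    (h : ∀ x, f x ≤ c) (h0 : ∀ x, (R : ℝ) < ‖x‖ → f x = 0) : radialSum p f < ∞ := by
  rw [radialSum, tsum_eq_sum (s := latticeBall d R)]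
  · refine ENNReal.sum_lt_top.2 fun k _ => ENNReal.rpow_lt_top_of_nonneg hp.le ?_
    exact ((radialSup_le fun x _ => h x).trans_lt hc.lt_top).ne
  · intro k hk
    rw [mem_latticeBall, not_le] at hk
    have : radialSup f ‖k‖ = 0 := le_antisymm
      (radialSup_le fun x hx => (h0 x (hk.trans_le hx)).le) zero_le
    rw [this, ENNReal.zero_rpow_of_pos hp]

theorem radialSum_one_tsum_le {β : Type*} (F : β → (Fin d → ℤ) → ℝ≥0∞) :
    radialSum 1 (fun x => ∑' b, F b x) ≤ ∑' b, radialSum 1 (F b) := by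
  simp only [radialSum_one]
  rw [ENNReal.tsum_comm]
  exact ENNReal.tsum_le_tsum fun k => radialSup_le fun x hx =>
    ENNReal.tsum_le_tsum fun b => le_radialSup hx

/-- A kernel on the lattice of cubes, viewed as a kernel on the original lattice. -/
noncomputable def blockLift (N : ℕ) (v : (Fin d → ℤ) → ℝ≥0∞) (x : Fin d → ℤ) : ℝ≥0∞ :=
  radialSup v (‖x‖ / N - 1)

theorem le_blockLift {N : ℕ} (hN : 1 ≤ N) (v : (Fin d → ℤ) → ℝ≥0∞) (i j : Fin d → ℤ) :
    v (blockIndex N i - blockIndex N j) ≤ blockLift N v (i - j) :=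
  le_radialSup (norm_blockIndex_sub_ge hN i j)

/-- If n is the norm of k divided by 2N with rounding, then ‖k‖/N - 1 ≥ 2n - 1 ≥ n when n ≥ 1. For n
= 0 the value at 0 is already the largest. -/
theorem radialSum_blockLift_le {N : ℕ} (hN : 1 ≤ N) (v : (Fin d → ℤ) → ℝ≥0∞) :
    radialSum 1 (blockLift N v) ≤ ((4 * N + 1) ^ d : ℕ) * radialSum 1 v := by
  have hN' : (0 : ℝ) < N := by exact_mod_cast hN
  have h1 : ∀ k : Fin d → ℤ, radialSup (blockLift N v) ‖k‖ ≤
      radialSup v ‖latticeDiv (2 * N) k‖ := by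
    intro k
    refine (radialSup_of_antitone (H := fun r => radialSup v (r / N - 1)) (fun a b hab =>
      radialSup_antitone v (by gcongr)) _).trans ?_
    by_cases h0 : latticeDiv (2 * N) k = 0
    · rw [h0, norm_zero]
      exact radialSup_le_zero _
    · refine radialSup_antitone v ?_
      obtain ⟨n, hn⟩ := exists_nat_norm_eq (latticeDiv (2 * N) k)
      have hpos : 0 < ‖latticeDiv (2 * N) k‖ := norm_pos_iff.2 h0
      have hle := norm_latticeDiv_le (M := 2 * N) (by omega) k
      rw [hn] at hpos
      have hn1 : (1 : ℝ) ≤ n := by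
        have : 0 < n := by exact_mod_cast hpos
        exact_mod_cast this
      have h2 : ‖k‖ / ((2 * N : ℕ) : ℝ) = ‖k‖ / N / 2 := by
        push_cast; field_simp
      rw [h2] at hle
      have := hn ▸ hle
      rw [hn]
      linarith
  rw [radialSum_one, radialSum_one]
  refine (ENNReal.tsum_le_tsum h1).trans ?_
  have := tsum_comp_latticeDiv_le (M := 2 * N) (by omega) fun k : Fin d → ℤ => radialSup v ‖k‖
  rwa [show 2 * (2 * N) + 1 = 4 * N + 1 by ring] at this

/-- Each cube index is replaced by the N^d points k of its cube, which satisfy ‖k‖ ≤ N(‖n‖ + 1).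
With m = max(‖n‖, 7) one has (m + 1)/2 ≤ m - 3 exactly because m ≥ 7; this is the origin of the
number 7. -/
theorem pow_mul_tsum_block_le {N : ℕ} (hN : 1 ≤ N) {H : ℝ → ℝ≥0∞} (hH : Antitone H) :
    (N : ℝ≥0∞) ^ d * ∑' n : Fin d → ℤ, H (N * (max ‖n‖ 7 - 3)) ≤
      (5 ^ d : ℕ) * ∑' k : Fin d → ℤ, H (max ‖k‖ N) := by
  have hN' : (0 : ℝ) < N := by exact_mod_cast hN
  have hinj : Function.Injective fun y : (Fin d → ℤ) × discreteCube (0 : Fin d → ℤ) N =>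
      blockCorner N y.1 + y.2.1 := by
    have key : ∀ y : (Fin d → ℤ) × discreteCube (0 : Fin d → ℤ) N,
        blockIndex N (blockCorner N y.1 + y.2.1) = y.1 := by
      intro y
      rw [← mem_block hN, block, mem_discreteCube]
      intro k
      have := mem_discreteCube.1 y.2.2 k
      simp only [Pi.zero_apply, Pi.add_apply] at this ⊢
      omega
    intro y z h
    have h1 : y.1 = z.1 := by rw [← key y, ← key z]; exact congrArg _ h
    refine Prod.ext h1 (Subtype.ext ?_)
    simp only [h1] at h
    exact add_left_cancel h
  calc (N : ℝ≥0∞) ^ d * ∑' n : Fin d → ℤ, H (N * (max ‖n‖ 7 - 3))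
      = ∑' y : (Fin d → ℤ) × discreteCube (0 : Fin d → ℤ) N, H (N * (max ‖y.1‖ 7 - 3)) := by
        rw [ENNReal.tsum_prod (f := fun (n : Fin d → ℤ) (_ : discreteCube (0 : Fin d → ℤ) N) =>
          H (N * (max ‖n‖ 7 - 3))), ← ENNReal.tsum_mul_left]
        refine tsum_congr fun n => ?_
        rw [tsum_fintype, Finset.sum_const, Finset.card_univ, Fintype.card_coe, card_discreteCube]
        simp
    _ ≤ ∑' y : (Fin d → ℤ) × discreteCube (0 : Fin d → ℤ) N,
          (fun k : Fin d → ℤ => H (max (‖k‖ / 2) N)) (blockCorner N y.1 + y.2.1) := by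
        refine ENNReal.tsum_le_tsum fun y => hH ?_
        have hs : ‖y.2.1‖ ≤ N := by
          have := norm_sub_blockCorner_le hN (n := 0) (i := y.2.1) (by
            rw [block, mem_discreteCube]
            intro k
            simpa [blockCorner] using mem_discreteCube.1 y.2.2 k)
          have h0 : blockCorner N (0 : Fin d → ℤ) = 0 := by funext k; simp [blockCorner]
          simpa [h0] using this
        have h1 := norm_add_le (blockCorner N y.1) y.2.1
        rw [norm_blockCorner] at h1
        have h2 : (7 : ℝ) ≤ max ‖y.1‖ 7 := le_max_right _ _
        have h3 : ‖y.1‖ ≤ max ‖y.1‖ 7 := le_max_left _ _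
        refine max_le ?_ ?_
        · nlinarith
        · nlinarith
    _ ≤ ∑' k : Fin d → ℤ, H (max (‖k‖ / 2) N) := ENNReal.tsum_comp_le_tsum_of_injective hinj _
    _ ≤ _ := tsum_antitone_half_le (H := fun r => H (max r N)) fun a b hab =>
        hH (max_le_max_right _ hab)

/-- For ‖x‖ ≤ X the extra factor is at most X/N; for larger ‖x‖ it is at most 1 and the tail of the
majorant remains. -/
theorem radialSum_one_min_le {N : ℕ} (hN : 1 ≤ N) (f : (Fin d → ℤ) → ℝ≥0∞) (X : ℕ) :
    radialSum 1 (fun x => f x * ENNReal.ofReal (min 1 (‖x‖ / N))) ≤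
      ENNReal.ofReal (X / N) * radialSum 1 f + ∑' k : Fin d → ℤ, radialSup f (max ‖k‖ X) := by
  simp only [radialSum_one]
  rw [← ENNReal.tsum_mul_left, ← ENNReal.tsum_add]
  refine ENNReal.tsum_le_tsum fun k => radialSup_le fun x hx => ?_
  rcases le_total ‖x‖ X with h | h
  · refine le_trans ?_ le_self_add
    rw [mul_comm]
    gcongr
    · exact (min_le_right _ _).trans (by gcongr)
    · exact le_radialSup hx
  · refine le_trans ?_ le_add_self
    refine (mul_le_of_le_one_right' ?_).trans (le_radialSup (max_le hx h))
    rw [ENNReal.ofReal_le_one]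
    exact min_le_left _ _

end RadialMore

/-! ### Local norms on the cubes of a tiling -/

section CubeEstimates

variable {d : ℕ} {q : ℝ} {w : (Fin d → ℤ) → ℝ} [hq : Fact (1 ≤ q)] {C : ℝ≥0∞}

theorem CubeBound.root (hC : CubeBound q (fun i => ENNReal.ofReal (w i)) C) (a : Fin d → ℤ) {M : ℕ}
    (hM : 1 ≤ M) (c : (Fin d → ℤ) → ℝ≥0∞) :
    (∑ i ∈ discreteCube a M, c i) * (∑ i ∈ discreteCube a M, ENNReal.ofReal (w i)) ^ (1 / q) ≤
      C ^ (1 / q) * (M : ℝ≥0∞) ^ d *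
        (∑ i ∈ discreteCube a M, c i ^ q * ENNReal.ofReal (w i)) ^ (1 / q) := by
  have hq0 := q_pos q
  have hp : 0 ≤ 1 / q := by positivity
  have h := ENNReal.rpow_le_rpow (hC a M hM c) hp
  rwa [ENNReal.mul_rpow_of_nonneg _ _ hp, ENNReal.mul_rpow_of_nonneg _ _ hp,
    ENNReal.mul_rpow_of_nonneg _ _ hp, ← ENNReal.rpow_mul, ← ENNReal.rpow_mul,
    mul_one_div_cancel hq0.ne', ENNReal.rpow_one, ENNReal.rpow_one] at h

/-- The averaging bound tested on the indicator of `s`. It yields the doubling property of the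
weight. -/
theorem CubeBound.card_mul_le (hC : CubeBound q (fun i => ENNReal.ofReal (w i)) C)
    {a : Fin d → ℤ} {M : ℕ} (hM : 1 ≤ M) {s : Finset (Fin d → ℤ)} (hs : s ⊆ discreteCube a M) :
    (s.card : ℝ≥0∞) * (∑ i ∈ discreteCube a M, ENNReal.ofReal (w i)) ^ (1 / q) ≤
      C ^ (1 / q) * (M : ℝ≥0∞) ^ d * (∑ i ∈ s, ENNReal.ofReal (w i)) ^ (1 / q) := by
  have hq0 := q_pos q
  have h := hC.root a hM (fun i => if i ∈ s then 1 else 0)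
  have h1 : ∑ i ∈ discreteCube a M, (if i ∈ s then (1 : ℝ≥0∞) else 0) = s.card := by
    rw [← Finset.sum_filter, Finset.filter_mem_eq_inter, Finset.inter_eq_right.2 hs]
    simp
  have h2 : ∑ i ∈ discreteCube a M, (if i ∈ s then (1 : ℝ≥0∞) else 0) ^ q * ENNReal.ofReal (w i) =
      ∑ i ∈ s, ENNReal.ofReal (w i) := by
    rw [← Finset.inter_eq_right.2 hs, ← Finset.filter_mem_eq_inter, Finset.sum_filter]
    refine Finset.sum_congr rfl fun i hi => ?_
    split_ifs <;> simp_all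
  rwa [h1, h2] at h

theorem CubeBound.single_le (hC : CubeBound q (fun i => ENNReal.ofReal (w i)) C)
    {a : Fin d → ℤ} {M : ℕ} (hM : 1 ≤ M) {i : Fin d → ℤ} (hi : i ∈ discreteCube a M) :
    (∑ i ∈ discreteCube a M, ENNReal.ofReal (w i)) ^ (1 / q) ≤
      C ^ (1 / q) * (M : ℝ≥0∞) ^ d * ENNReal.ofReal (w i) ^ (1 / q) := by
  have := hC.card_mul_le hM (Finset.singleton_subset_iff.2 hi)
  simpa using this

theorem CubeBound.weight_le (hC : CubeBound q (fun i => ENNReal.ofReal (w i)) C) {M : ℕ}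
    {i j : Fin d → ℤ} (hij : ‖i - j‖ ≤ M) :
    ENNReal.ofReal (w j) ^ (1 / q) ≤
      C ^ (1 / q) * ((2 * M + 1 : ℕ) : ℝ≥0∞) ^ d * ENNReal.ofReal (w i) ^ (1 / q) := by
  have hq0 := q_pos q
  have hp : 0 ≤ 1 / q := by positivity
  have hmem : ∀ x : Fin d → ℤ, ‖i - x‖ ≤ M → x ∈ discreteCube (i - fun _ => (M : ℤ)) (2 * M + 1) := by
    intro x hx
    rw [mem_discreteCube]
    intro k
    have h1 := (norm_le_pi_norm (i - x) k).trans hx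
    rw [Pi.sub_apply, Int.norm_eq_abs, ← Int.cast_abs] at h1
    have h2 : |i k - x k| ≤ M := by exact_mod_cast h1
    rw [abs_le] at h2
    simp only [Pi.sub_apply]
    push_cast
    omega
  refine le_trans ?_ (hC.single_le (by omega) (hmem i (by simp)))
  exact ENNReal.rpow_le_rpow (Finset.single_le_sum (f := fun i => ENNReal.ofReal (w i))
    (fun _ _ => zero_le) (hmem j hij)) hp

theorem CubeBound.sum_mul_le (hC : CubeBound q (fun i => ENNReal.ofReal (w i)) C)
    (a : Fin d → ℤ) {M : ℕ} (hM : 1 ≤ M) (y : (Fin d → ℤ) → ℂ) :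
    (∑ i ∈ discreteCube a M, ‖y i‖ₑ) *
        (∑ i ∈ discreteCube a M, ENNReal.ofReal (w i)) ^ (1 / q) ≤
      C ^ (1 / q) * (M : ℝ≥0∞) ^ d * wlpENorm q w y := by
  have hq0 := q_pos q
  refine (hC.root a hM fun i => ‖y i‖ₑ).trans ?_
  unfold wlpENorm
  gcongr
  exact ENNReal.sum_le_tsum _

/-- The `q`-th root of the weight of a cube. -/
noncomputable def blockWeight (q : ℝ) (w : (Fin d → ℤ) → ℝ) (N : ℕ) (n : Fin d → ℤ) : ℝ≥0∞ :=
  (∑ i ∈ block N n, ENNReal.ofReal (w i)) ^ (1 / q)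

theorem blockWeight_ne_top (N : ℕ) (n : Fin d → ℤ) : blockWeight q w N n ≠ ∞ := by
  have := q_pos q
  exact ENNReal.rpow_ne_top_of_nonneg (by positivity)
    (ENNReal.sum_ne_top.2 fun _ _ => ENNReal.ofReal_ne_top)

theorem weight_le_blockWeight {N : ℕ} (hN : 1 ≤ N) (i : Fin d → ℤ) :
    ENNReal.ofReal (w i) ^ (1 / q) ≤ blockWeight q w N (blockIndex N i) := by
  have := q_pos q
  exact ENNReal.rpow_le_rpow (Finset.single_le_sum (f := fun i => ENNReal.ofReal (w i))
    (fun _ _ => zero_le) ((mem_block hN).2 rfl)) (by positivity)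

theorem CubeBound.blockWeight_le (hC : CubeBound q (fun i => ENNReal.ofReal (w i)) C) {N : ℕ}
    (hN : 1 ≤ N) (i : Fin d → ℤ) :
    blockWeight q w N (blockIndex N i) ≤
      C ^ (1 / q) * (N : ℝ≥0∞) ^ d * ENNReal.ofReal (w i) ^ (1 / q) :=
  hC.single_le hN ((mem_block hN).2 rfl)

/-- Both cubes lie in one cube of side 8N. Comparing that cube with its subset `block N n` of N^d
points gives a constant independent of N. -/
theorem CubeBound.blockWeight_near (hC : CubeBound q (fun i => ENNReal.ofReal (w i)) C) {N : ℕ}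
    (hN : 1 ≤ N) {n l : Fin d → ℤ} (hnl : ‖n - l‖ ≤ 7) :
    blockWeight q w N l ≤ C ^ (1 / q) * 8 ^ d * blockWeight q w N n := by
  have hq0 := q_pos q
  have hp : 0 ≤ 1 / q := by positivity
  have hNz : (0 : ℤ) < N := by exact_mod_cast hN
  have hk : ∀ k, |n k - l k| ≤ 7 := by
    intro k
    have h1 := (norm_le_pi_norm (n - l) k).trans hnl
    rw [Pi.sub_apply, Int.norm_eq_abs, ← Int.cast_abs] at h1
    exact_mod_cast h1
  set a : Fin d → ℤ := blockCorner N (fun k => min (n k) (l k)) with ha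
  have hsub : ∀ m : Fin d → ℤ, (∀ k, min (n k) (l k) ≤ m k ∧ m k ≤ min (n k) (l k) + 7) →
      block N m ⊆ discreteCube a (8 * N) := by
    intro m hm x hx
    rw [block, mem_discreteCube] at hx
    rw [mem_discreteCube]
    intro k
    obtain ⟨h1, h2⟩ := hx k
    obtain ⟨h3, h4⟩ := hm k
    simp only [blockCorner, ha] at *
    push_cast
    constructor <;> nlinarith
  have hn := hsub n fun k => by have := abs_le.1 (hk k); omega
  have hl := hsub l fun k => by have := abs_le.1 (hk k); omega
  have h1 := hC.card_mul_le (by omega) hn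
  rw [block, card_discreteCube, ← block] at h1
  have hN0 : (N : ℝ≥0∞) ^ d ≠ 0 := by
    have : (N : ℝ≥0∞) ≠ 0 := by exact_mod_cast (by omega : N ≠ 0)
    exact pow_ne_zero _ this
  have hNt : (N : ℝ≥0∞) ^ d ≠ ∞ := ENNReal.pow_ne_top (ENNReal.natCast_ne_top _)
  rw [← ENNReal.mul_le_mul_iff_right hN0 hNt]
  calc (N : ℝ≥0∞) ^ d * blockWeight q w N l
      ≤ (N : ℝ≥0∞) ^ d * (∑ i ∈ discreteCube a (8 * N), ENNReal.ofReal (w i)) ^ (1 / q) := by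
        unfold blockWeight
        gcongr
    _ ≤ _ := by
        push_cast at h1
        refine h1.trans (le_of_eq ?_)
        rw [blockWeight, mul_pow]
        ring

theorem weight_rpow_ne_top (i : Fin d → ℤ) : ENNReal.ofReal (w i) ^ (1 / q) ≠ ∞ := by
  have hq0 := q_pos q
  exact ENNReal.rpow_ne_top_of_nonneg (by positivity) ENNReal.ofReal_ne_top

variable [hw : Fact (∀ i, 0 < w i)]

theorem weight_rpow_ne_zero (i : Fin d → ℤ) : ENNReal.ofReal (w i) ^ (1 / q) ≠ 0 := by
  have hq0 := q_pos q
  have := weight_pos w i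
  simp [this]

theorem blockWeight_ne_zero {N : ℕ} (hN : 1 ≤ N) (n : Fin d → ℤ) : blockWeight q w N n ≠ 0 := by
  have h : blockIndex N (blockCorner N n) = n := by
    rw [← mem_block hN, block, mem_discreteCube]
    intro k
    omega
  have h1 := weight_le_blockWeight (q := q) (w := w) hN (blockCorner N n)
  rw [h] at h1
  exact fun h0 => weight_rpow_ne_zero (q := q) (w := w) (blockCorner N n) (le_antisymm (h0 ▸ h1) zero_le)

theorem enorm_wlpProj_block_le {N : ℕ} (hN : 1 ≤ N) (n : Fin d → ℤ) (z : Wlp q w) {b : ℝ≥0∞}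
    (hz : ∀ i ∈ block N n, ‖z i‖ₑ ≤ b) :
    ‖wlpProj (blockIndex N ⁻¹' {n}) z‖ₑ ≤ b * blockWeight q w N n := by
  have hq0 := q_pos q
  have hp : 0 ≤ 1 / q := by positivity
  rw [wlp_enorm_eq, wlpENorm, tsum_eq_sum (s := block N n)]
  · calc (∑ i ∈ block N n, ‖wlpProj (blockIndex N ⁻¹' {n}) z i‖ₑ ^ q * ENNReal.ofReal (w i)) ^ (1 / q)
        ≤ (∑ i ∈ block N n, b ^ q * ENNReal.ofReal (w i)) ^ (1 / q) := by
          gcongr with i hi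
          rw [wlpProj_apply_of_mem (s := blockIndex N ⁻¹' {n}) ((mem_block hN).1 hi)]
          exact hz i hi
      _ = _ := by
          rw [← Finset.mul_sum, ENNReal.mul_rpow_of_nonneg _ _ hp, ← ENNReal.rpow_mul,
            mul_one_div_cancel hq0.ne', ENNReal.rpow_one, blockWeight]
  · intro i hi
    rw [wlpProj_apply_of_notMem (s := blockIndex N ⁻¹' {n}) fun h => hi ((mem_block hN).2 h)]
    simp [hq0]

/-- The normalised local norms of a sequence on the cubes of a tiling. -/
noncomputable def blockNorm (N : ℕ) (c : Wlp q w) (n : Fin d → ℤ) : ℝ≥0∞ :=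
  ‖wlpProj (blockIndex N ⁻¹' {n}) c‖ₑ / blockWeight q w N n

theorem blockNorm_single_le {N : ℕ} (hN : 1 ≤ N) (j n : Fin d → ℤ) :
    blockNorm N (wlpSingle j : Wlp q w) n ≤ if n = blockIndex N j then 1 else 0 := by
  unfold blockNorm
  split_ifs with h
  · rw [wlpProj_single_of_mem (by exact h.symm), wlpENorm_single, h]
    exact ENNReal.div_le_of_le_mul (by rw [one_mul]; exact weight_le_blockWeight hN j)
  · rw [wlpProj_single_of_notMem (fun h' => h (by exact h'.symm))]
    simp

theorem CubeBound.enorm_apply_le_blockNorm (hC : CubeBound q (fun i => ENNReal.ofReal (w i)) C)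
    {N : ℕ} (hN : 1 ≤ N) (c : Wlp q w) (i : Fin d → ℤ) :
    ‖c i‖ₑ ≤ C ^ (1 / q) * (N : ℝ≥0∞) ^ d * blockNorm N c (blockIndex N i) := by
  have h1 := enorm_apply_mul_le (q := q) (w := w) (wlpProj (blockIndex N ⁻¹' {blockIndex N i}) c) i
  rw [← wlp_enorm_eq, 
    wlpProj_apply_of_mem (s := blockIndex N ⁻¹' {blockIndex N i}) rfl] at h1
  have h2 : ‖wlpProj (blockIndex N ⁻¹' {blockIndex N i}) c‖ₑ =
      blockNorm N c (blockIndex N i) * blockWeight q w N (blockIndex N i) := by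
    rw [blockNorm, ENNReal.div_mul_cancel (blockWeight_ne_zero hN _) (blockWeight_ne_top _ _)]
  rw [h2] at h1
  rw [← ENNReal.mul_le_mul_iff_left (weight_rpow_ne_zero (q := q) (w := w) i) (weight_rpow_ne_top i)]
  refine h1.trans ((mul_le_mul_right (hC.blockWeight_le hN i) _).trans (le_of_eq ?_))
  ring

/-- Weights at bounded distance are comparable, so the entries of a bounded operator are bounded on
every band around the diagonal. -/
theorem CubeBound.enorm_clm_single_le (hC : CubeBound q (fun i => ENNReal.ofReal (w i)) C)
    (G : Wlp q w →L[ℂ] Wlp q w) {M : ℕ} {i j : Fin d → ℤ} (hij : ‖i - j‖ ≤ M) :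
    ‖G (wlpSingle j) i‖ₑ ≤ ‖G‖ₑ * (C ^ (1 / q) * ((2 * M + 1 : ℕ) : ℝ≥0∞) ^ d) := by
  have h1 := enorm_apply_mul_le (q := q) (w := w) (G (wlpSingle j)) i
  have h2 := ContinuousLinearMap.le_opENorm G (wlpSingle j)
  rw [wlpENorm_single] at h2
  rw [← wlp_enorm_eq] at h1
  rw [← ENNReal.mul_le_mul_iff_left (weight_rpow_ne_zero (q := q) (w := w) i) (weight_rpow_ne_top i),
    mul_assoc]
  exact h1.trans (h2.trans (mul_le_mul_right (hC.weight_le hij) _))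

theorem blockNorm_map_le (N : ℕ) (E : Wlp q w →L[ℂ] Wlp q w) (c : Wlp q w) (n : Fin d → ℤ) :
    blockNorm N (E c) n ≤ ∑' l, blockNorm N (E (wlpProj (blockIndex N ⁻¹' {l}) c)) n := by
  have h := enorm_map_le_tsum_fiber (blockIndex N) ((wlpProj (blockIndex N ⁻¹' {n})).comp E) c
  unfold blockNorm
  simp only [ENNReal.div_eq_inv_mul]
  rw [ENNReal.tsum_mul_left]
  gcongr
  exact h

end CubeEstimates

/-! ### Local parametrices and the summability of the inverse matrix -/

/-- The matrix of an operator on `ℓ^q_w`. -/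
noncomputable def opMatrix {ι : Type*} [DecidableEq ι] {q : ℝ} {w : ι → ℝ} [Fact (1 ≤ q)]
    [Fact (∀ i, 0 < w i)] (T : Wlp q w →L[ℂ] Wlp q w) : Matrix ι ι ℂ :=
  fun i j => T (wlpSingle j) i

section Parametrix

variable {d : ℕ} {q : ℝ} {w : (Fin d → ℤ) → ℝ} [hq : Fact (1 ≤ q)] [hw : Fact (∀ i, 0 < w i)]
  {C K : ℝ≥0∞} {A : Matrix (Fin d → ℤ) (Fin d → ℤ) ℂ} {T G P : Wlp q w →L[ℂ] Wlp q w} {N : ℕ}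

/-- The cut-off of an operator near the cubes of a tiling, as a matrix. -/
noncomputable def parametrixMatrix (N : ℕ) (G : Wlp q w →L[ℂ] Wlp q w) :
    Matrix (Fin d → ℤ) (Fin d → ℤ) ℂ :=
  fun i j => (blockCutoff N (blockIndex N j) i : ℂ) * opMatrix G i j

/-- Multiplication by the cut-off function of a cube. -/
noncomputable def cutoffMul (N : ℕ) (l : Fin d → ℤ) : Wlp q w →L[ℂ] Wlp q w :=
  wlpMul (fun i => (blockCutoff N l i : ℂ)) fun i => by
    rw [Complex.norm_of_nonneg (blockCutoff_nonneg N l i)]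
    exact blockCutoff_le_one N l i

theorem cutoffMul_apply (l : Fin d → ℤ) (c : Wlp q w) (i : Fin d → ℤ) :
    cutoffMul N l c i = (blockCutoff N l i : ℂ) * c i := rfl

/-- The matrix is bounded and vanishes for ‖i - j‖ > 3N: the cut-off has radius 2N about the corner
of the cube, and j is within N of that corner. -/
theorem radialSum_parametrixMatrix_lt_top
    (hC : CubeBound q (fun i => ENNReal.ofReal (w i)) C) (hCt : C ≠ ∞) (hN : 1 ≤ N) :
    radialSum 1 (matrixKernel (parametrixMatrix N G)) < ∞ := by
  have hq0 := q_pos q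
  have hzero : ∀ i j : Fin d → ℤ, ((3 * N : ℕ) : ℝ) < ‖i - j‖ → parametrixMatrix N G i j = 0 := by
    intro i j hij
    have : blockCutoff N (blockIndex N j) i = 0 := by
      by_contra hne
      have h1 := norm_lt_of_blockCutoff_ne_zero hN hne
      have h2 := norm_sub_blockCorner_le hN ((mem_block hN).2 (rfl : blockIndex N j = _))
      have h3 := norm_sub_le (i - blockCorner N (blockIndex N j)) (j - blockCorner N (blockIndex N j))
      rw [sub_sub_sub_cancel_right] at h3
      push_cast at hij
      linarith
    simp [parametrixMatrix, this]
  refine radialSum_lt_top_of_band zero_lt_one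
    (c := ‖G‖ₑ * (C ^ (1 / q) * ((2 * (3 * N) + 1 : ℕ) : ℝ≥0∞) ^ d)) ?_ (3 * N) ?_ ?_
  · exact ENNReal.mul_ne_top enorm_ne_top (ENNReal.mul_ne_top
      (ENNReal.rpow_ne_top_of_nonneg (by positivity) hCt)
      (ENNReal.pow_ne_top (ENNReal.natCast_ne_top _)))
  · refine matrixKernel_le (f := fun _ => _) fun i j => ?_
    by_cases hij : ‖i - j‖ ≤ ((3 * N : ℕ) : ℝ)
    · refine le_trans ?_ (hC.enorm_clm_single_le G hij)
      refine enorm_mul_le_of_norm_le_one ?_ _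
      rw [Complex.norm_of_nonneg (blockCutoff_nonneg _ _ _)]
      exact blockCutoff_le_one _ _ _
    · rw [hzero i j (not_le.1 hij)]
      simp
  · intro x hx
    have := matrixKernel_le (A := parametrixMatrix N G)
      (f := fun x => if ((3 * N : ℕ) : ℝ) < ‖x‖ then 0 else ∞) (fun i j => by
        by_cases h : ((3 * N : ℕ) : ℝ) < ‖i - j‖
        · rw [hzero i j h]; simp
        · rw [if_neg h]; exact le_top) x
    rw [if_pos hx] at this
    exact le_antisymm this zero_le

/-- All columns with index in one cube carry the same cut-off, so there `P` is `G` followed by a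
multiplication. -/
theorem parametrix_proj (hP : IsMatrixOf (parametrixMatrix N G) P) (l : Fin d → ℤ)
    (c : Wlp q w) :
    P (wlpProj (blockIndex N ⁻¹' {l}) c) = cutoffMul N l (G (wlpProj (blockIndex N ⁻¹' {l}) c)) := by
  have h : P.comp (wlpProj (blockIndex N ⁻¹' {l})) =
      (cutoffMul N l).comp (G.comp (wlpProj (blockIndex N ⁻¹' {l}))) := by
    refine wlp_clm_ext fun j => ?_
    simp only [ContinuousLinearMap.comp_apply]
    by_cases hj : blockIndex N j = l
    · rw [wlpProj_single_of_mem (by exact hj)]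
      refine wlp_ext fun i => ?_
      rw [hP.apply_single, cutoffMul_apply, parametrixMatrix, hj]
      rfl
    · rw [wlpProj_single_of_notMem (by exact hj)]
      simp
  exact congrArg (fun S : Wlp q w →L[ℂ] Wlp q w => S c) h

/-- The error of a parametrix on a single cube is a commutator. -/
theorem enorm_parametrix_error_le (hN : 1 ≤ N) (hA : IsMatrixOf A T) (hTG : T * G = 1)
    (hP : IsMatrixOf (parametrixMatrix N G) P) (l : Fin d → ℤ) (c : Wlp q w) (i : Fin d → ℤ) :
    ‖(T * P - 1) (wlpProj (blockIndex N ⁻¹' {l}) c) i‖ₑ ≤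
      ∑' k, ‖A i k‖ₑ * ENNReal.ofReal |blockCutoff N l k - blockCutoff N l i| *
        ‖G (wlpProj (blockIndex N ⁻¹' {l}) c) k‖ₑ := by
  set x := wlpProj (blockIndex N ⁻¹' {l}) c with hx
  set y := G x with hy
  have hTy : T y = x := congrArg (fun S : Wlp q w →L[ℂ] Wlp q w => S x) hTG
  have h1 := hA (cutoffMul N l y) i
  have h2 := (hA y i).mul_left (blockCutoff N l i : ℂ)
  -- Ty = x lives where the cut-off ψ is one, so x = ψTy. Subtracting the identity thus turns Tψy
  -- into the commutator of T and ψ applied to y.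
  have h3 : (blockCutoff N l i : ℂ) * (T y) i = x i := by
    rw [hTy]
    by_cases hi : blockIndex N i = l
    · rw [blockCutoff_eq_one hN ((mem_block hN).2 hi)]
      simp
    · have : x i = 0 := wlpProj_apply_of_notMem (s := blockIndex N ⁻¹' {l}) hi c
      rw [this, mul_zero]
  rw [h3] at h2
  have h4 : (T * P - 1) x i = T (cutoffMul N l y) i - x i := by
    rw [hy, ← parametrix_proj hP]
    rfl
  rw [h4]
  refine (h1.sub h2).enorm_le_tsum.trans (ENNReal.tsum_le_tsum fun k => le_of_eq ?_)
  rw [cutoffMul_apply]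
  have : A i k * ((blockCutoff N l k : ℂ) * y k) - (blockCutoff N l i : ℂ) * (A i k * y k) =
      A i k * ((blockCutoff N l k - blockCutoff N l i : ℝ) : ℂ) * y k := by
    push_cast; ring
  rw [this, enorm_mul, enorm_mul, ← ofReal_norm (((blockCutoff N l k - blockCutoff N l i : ℝ) : ℂ)),
    Complex.norm_real, Real.norm_eq_abs]

/-- The kernel that bounds the blocks of the error of a parametrix. -/
noncomputable def errorKernel (f : (Fin d → ℤ) → ℝ≥0∞) (a b : ℝ≥0∞) (N : ℕ) (x : Fin d → ℤ) :
    ℝ≥0∞ :=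
  a * radialSum 1 (fun x => f x * ENNReal.ofReal (min 1 (‖x‖ / N))) * (if ‖x‖ ≤ 7 then 1 else 0) +
    b * ((N : ℝ≥0∞) ^ d * radialSup f (N * (max ‖x‖ 7 - 3)))

/-- The commutator is dominated by the kernel of `A` times min(1, ‖x‖/N), which acts boundedly on
the whole space. Doubling compares the weights of the two cubes. -/
theorem blockNorm_error_near (hC : CubeBound q (fun i => ENNReal.ofReal (w i)) C)
    (hK : KernelBound q w K) (hN : 1 ≤ N) (hA : IsMatrixOf A T) (hTG : T * G = 1)
    (hP : IsMatrixOf (parametrixMatrix N G) P) {n l : Fin d → ℤ} (hnl : ‖n - l‖ ≤ 7)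
    (c : Wlp q w) :
    blockNorm N ((T * P - 1) (wlpProj (blockIndex N ⁻¹' {l}) c)) n ≤
      K * ‖G‖ₑ * (C ^ (1 / q) * 8 ^ d) *
        radialSum 1 (fun x => matrixKernel A x * ENNReal.ofReal (min 1 (‖x‖ / N))) *
          blockNorm N c l := by
  set x := wlpProj (blockIndex N ⁻¹' {l}) c with hx
  set S := radialSum 1 (fun x => matrixKernel A x * ENNReal.ofReal (min 1 (‖x‖ / N)))
  have h1 : ‖(T * P - 1) x‖ₑ ≤ K * S * ‖G x‖ₑ := by
    rw [wlp_enorm_eq, wlp_enorm_eq]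
    refine hK _ _ _ fun i => (enorm_parametrix_error_le hN hA hTG hP l c i).trans ?_
    refine ENNReal.tsum_le_tsum fun k => ?_
    gcongr
    · exact enorm_le_matrixKernel A i k
    · exact abs_blockCutoff_sub_le N l k i
  have h2 : ‖G x‖ₑ ≤ ‖G‖ₑ * ‖x‖ₑ := ContinuousLinearMap.le_opENorm G x
  have h3 : ‖x‖ₑ = blockNorm N c l * blockWeight q w N l := by
    rw [blockNorm, ENNReal.div_mul_cancel (blockWeight_ne_zero hN _) (blockWeight_ne_top _ _)]
  rw [blockNorm]
  refine ENNReal.div_le_of_le_mul ?_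
  calc ‖wlpProj (blockIndex N ⁻¹' {n}) ((T * P - 1) x)‖ₑ ≤ ‖(T * P - 1) x‖ₑ := enorm_wlpProj_le _ _
    _ ≤ K * S * (‖G‖ₑ * (blockNorm N c l * blockWeight q w N l)) := by
        rw [← h3]
        exact h1.trans (mul_le_mul_right h2 _)
    _ ≤ K * S * (‖G‖ₑ * (blockNorm N c l * (C ^ (1 / q) * 8 ^ d * blockWeight q w N n))) := by
        gcongr
        exact hC.blockWeight_near hN hnl
    _ = _ := by ring

/-- Here the cut-off vanishes on `block N n`, and only entries of `A` at distance at least N(‖n - l‖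
- 3) matter: N is lost to the cube, 2N to the support of the cut-off. They are bounded by their
supremum, and the sum of the entries of Gx over a cube of side 4N by the A_q condition. -/
theorem blockNorm_error_far (hC : CubeBound q (fun i => ENNReal.ofReal (w i)) C)
    (hN : 1 ≤ N) (hA : IsMatrixOf A T) (hTG : T * G = 1)
    (hP : IsMatrixOf (parametrixMatrix N G) P) {n l : Fin d → ℤ} (hnl : 7 < ‖n - l‖)
    (c : Wlp q w) :
    blockNorm N ((T * P - 1) (wlpProj (blockIndex N ⁻¹' {l}) c)) n ≤
      C ^ (1 / q) * 4 ^ d * ‖G‖ₑ *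
        ((N : ℝ≥0∞) ^ d * radialSup (matrixKernel A) (N * (‖n - l‖ - 3))) * blockNorm N c l := by
  have hq0 := q_pos q
  have hN' : (0 : ℝ) < N := by exact_mod_cast hN
  set x := wlpProj (blockIndex N ⁻¹' {l}) c with hx
  set R := radialSup (matrixKernel A) (N * (‖n - l‖ - 3)) with hR
  set a : Fin d → ℤ := fun k => N * l k - 2 * N with ha
  set Q := discreteCube a (4 * N) with hQ
  have h3 : ‖x‖ₑ = blockNorm N c l * blockWeight q w N l := by
    rw [blockNorm, ENNReal.div_mul_cancel (blockWeight_ne_zero hN _) (blockWeight_ne_top _ _)]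
  have hsub : block N l ⊆ Q := by
    intro k hk
    rw [block, mem_discreteCube] at hk
    rw [hQ, mem_discreteCube]
    intro m
    have := hk m
    simp only [blockCorner, ha] at *
    push_cast
    omega
  have hmem : ∀ k, blockCutoff N l k ≠ 0 → k ∈ Q := by
    intro k hk
    have h := norm_lt_of_blockCutoff_ne_zero hN hk
    rw [hQ, mem_discreteCube]
    intro m
    have h1 := (norm_le_pi_norm (k - blockCorner N l) m).trans_lt h
    rw [Pi.sub_apply, Int.norm_eq_abs, ← Int.cast_abs] at h1
    have h2 : |k m - blockCorner N l m| < 2 * N := by exact_mod_cast h1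
    rw [abs_lt] at h2
    simp only [blockCorner, ha] at *
    push_cast
    omega
  have hdist : ∀ i ∈ block N n, ∀ k, blockCutoff N l k ≠ 0 → N * (‖n - l‖ - 3) ≤ ‖i - k‖ := by
    intro i hi k hk
    have h1 := norm_lt_of_blockCutoff_ne_zero hN hk
    have h2 := norm_sub_blockCorner_le hN hi
    have h4 : ‖blockCorner N n - blockCorner N l‖ = N * ‖n - l‖ := by
      rw [blockCorner_sub, norm_blockCorner]
    have h5 : blockCorner N n - blockCorner N l =
        (i - k) + (k - blockCorner N l) - (i - blockCorner N n) := by abel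
    have h6 := norm_sub_le ((i - k) + (k - blockCorner N l)) (i - blockCorner N n)
    have h7 := norm_add_le (i - k) (k - blockCorner N l)
    rw [← h5, h4] at h6
    nlinarith
  have hcut : ∀ i ∈ block N n, blockCutoff N l i = 0 := by
    intro i hi
    by_contra hne
    have := hdist i hi i hne
    rw [sub_self, norm_zero] at this
    nlinarith
  have hpt : ∀ i ∈ block N n, ‖(T * P - 1) x i‖ₑ ≤ R * ∑ k ∈ Q, ‖G x k‖ₑ := by
    intro i hi
    refine (enorm_parametrix_error_le hN hA hTG hP l c i).trans ?_
    rw [tsum_eq_sum (s := Q), Finset.mul_sum]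
    · refine Finset.sum_le_sum fun k _ => ?_
      gcongr
      rw [hcut i hi, sub_zero]
      by_cases hk : blockCutoff N l k = 0
      · simp [hk]
      · refine (mul_le_of_le_one_right' ?_).trans ((enorm_le_matrixKernel A i k).trans
          (le_radialSup (hdist i hi k hk)))
        rw [ENNReal.ofReal_le_one, abs_of_nonneg (blockCutoff_nonneg _ _ _)]
        exact blockCutoff_le_one _ _ _
    · intro k hk
      have : blockCutoff N l k = 0 := by
        by_contra hne
        exact hk (hmem k hne)
      simp [this, hcut i hi]
  have hsum := hC.sum_mul_le a (M := 4 * N) (by omega) (G x)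
  rw [← wlp_enorm_eq] at hsum
  have hwl : blockWeight q w N l ≤ (∑ i ∈ Q, ENNReal.ofReal (w i)) ^ (1 / q) :=
    ENNReal.rpow_le_rpow (Finset.sum_le_sum_of_subset hsub) (by positivity)
  have hS : ∑ k ∈ Q, ‖G x k‖ₑ ≤ C ^ (1 / q) * ((4 * N : ℕ) : ℝ≥0∞) ^ d * ‖G‖ₑ * blockNorm N c l := by
    rw [← ENNReal.mul_le_mul_iff_left (blockWeight_ne_zero (q := q) (w := w) hN l)
      (blockWeight_ne_top N l)]
    calc (∑ k ∈ Q, ‖G x k‖ₑ) * blockWeight q w N l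
        ≤ (∑ k ∈ Q, ‖G x k‖ₑ) * (∑ i ∈ Q, ENNReal.ofReal (w i)) ^ (1 / q) := by gcongr
      _ ≤ _ := hsum
      _ ≤ C ^ (1 / q) * ((4 * N : ℕ) : ℝ≥0∞) ^ d * (‖G‖ₑ * ‖x‖ₑ) := by
          gcongr
          exact ContinuousLinearMap.le_opENorm G x
      _ = _ := by rw [h3]; ring
  rw [blockNorm]
  refine ENNReal.div_le_of_le_mul ?_
  refine (enorm_wlpProj_block_le hN n _ hpt).trans (mul_le_mul_left ?_ _)
  refine (mul_le_mul_right hS R).trans (le_of_eq ?_)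
  push_cast
  rw [mul_pow]
  ring

theorem blockNorm_error_le (hC : CubeBound q (fun i => ENNReal.ofReal (w i)) C)
    (hK : KernelBound q w K) (hN : 1 ≤ N) (hA : IsMatrixOf A T) (hTG : T * G = 1)
    (hP : IsMatrixOf (parametrixMatrix N G) P) (c : Wlp q w) (n : Fin d → ℤ) :
    blockNorm N ((T * P - 1) c) n ≤
      ∑' l, errorKernel (matrixKernel A) (K * ‖G‖ₑ * (C ^ (1 / q) * 8 ^ d))
        (C ^ (1 / q) * 4 ^ d * ‖G‖ₑ) N (n - l) * blockNorm N c l := by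
  refine (blockNorm_map_le N _ c n).trans (ENNReal.tsum_le_tsum fun l => ?_)
  unfold errorKernel
  rcases le_or_gt ‖n - l‖ 7 with h | h
  · refine (blockNorm_error_near hC hK hN hA hTG hP h c).trans ?_
    gcongr
    rw [if_pos h, mul_one]
    exact le_self_add
  · refine (blockNorm_error_far hC hN hA hTG hP h c).trans ?_
    gcongr
    rw [max_eq_left h.le]
    exact le_add_self

/-- The factor 15^d counts the points of the ball of radius 7. Everything on the right is small if X
is large and N is large compared with X. -/
theorem radialSum_errorKernel_le (f : (Fin d → ℤ) → ℝ≥0∞) (a b : ℝ≥0∞) (hN : 1 ≤ N) (X : ℕ) :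
    radialSum 1 (errorKernel f a b N) ≤
      a * (15 ^ d : ℕ) * (ENNReal.ofReal (X / N) * radialSum 1 f +
        ∑' k : Fin d → ℤ, radialSup f (max ‖k‖ X)) +
      b * ((5 ^ d : ℕ) * ∑' k : Fin d → ℤ, radialSup f (max ‖k‖ N)) := by
  set S := radialSum 1 (fun x => f x * ENNReal.ofReal (min 1 (‖x‖ / N))) with hS
  let H : ℝ → ℝ≥0∞ := fun r => a * S * (if r ≤ 7 then 1 else 0) +
    b * ((N : ℝ≥0∞) ^ d * radialSup f (N * (max r 7 - 3)))
  have hH : Antitone H := by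
    intro r s hrs
    simp only [H]
    gcongr
    · split_ifs with h1 h2
      · exact le_rfl
      · exact absurd (hrs.trans h1) h2
      · exact zero_le
      · exact le_rfl
    · exact radialSup_antitone f (by gcongr)
  rw [radialSum_one]
  calc ∑' k : Fin d → ℤ, radialSup (errorKernel f a b N) ‖k‖ ≤ ∑' k : Fin d → ℤ, H ‖k‖ :=
        ENNReal.tsum_le_tsum fun k => radialSup_of_antitone hH _
    _ = a * S * (15 ^ d : ℕ) +
        b * ((N : ℝ≥0∞) ^ d * ∑' k : Fin d → ℤ, radialSup f (N * (max ‖k‖ 7 - 3))) := by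
        simp only [H]
        rw [ENNReal.tsum_add, ENNReal.tsum_mul_left, ENNReal.tsum_mul_left, ENNReal.tsum_mul_left,
          tsum_eq_sum (s := latticeBall d 7)]
        · have : ∀ k ∈ latticeBall d 7, (if ‖k‖ ≤ 7 then (1 : ℝ≥0∞) else 0) = 1 := by
            intro k hk
            rw [mem_latticeBall] at hk
            exact if_pos (by exact_mod_cast hk)
          rw [Finset.sum_congr rfl this, Finset.sum_const, card_latticeBall]
          simp
        · intro k hk
          rw [mem_latticeBall] at hk
          exact if_neg (by exact_mod_cast hk)
    _ ≤ a * (ENNReal.ofReal (X / N) * radialSum 1 f +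
        ∑' k : Fin d → ℤ, radialSup f (max ‖k‖ X)) * (15 ^ d : ℕ) +
      b * ((5 ^ d : ℕ) * ∑' k : Fin d → ℤ, radialSup f (max ‖k‖ N)) := by
        exact add_le_add (mul_le_mul_left (mul_le_mul_right (radialSum_one_min_le hN f X) _) _)
          (mul_le_mul_right (pow_mul_tsum_block_le hN (radialSup_antitone f)) _)
    _ = _ := by ring

end Parametrix

/-! ### Neumann series for the parametrix and the entries of the inverse -/

section Neumann

variable {d : ℕ}

/-- The convolution powers of a kernel. -/
noncomputable def kernelPow (v : (Fin d → ℤ) → ℝ≥0∞) : ℕ → (Fin d → ℤ) → ℝ≥0∞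
  | 0 => fun x => if x = 0 then 1 else 0
  | k + 1 => kernelConv v (kernelPow v k)

theorem radialSum_kernelPow_le (v : (Fin d → ℤ) → ℝ≥0∞) (k : ℕ) :
    radialSum 1 (kernelPow v k) ≤ (4 * (5 ^ d : ℕ) * radialSum 1 v) ^ k := by
  induction k with
  | zero =>
    rw [radialSum_one, pow_zero, tsum_eq_single 0]
    · refine radialSup_le fun x _ => ?_
      simp only [kernelPow]
      split_ifs <;> simp
    · intro k hk
      refine le_antisymm (radialSup_le fun x hx => ?_) zero_le
      have : x ≠ 0 := by
        rintro rfl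
        rw [norm_zero] at hx
        exact hk (norm_le_zero_iff.1 hx)
      simp [kernelPow, this]
  | succ k ih =>
    calc radialSum 1 (kernelPow v (k + 1))
        ≤ 4 * (5 ^ d : ℕ) * (radialSum 1 v * radialSum 1 (kernelPow v k)) := radialSum_one_conv_le
      _ ≤ 4 * (5 ^ d : ℕ) * (radialSum 1 v * (4 * (5 ^ d : ℕ) * radialSum 1 v) ^ k) := by gcongr
      _ = _ := by ring

theorem exists_errorKernel_small [NeZero d] {f : (Fin d → ℤ) → ℝ≥0∞} (hf : radialSum 1 f < ∞)
    {a b : ℝ≥0∞} (ha : a ≠ ∞) (hb : b ≠ ∞) {ε : ℝ≥0∞} (hε : ε ≠ 0) :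
    ∃ N : ℕ, 1 ≤ N ∧ radialSum 1 (errorKernel f a b N) ≤ ε := by
  have hε3 : 0 < ε / 3 := ENNReal.div_pos hε (by simp)
  have hc : a * (15 ^ d : ℕ) ≠ ∞ := ENNReal.mul_ne_top ha (ENNReal.natCast_ne_top _)
  have hc' : b * (5 ^ d : ℕ) ≠ ∞ := ENNReal.mul_ne_top hb (ENNReal.natCast_ne_top _)
  have htail := tendsto_tsum_antitone_max (radialSup_antitone f) (by
    rw [← radialSum_one]; exact hf.ne)
  have t1 := ENNReal.Tendsto.const_mul htail (Or.inr hc)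
  have t2 := ENNReal.Tendsto.const_mul htail (Or.inr hc')
  rw [mul_zero] at t1 t2
  -- X is fixed before N: the tail beyond X does not involve N, and then X/N tends to 0.
  obtain ⟨X, hX⟩ := (t1.eventually_le_const hε3).exists
  have t3 : Tendsto (fun N : ℕ => a * (15 ^ d : ℕ) * (ENNReal.ofReal (X / N) * radialSum 1 f)) atTop
      (𝓝 0) := by
    have h1 : Tendsto (fun N : ℕ => ENNReal.ofReal ((X : ℝ) / N)) atTop (𝓝 0) := by
      have := ENNReal.tendsto_ofReal (tendsto_const_div_atTop_nhds_zero_nat (X : ℝ))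
      rwa [ENNReal.ofReal_zero] at this
    have h2 := ENNReal.Tendsto.mul_const (b := radialSum 1 f) h1 (Or.inr hf.ne)
    rw [zero_mul] at h2
    have h3 := ENNReal.Tendsto.const_mul h2 (Or.inr hc)
    rwa [mul_zero] at h3
  obtain ⟨N, hN1, hN2, hN3⟩ := ((eventually_ge_atTop 1).and
    ((t2.eventually_le_const hε3).and (t3.eventually_le_const hε3))).exists
  refine ⟨N, hN1, (radialSum_errorKernel_le f a b hN1 X).trans ?_⟩
  rw [mul_add, ← mul_assoc b]
  calc _ ≤ ε / 3 + ε / 3 + ε / 3 := add_le_add (add_le_add hN3 hX) hN2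
    _ = ε := ENNReal.add_thirds ε

variable {q : ℝ} {w : (Fin d → ℤ) → ℝ} [hq : Fact (1 ≤ q)] [hw : Fact (∀ i, 0 < w i)]
  {C K : ℝ≥0∞} {A : Matrix (Fin d → ℤ) (Fin d → ℤ) ℂ} {T G P E : Wlp q w →L[ℂ] Wlp q w} {N : ℕ}

theorem blockNorm_pow_single_le (hN : 1 ≤ N) {v : (Fin d → ℤ) → ℝ≥0∞}
    (hE : ∀ c n, blockNorm N (E c) n ≤ ∑' l, v (n - l) * blockNorm N c l) (j : Fin d → ℤ) (k : ℕ)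
    (n : Fin d → ℤ) :
    blockNorm N ((E ^ k) (wlpSingle j)) n ≤ kernelPow v k (n - blockIndex N j) := by
  induction k generalizing n with
  | zero =>
    simpa [kernelPow, sub_eq_zero] using blockNorm_single_le (q := q) (w := w) hN j n
  | succ k ih =>
    rw [pow_succ']
    refine (hE _ n).trans ((ENNReal.tsum_le_tsum fun l => mul_le_mul_right (ih l) _).trans
      (le_of_eq ?_))
    change _ = kernelConv v (kernelPow v k) _
    unfold kernelConv
    rw [← (Equiv.subLeft n).tsum_eq]
    refine tsum_congr fun x => ?_
    simp only [Equiv.subLeft_apply]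
    congr 2
    · abel
    · abel

theorem IsMatrixOf.enorm_apply_coord_le (hA : IsMatrixOf A T) (c : Wlp q w) (i : Fin d → ℤ) :
    ‖T c i‖ₑ ≤ ∑' j, matrixKernel A (i - j) * ‖c j‖ₑ := by
  rw [← (hA c i).tsum_eq]
  exact enorm_tsum_matrix_le _ i

theorem eq_sum_add_mul_pow {R : Type*} [Ring R] {g p e : R} (h : g = p + g * e) (M : ℕ) :
    g = ∑ k ∈ Finset.range M, p * e ^ k + g * e ^ M := by
  induction M with
  | zero => simp
  | succ M ih =>
    rw [Finset.sum_range_succ]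
    conv_lhs => rw [ih]
    conv_lhs => enter [2, 1]; rw [h]
    rw [add_mul, pow_succ', mul_assoc, add_assoc]

/-- The inverse of an operator whose matrix has a summable radial majorant has a matrix with a
summable radial majorant. -/
theorem radialSum_opMatrix_inverse_lt_top [NeZero d]
    (hC : CubeBound q (fun i => ENNReal.ofReal (w i)) C) (hCt : C ≠ ∞)
    (hK : KernelBound q w K) (hKt : K ≠ ∞) (hA : IsMatrixOf A T)
    (hAs : radialSum 1 (matrixKernel A) < ∞) (hTG : T * G = 1) (hGT : G * T = 1) :
    radialSum 1 (matrixKernel (opMatrix G)) < ∞ := by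
  have hq0 := q_pos q
  have hγ : C ^ (1 / q) ≠ ∞ := ENNReal.rpow_ne_top_of_nonneg (by positivity) hCt
  set a := K * ‖G‖ₑ * (C ^ (1 / q) * 8 ^ d) with ha
  set b := C ^ (1 / q) * 4 ^ d * ‖G‖ₑ with hb
  have hat : a ≠ ∞ := ENNReal.mul_ne_top (ENNReal.mul_ne_top hKt enorm_ne_top)
    (ENNReal.mul_ne_top hγ (ENNReal.pow_ne_top (by simp)))
  have hbt : b ≠ ∞ := ENNReal.mul_ne_top (ENNReal.mul_ne_top hγ (ENNReal.pow_ne_top (by simp)))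
    enorm_ne_top
  have h5 : (4 * (5 ^ d : ℕ) : ℝ≥0∞) ≠ 0 := by
    simp
  have h5t : (4 * (5 ^ d : ℕ) : ℝ≥0∞) ≠ ∞ := ENNReal.mul_ne_top (by simp) (ENNReal.natCast_ne_top _)
  -- Each convolution costs the factor 4·5^d, so this choice makes the radial sums of the
  -- convolution powers decay like 2^{-k}.
  obtain ⟨N, hN, hsmall⟩ := exists_errorKernel_small hAs hat hbt
    (ε := (4 * (5 ^ d : ℕ) : ℝ≥0∞)⁻¹ * 2⁻¹) (mul_ne_zero (ENNReal.inv_ne_zero.2 h5t) (by simp))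
  set v := errorKernel (matrixKernel A) a b N with hv
  have hv2 : 4 * (5 ^ d : ℕ) * radialSum 1 v ≤ 2⁻¹ := by
    refine (mul_le_mul_right hsmall _).trans (le_of_eq ?_)
    rw [← mul_assoc, ENNReal.mul_inv_cancel h5 h5t, one_mul]
  have hBs := radialSum_parametrixMatrix_lt_top (G := G) hC hCt hN
  obtain ⟨P, hP⟩ := exists_isMatrixOf hKt hK hBs
  set B := parametrixMatrix N G with hB
  set E : Wlp q w →L[ℂ] Wlp q w := 1 - T * P with hE
  have hGE : G = P + G * E := by
    rw [hE, mul_sub, mul_one, ← mul_assoc, hGT, one_mul, add_sub_cancel]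
  have hEv : ∀ c n, blockNorm N (E c) n ≤ ∑' l, v (n - l) * blockNorm N c l := by
    intro c n
    have h1 : E c = (T * P - 1) (-c) := by
      rw [map_neg, ← neg_apply, neg_sub]
    have h2 : ∀ l, blockNorm N (-c) l = blockNorm N c l := fun l => by
      rw [blockNorm, map_neg, enorm_neg, blockNorm]
    rw [h1]
    refine (blockNorm_error_le hC hK hN hA hTG hP (-c) n).trans (le_of_eq ?_)
    simp only [h2]
    rfl
  set cN := C ^ (1 / q) * (N : ℝ≥0∞) ^ d with hcN
  have hcNt : cN ≠ ∞ := ENNReal.mul_ne_top hγ (ENNReal.pow_ne_top (ENNReal.natCast_ne_top _))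
  set F : ℕ → (Fin d → ℤ) → ℝ≥0∞ := fun k x => cN * blockLift N (kernelPow v k) x with hF
  have hEk : ∀ k i j, ‖(E ^ k) (wlpSingle j) i‖ₑ ≤ F k (i - j) := by
    intro k i j
    refine (hC.enorm_apply_le_blockNorm hN _ i).trans ?_
    simp only [hF]
    gcongr
    exact (blockNorm_pow_single_le hN hEv j k _).trans (le_blockLift hN _ i j)
  have hFk : ∀ k, radialSum 1 (F k) ≤ cN * ((4 * N + 1) ^ d : ℕ) * 2⁻¹ ^ k := by
    intro k
    refine (radialSum_const_mul_le zero_le_one _).trans ?_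
    rw [ENNReal.rpow_one, mul_assoc cN]
    refine mul_le_mul_right ?_ cN
    refine (radialSum_blockLift_le hN _).trans ?_
    gcongr
    exact (radialSum_kernelPow_le v k).trans (by gcongr)
  have hDt : cN * ((4 * N + 1) ^ d : ℕ) ≠ ∞ := ENNReal.mul_ne_top hcNt (ENNReal.natCast_ne_top _)
  set D := cN * ((4 * N + 1) ^ d : ℕ) with hD
  have hPE : ∀ k i j, ‖(P * E ^ k) (wlpSingle j) i‖ₑ ≤ kernelConv (matrixKernel B) (F k) (i - j) := by
    intro k i j
    refine (hP.enorm_apply_coord_le _ i).trans ?_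
    unfold kernelConv
    rw [← (Equiv.subLeft i).tsum_eq]
    refine ENNReal.tsum_le_tsum fun x => ?_
    simp only [Equiv.subLeft_apply, sub_sub_cancel]
    refine mul_le_mul_right ((hEk k _ j).trans (le_of_eq ?_)) _
    congr 1
    abel
  -- The remainder tends to zero entrywise, since the kernel of E^M controls E^M on unit sequences;
  -- the operator norm of E itself is never estimated.
  have hrem : ∀ M i j, ‖(G * E ^ M) (wlpSingle j) i‖ₑ * ENNReal.ofReal (w i) ^ (1 / q) ≤
      ‖G‖ₑ * (K * D * ‖(wlpSingle j : Wlp q w)‖ₑ) * 2⁻¹ ^ M := by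
    intro M i j
    have h1 := enorm_apply_mul_le (q := q) (w := w) ((G * E ^ M) (wlpSingle j)) i
    rw [← wlp_enorm_eq] at h1
    have h2 : ‖(E ^ M) (wlpSingle j)‖ₑ ≤ K * radialSum 1 (F M) * ‖(wlpSingle j : Wlp q w)‖ₑ := by
      rw [wlp_enorm_eq, wlp_enorm_eq]
      refine hK _ _ _ fun i => (hEk M i j).trans ?_
      refine le_trans ?_ (ENNReal.le_tsum j)
      simp [wlpSingle_apply]
    calc _ ≤ _ := h1
      _ ≤ ‖G‖ₑ * ‖(E ^ M) (wlpSingle j)‖ₑ := ContinuousLinearMap.le_opENorm G _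
      _ ≤ ‖G‖ₑ * (K * (D * 2⁻¹ ^ M) * ‖(wlpSingle j : Wlp q w)‖ₑ) := by
          gcongr
          exact h2.trans (by gcongr; exact hFk M)
      _ = _ := by ring
  have hentry : ∀ i j, ‖opMatrix G i j‖ₑ ≤ ∑' k, kernelConv (matrixKernel B) (F k) (i - j) := by
    intro i j
    set W := ENNReal.ofReal (w i) ^ (1 / q) with hW
    rw [← ENNReal.mul_le_mul_iff_left (weight_rpow_ne_zero (q := q) (w := w) i) (weight_rpow_ne_top i)]
    set S := ∑' k, kernelConv (matrixKernel B) (F k) (i - j) with hS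
    set R := ‖G‖ₑ * (K * D * ‖(wlpSingle j : Wlp q w)‖ₑ) with hR
    have hRt : R ≠ ∞ := ENNReal.mul_ne_top enorm_ne_top
      (ENNReal.mul_ne_top (ENNReal.mul_ne_top hKt hDt) enorm_ne_top)
    have hlim : Tendsto (fun M : ℕ => S * W + R * 2⁻¹ ^ M) atTop (𝓝 (S * W + R * 0)) :=
      tendsto_const_nhds.add (ENNReal.Tendsto.const_mul
        (ENNReal.tendsto_pow_atTop_nhds_zero_of_lt_one (by simp)) (Or.inr hRt))
    rw [mul_zero, add_zero] at hlim
    refine ge_of_tendsto' hlim fun M => ?_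
    have h1 : opMatrix G i j = ∑ k ∈ Finset.range M, (P * E ^ k) (wlpSingle j) i +
        (G * E ^ M) (wlpSingle j) i := by
      have h2 := congrArg (fun S : Wlp q w →L[ℂ] Wlp q w => S (wlpSingle j) i)
        (eq_sum_add_mul_pow hGE M)
      simp only [add_apply, sum_apply, wlp_add_apply,
        wlp_sum_apply] at h2
      exact h2
    rw [h1]
    calc _ ≤ (∑ k ∈ Finset.range M, ‖(P * E ^ k) (wlpSingle j) i‖ₑ +
          ‖(G * E ^ M) (wlpSingle j) i‖ₑ) * W := by
          gcongr
          exact (enorm_add_le _ _).trans (add_le_add (enorm_sum_le _ _) le_rfl)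
      _ ≤ _ := by
          rw [add_mul]
          refine add_le_add (mul_le_mul_left ?_ _) (hrem M i j)
          exact (Finset.sum_le_sum fun k _ => hPE k i j).trans (ENNReal.sum_le_tsum _)
  calc radialSum 1 (matrixKernel (opMatrix G))
      ≤ radialSum 1 (fun x => ∑' k, kernelConv (matrixKernel B) (F k) x) :=
        radialSum_mono zero_le_one (matrixKernel_le hentry)
    _ ≤ ∑' k, radialSum 1 (kernelConv (matrixKernel B) (F k)) := radialSum_one_tsum_le _
    _ ≤ ∑' k : ℕ, 4 * (5 ^ d : ℕ) * radialSum 1 (matrixKernel B) * D * 2⁻¹ ^ k := by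
        refine ENNReal.tsum_le_tsum fun k => radialSum_one_conv_le.trans ?_
        calc _ ≤ 4 * (5 ^ d : ℕ) * (radialSum 1 (matrixKernel B) * (D * 2⁻¹ ^ k)) := by
              gcongr
              exact hFk k
          _ = _ := by ring
    _ < ∞ := by
        rw [ENNReal.tsum_mul_left, ENNReal.tsum_geometric]
        refine ENNReal.mul_lt_top (ENNReal.mul_lt_top (ENNReal.mul_lt_top h5t.lt_top hBs)
          hDt.lt_top) ?_
        rw [ENNReal.one_sub_inv_two]
        simp

end Neumann

/-! ### Weighted estimates for the inverse by truncation of the weight -/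

section Bootstrap

variable {d : ℕ} {f g h e U V : (Fin d → ℤ) → ℝ≥0∞} {p : ℝ}

theorem radialSum_lt_top_of_one (hp : 1 ≤ p) (hf : radialSum 1 f < ∞) : radialSum p f < ∞ := by
  have hb : radialSup f 0 < ∞ := radialSup_lt_top le_rfl hf 0
  have h1 : radialSum p f ≤ radialSup f 0 ^ (p - 1) * radialSum 1 f := by
    rw [radialSum_one, radialSum, ← ENNReal.tsum_mul_left]
    refine ENNReal.tsum_le_tsum fun k => ?_
    conv_lhs => rw [show p = (p - 1) + 1 by ring]
    rw [ENNReal.rpow_add_of_nonneg _ _ (by linarith) zero_le_one, ENNReal.rpow_one]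
    gcongr
    exact radialSup_le_zero _
  exact h1.trans_lt (ENNReal.mul_lt_top (ENNReal.rpow_lt_top_of_nonneg (by linarith) hb.ne) hf)

/-- Absorption needs a finite quantity, which is available for bounded weights only. Monotone
convergence then removes the truncation. -/
theorem radialSum_le_of_truncate (hp : 0 < p) (hU : ∀ x, U x ≠ ∞) {c : ℝ≥0∞}
    (hc : ∀ M : ℕ, 1 ≤ M → radialSum p (fun x => f x * min (U x) M) ≤ c) :
    radialSum p (fun x => f x * U x) ≤ c := by
  set F : ℕ → (Fin d → ℤ) → ℝ≥0∞ :=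
    fun M k => radialSup (fun x => f x * min (U x) (M + 1 : ℕ)) ‖k‖ ^ p with hF
  have hmono : Monotone F := by
    intro M M' hM k
    refine ENNReal.rpow_le_rpow (radialSup_mono (fun x => ?_) _) hp.le
    gcongr
  have hle : ∀ k : Fin d → ℤ, radialSup (fun x => f x * U x) ‖k‖ ^ p ≤ ⨆ M, F M k := by
    intro k
    rw [← ENNReal.le_rpow_inv_iff hp]
    refine radialSup_le fun x hx => ?_
    obtain ⟨M, hM⟩ := ENNReal.exists_nat_gt (hU x)
    rw [ENNReal.le_rpow_inv_iff hp]
    refine le_trans ?_ (le_iSup (fun M => F M k) M)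
    refine ENNReal.rpow_le_rpow ?_ hp.le
    refine le_trans (le_of_eq ?_) (le_radialSup (f := fun x => f x * min (U x) (M + 1 : ℕ)) hx)
    rw [min_eq_left (hM.le.trans (by gcongr; omega))]
  calc radialSum p (fun x => f x * U x) ≤ ∑' k, ⨆ M, F M k := ENNReal.tsum_le_tsum hle
    _ = ⨆ M, ∑' k, F M k := by
        simp only [← MeasureTheory.lintegral_count]
        exact MeasureTheory.lintegral_iSup (fun M => measurable_of_countable _) hmono
    _ ≤ c := iSup_le fun M => hc (M + 1) (by omega)

theorem le_two_mul_of_le_add {x a b : ℝ≥0∞} (hx : x ≠ ∞) (hb : b ≤ 2⁻¹) (h : x ≤ a + b * x) :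
    x ≤ 2 * a := by
  have h1 : x ≤ a + 2⁻¹ * x := h.trans (by gcongr)
  have h2 : 2⁻¹ * x ≠ ∞ := ENNReal.mul_ne_top (by simp) hx
  have h3 : x = 2⁻¹ * x + 2⁻¹ * x := by
    rw [← add_mul, ENNReal.inv_two_add_inv_two, one_mul]
  have h4 : 2⁻¹ * x ≤ a := by
    rw [← ENNReal.add_le_add_iff_right h2]
    rwa [← h3]
  calc x = 2 * (2⁻¹ * x) := by
        rw [← mul_assoc, ENNReal.mul_inv_cancel (by simp) (by simp), one_mul]
    _ ≤ 2 * a := by gcongr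

/-- Truncation preserves the weight inequality with the same auxiliary factor, because that factor
is at least one. -/
theorem min_natCast_mul_le {a b c : ℝ≥0∞} (h : a ≤ b * c) (hc : 1 ≤ c) (M : ℕ) :
    min a M ≤ min b M * c := by
  rw [min_mul_of_nonneg _ _ zero_le]
  exact min_le_min h (le_mul_of_one_le_right' hc)

theorem radialSum_min_lt_top (hp : 1 ≤ p) (hf : radialSum 1 f < ∞) (M : ℕ) :
    radialSum p (fun x => f x * min (U x) M) < ∞ := by
  have hp0 : 0 ≤ p := by linarith
  have h1 : radialSum p (fun x => f x * min (U x) M) ≤ (M : ℝ≥0∞) ^ p * radialSum p f := by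
    refine le_trans (radialSum_mono hp0 fun x => ?_) (radialSum_const_mul_le hp0 _)
    rw [mul_comm]
    gcongr
    exact min_le_right _ _
  exact h1.trans_lt (ENNReal.mul_lt_top (ENNReal.rpow_lt_top_of_nonneg hp0
    (ENNReal.natCast_ne_top _)) (radialSum_lt_top_of_one hp hf))

theorem radialSum_add_conv_mul_le (hp : 1 ≤ p) {W : (Fin d → ℤ) → ℝ≥0∞}
    (hW : ∀ x y : Fin d → ℤ, ‖y‖ ≤ ‖x‖ → W (x + y) ≤ W x * V y)
    (hf : ∀ x, f x ≤ g x + kernelConv h e x) :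
    radialSum p (fun x => f x * W x) ≤ 2 ^ p * (radialSum p (fun x => g x * W x) +
      2 ^ p * (5 ^ d : ℕ) * (radialSum p (fun x => h x * W x) * (∑' y, e y * V y) ^ p +
        radialSum p (fun x => e x * W x) * (∑' y, h y * V y) ^ p)) := by
  calc radialSum p (fun x => f x * W x)
      ≤ radialSum p (fun x => g x * W x + kernelConv h e x * W x) :=
        radialSum_mono (by linarith) fun x => by rw [← add_mul]; gcongr; exact hf x
    _ ≤ 2 ^ p * (radialSum p (fun x => g x * W x) + radialSum p (fun x => kernelConv h e x * W x)) :=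
        radialSum_add_le hp
    _ ≤ _ := by
        gcongr
        exact radialSum_conv_le hp hW

/-- A priori estimate in a weighted space with a submultiplicative weight. -/
theorem radialSum_one_weight_lt_top (hV1 : ∀ x, 1 ≤ V x) (hVt : ∀ x, V x ≠ ∞)
    (hVV : ∀ x y : Fin d → ℤ, ‖y‖ ≤ ‖x‖ → V (x + y) ≤ V x * V y)
    (hf1 : radialSum 1 f < ∞) (hf : ∀ x, f x ≤ g x + kernelConv f e x)
    (hg : radialSum 1 (fun x => g x * V x) < ∞)
    (he : 8 * (5 ^ d : ℕ) * radialSum 1 (fun x => e x * V x) ≤ 2⁻¹) :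
    radialSum 1 (fun x => f x * V x) < ∞ := by
  refine lt_of_le_of_lt (radialSum_le_of_truncate (c := 2 * (2 * radialSum 1 (fun x => g x * V x)))
    zero_lt_one hVt fun M hM => ?_) (ENNReal.mul_lt_top (by simp) (ENNReal.mul_lt_top (by simp) hg))
  have hM1 : (1 : ℝ≥0∞) ≤ M := by exact_mod_cast hM
  refine le_two_mul_of_le_add (radialSum_min_lt_top le_rfl hf1 M).ne he ?_
  -- Both factors are truncated, because the sum of `f` against the second one has to be absorbed as
  -- well.
  have hW : ∀ x y : Fin d → ℤ, ‖y‖ ≤ ‖x‖ → min (V (x + y)) M ≤ min (V x) M * min (V y) M := by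
    intro x y hxy
    rw [mul_min_of_nonneg _ _ zero_le]
    refine le_min (min_natCast_mul_le (hVV x y hxy) (hV1 y) M) ?_
    exact (min_le_right _ _).trans (le_mul_of_one_le_left' (le_min (hV1 x) hM1))
  refine (radialSum_add_conv_mul_le le_rfl (W := fun x => min (V x) M) hW hf).trans ?_
  simp only [ENNReal.rpow_one]
  have h1 : ∑' y, e y * min (V y) M ≤ radialSum 1 (fun x => e x * V x) :=
    (tsum_le_radialSum _).trans (radialSum_mono zero_le_one fun x => by gcongr; exact min_le_left _ _)
  have h2 : radialSum 1 (fun x => e x * min (V x) M) ≤ radialSum 1 (fun x => e x * V x) :=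
    radialSum_mono zero_le_one fun x => by gcongr; exact min_le_left _ _
  have h3 : radialSum 1 (fun x => g x * min (V x) M) ≤ radialSum 1 (fun x => g x * V x) :=
    radialSum_mono zero_le_one fun x => by gcongr; exact min_le_left _ _
  calc _ ≤ 2 * (radialSum 1 (fun x => g x * V x) + 2 * (5 ^ d : ℕ) *
      (radialSum 1 (fun x => f x * min (V x) M) * radialSum 1 (fun x => e x * V x) +
        radialSum 1 (fun x => e x * V x) * radialSum 1 (fun x => f x * min (V x) M))) := by
        gcongr
        exact tsum_le_radialSum _
    _ = _ := by ring

/-- A priori estimate in the Beurling class. -/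
theorem radialSum_weight_lt_top (hp : 1 ≤ p) (hV1 : ∀ x, 1 ≤ V x) (hUt : ∀ x, U x ≠ ∞)
    (hUV : ∀ x y : Fin d → ℤ, ‖y‖ ≤ ‖x‖ → U (x + y) ≤ U x * V y)
    (hf1 : radialSum 1 f < ∞) (hf : ∀ x, f x ≤ g x + kernelConv f e x)
    (hg : radialSum p (fun x => g x * U x) < ∞) (heU : radialSum p (fun x => e x * U x) < ∞)
    (hfV : ∑' y, f y * V y < ∞)
    (he : 2 ^ p * (2 ^ p * (5 ^ d : ℕ)) * (∑' y, e y * V y) ^ p ≤ 2⁻¹) :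
    radialSum p (fun x => f x * U x) < ∞ := by
  have hp0 : 0 ≤ p := by linarith
  have h2p : (2 : ℝ≥0∞) ^ p < ∞ := ENNReal.rpow_lt_top_of_nonneg hp0 (by simp)
  refine lt_of_le_of_lt (radialSum_le_of_truncate (c := 2 * (2 ^ p * (radialSum p (fun x => g x * U x) +
    2 ^ p * (5 ^ d : ℕ) * (radialSum p (fun x => e x * U x) * (∑' y, f y * V y) ^ p))))
    (by linarith) hUt fun M hM => ?_) ?_
  · refine le_two_mul_of_le_add (radialSum_min_lt_top hp hf1 M).ne he ?_
    refine (radialSum_add_conv_mul_le hp (W := fun x => min (U x) M) (V := V)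
      (fun x y hxy => min_natCast_mul_le (hUV x y hxy) (hV1 y) M) hf).trans ?_
    have h2 : radialSum p (fun x => e x * min (U x) M) ≤ radialSum p (fun x => e x * U x) :=
      radialSum_mono hp0 fun x => by gcongr; exact min_le_left _ _
    have h3 : radialSum p (fun x => g x * min (U x) M) ≤ radialSum p (fun x => g x * U x) :=
      radialSum_mono hp0 fun x => by gcongr; exact min_le_left _ _
    calc _ ≤ 2 ^ p * (radialSum p (fun x => g x * U x) + 2 ^ p * (5 ^ d : ℕ) *
        (radialSum p (fun x => f x * min (U x) M) * (∑' y, e y * V y) ^ p +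
          radialSum p (fun x => e x * U x) * (∑' y, f y * V y) ^ p)) := by gcongr
      _ = _ := by ring
  · refine ENNReal.mul_lt_top (by simp) (ENNReal.mul_lt_top h2p (ENNReal.add_lt_top.2 ⟨hg, ?_⟩))
    exact ENNReal.mul_lt_top (ENNReal.mul_lt_top h2p (by simp)) (ENNReal.mul_lt_top heU
      (ENNReal.rpow_lt_top_of_nonneg hp0 hfV.ne))

/-- The restriction of a kernel to a ball. -/
noncomputable def kernelHead (R : ℕ) (f : (Fin d → ℤ) → ℝ≥0∞) (x : Fin d → ℤ) : ℝ≥0∞ :=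
  if ‖x‖ ≤ R then f x else 0

/-- The restriction of a kernel to the complement of a ball. -/
noncomputable def kernelTail (R : ℕ) (f : (Fin d → ℤ) → ℝ≥0∞) (x : Fin d → ℤ) : ℝ≥0∞ :=
  if ‖x‖ ≤ R then 0 else f x

/-- The kernel of the identity matrix. -/
noncomputable def kernelOne (x : Fin d → ℤ) : ℝ≥0∞ := if x = 0 then 1 else 0

/-- The relation between the kernels `h` of a matrix and `f` of its inverse that comes from the
truncation of the inverse. -/
def KernelInverse (h f : (Fin d → ℤ) → ℝ≥0∞) : Prop :=
  ∀ R : ℕ, ∃ e : (Fin d → ℤ) → ℝ≥0∞, (∀ x, f x ≤ kernelHead R f x + kernelConv f e x) ∧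
    (∀ x, e x ≤ kernelConv h (kernelTail R f) x) ∧
    (∀ x, e x ≤ kernelOne x + kernelConv h (kernelHead R f) x)

/-- A radially increasing weight given by a function of the norm. -/
noncomputable def radialWeight (ρ : ℝ → ℝ) (x : Fin d → ℤ) : ℝ≥0∞ := ENNReal.ofReal (ρ ‖x‖)

theorem radialSum_kernelTail_le (R : ℕ) :
    radialSum 1 (fun x => kernelTail R f x * V x) ≤
      ∑' k : Fin d → ℤ, radialSup (fun x => f x * V x) (max ‖k‖ R) := by
  rw [radialSum_one]
  refine ENNReal.tsum_le_tsum fun k => radialSup_le fun x hx => ?_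
  unfold kernelTail
  split_ifs with h
  · simp
  · exact le_radialSup (f := fun x => f x * V x) (max_le hx (not_le.1 h).le)

theorem tendsto_radialSum_kernelTail [NeZero d] (hf : radialSum 1 (fun x => f x * V x) < ∞) :
    Tendsto (fun R => radialSum 1 (fun x => kernelTail R f x * V x)) atTop (𝓝 0) :=
  tendsto_of_tendsto_of_tendsto_of_le_of_le tendsto_const_nhds
    (tendsto_tsum_antitone_max (radialSup_antitone _) (by rw [← radialSum_one]; exact hf.ne))
    (fun _ => zero_le) fun _ => radialSum_kernelTail_le _

theorem radialSum_one_conv_weight_le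
    (hVV : ∀ x y : Fin d → ℤ, ‖y‖ ≤ ‖x‖ → V (x + y) ≤ V x * V y) :
    radialSum 1 (fun x => kernelConv f g x * V x) ≤ 4 * (5 ^ d : ℕ) *
      (radialSum 1 (fun x => f x * V x) * radialSum 1 (fun x => g x * V x)) := by
  have h1 := radialSum_conv_le (f := f) (g := g) (p := 1) le_rfl hVV
  simp only [ENNReal.rpow_one] at h1
  calc _ ≤ _ := h1
    _ ≤ 2 * (5 ^ d : ℕ) * (radialSum 1 (fun x => f x * V x) * radialSum 1 (fun x => g x * V x) +
        radialSum 1 (fun x => g x * V x) * radialSum 1 (fun x => f x * V x)) := by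
      gcongr <;> exact tsum_le_radialSum _
    _ = _ := by ring

/-- The radius depends only on `h`, `f` and the weight, so it can be fixed before the error kernel
`e` is taken from `KernelInverse`. -/
theorem exists_tail_small [NeZero d]
    (hVV : ∀ x y : Fin d → ℤ, ‖y‖ ≤ ‖x‖ → V (x + y) ≤ V x * V y)
    (hh : radialSum 1 (fun x => h x * V x) < ∞) (hf : radialSum 1 (fun x => f x * V x) < ∞)
    {ε : ℝ≥0∞} (hε : 0 < ε) :
    ∃ R : ℕ, ∀ e : (Fin d → ℤ) → ℝ≥0∞, (∀ x, e x ≤ kernelConv h (kernelTail R f) x) →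
      radialSum 1 (fun x => e x * V x) ≤ ε := by
  have hc : 4 * (5 ^ d : ℕ) * radialSum 1 (fun x => h x * V x) ≠ ∞ :=
    ENNReal.mul_ne_top (ENNReal.mul_ne_top (by simp) (ENNReal.natCast_ne_top _)) hh.ne
  have ht := ENNReal.Tendsto.const_mul (tendsto_radialSum_kernelTail hf) (Or.inr hc)
  rw [mul_zero] at ht
  obtain ⟨R, hR⟩ := (ht.eventually_le_const hε).exists
  refine ⟨R, fun e he => le_trans (radialSum_mono zero_le_one fun x => ?_)
    ((radialSum_one_conv_weight_le hVV (f := h) (g := kernelTail R f)).trans ?_)⟩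
  · gcongr
    exact he x
  · rwa [← mul_assoc]

theorem radialSum_kernelHead_lt_top (hp : 0 < p) {ρ : ℝ → ℝ} (hρ : MonotoneOn ρ (Set.Ici 0))
    (hf : radialSum 1 f < ∞) (R : ℕ) :
    radialSum p (fun x => kernelHead R f x * radialWeight ρ x) < ∞ := by
  refine radialSum_lt_top_of_band hp (c := radialSup f 0 * ENNReal.ofReal (ρ R))
    (ENNReal.mul_ne_top (radialSup_lt_top le_rfl hf 0).ne ENNReal.ofReal_ne_top) R ?_ ?_
  · intro x
    unfold kernelHead
    split_ifs with h
    · refine mul_le_mul' (le_radialSup (norm_nonneg _)) (ENNReal.ofReal_le_ofReal ?_)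
      exact hρ (norm_nonneg x) (by simp) h
    · simp
  · intro x hx
    rw [kernelHead, if_neg (not_le.2 hx), zero_mul]

theorem radialSum_kernelOne_lt_top (hp : 0 < p) (ρ : ℝ → ℝ) :
    radialSum p (fun x : Fin d → ℤ => kernelOne x * radialWeight ρ x) < ∞ := by
  refine radialSum_lt_top_of_band hp (c := ENNReal.ofReal (ρ 0)) ENNReal.ofReal_ne_top 0 ?_ ?_
  · intro x
    unfold kernelOne
    split_ifs with h
    · rw [h, one_mul, radialWeight, norm_zero]
    · simp
  · intro x hx
    have : x ≠ 0 := by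
      rintro rfl
      simp at hx
    simp [kernelOne, this]

/-- The inverse belongs to the Beurling class if it belongs to the smaller class with weight `V`. -/
theorem KernelInverse.radialSum_lt_top [NeZero d] (hp : 1 ≤ p) {ρ σ : ℝ → ℝ}
    (hρ : MonotoneOn ρ (Set.Ici 0)) (hσ : MonotoneOn σ (Set.Ici 0)) (hσ1 : ∀ r, 0 ≤ r → 1 ≤ σ r)
    (hUV : ∀ x y : Fin d → ℤ, ‖y‖ ≤ ‖x‖ →
      radialWeight ρ (x + y) ≤ radialWeight ρ x * radialWeight σ y)
    (hVV : ∀ x y : Fin d → ℤ, ‖y‖ ≤ ‖x‖ →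
      radialWeight σ (x + y) ≤ radialWeight σ x * radialWeight σ y)
    (hinv : KernelInverse h f) (hhU : radialSum p (fun x => h x * radialWeight ρ x) < ∞)
    (hhV : radialSum 1 (fun x => h x * radialWeight σ x) < ∞)
    (hfV : radialSum 1 (fun x => f x * radialWeight σ x) < ∞) :
    radialSum p (fun x => f x * radialWeight ρ x) < ∞ := by
  have hp0 : 0 < p := by linarith
  have hV1 : ∀ x : Fin d → ℤ, 1 ≤ radialWeight σ x := fun x => by
    rw [radialWeight, ENNReal.one_le_ofReal]
    exact hσ1 _ (norm_nonneg x)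
  have hf1 : radialSum 1 f < ∞ := lt_of_le_of_lt
    (radialSum_mono zero_le_one fun x => le_mul_of_one_le_right' (hV1 x)) hfV
  have h2p : (2 : ℝ≥0∞) ^ p < ∞ := ENNReal.rpow_lt_top_of_nonneg hp0.le (by simp)
  have hct : (2 : ℝ≥0∞) ^ p * (2 ^ p * (5 ^ d : ℕ)) ≠ ∞ :=
    ENNReal.mul_ne_top h2p.ne (ENNReal.mul_ne_top h2p.ne (ENNReal.natCast_ne_top _))
  have hc0 : (2 : ℝ≥0∞) ^ p * (2 ^ p * (5 ^ d : ℕ)) ≠ 0 := by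
    simp
  set c := (2 : ℝ≥0∞) ^ p * (2 ^ p * (5 ^ d : ℕ)) with hc
  -- The p-th power of this tolerance times the constant c of the a priori estimate is 1/2.
  obtain ⟨R, hR⟩ := exists_tail_small hVV hhV hfV (ε := (c⁻¹ * 2⁻¹) ^ p⁻¹)
    (ENNReal.rpow_pos (ENNReal.mul_pos (ENNReal.inv_ne_zero.2 hct) (by simp))
      (ENNReal.mul_ne_top (ENNReal.inv_ne_top.2 hc0) (by simp)))
  obtain ⟨e, he1, he2, he3⟩ := hinv R
  have hhead := radialSum_kernelHead_lt_top hp0 hρ hf1 R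
  have hheadV := radialSum_kernelHead_lt_top zero_lt_one hσ hf1 R
  refine radialSum_weight_lt_top hp hV1 (fun _ => ENNReal.ofReal_ne_top) hUV hf1 he1 hhead ?_
    ((tsum_le_radialSum _).trans_lt hfV) ?_
  -- The tail bound of `e` gives smallness but involves the unknown `f`; its other bound involves
  -- only `h` and a banded kernel, so it gives finiteness with the full weight.
  · refine (radialSum_add_conv_mul_le hp hUV he3).trans_lt ?_
    refine ENNReal.mul_lt_top h2p (ENNReal.add_lt_top.2 ⟨radialSum_kernelOne_lt_top hp0 ρ,
      ENNReal.mul_lt_top (ENNReal.mul_lt_top h2p (by simp)) (ENNReal.add_lt_top.2 ⟨?_, ?_⟩)⟩)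
    · exact ENNReal.mul_lt_top hhU (ENNReal.rpow_lt_top_of_nonneg hp0.le
        ((tsum_le_radialSum _).trans_lt hheadV).ne)
    · exact ENNReal.mul_lt_top hhead (ENNReal.rpow_lt_top_of_nonneg hp0.le
        ((tsum_le_radialSum _).trans_lt hhV).ne)
  · have h1 : (∑' y, e y * radialWeight σ y) ^ p ≤ c⁻¹ * 2⁻¹ := by
      rw [← ENNReal.le_rpow_inv_iff hp0]
      exact (tsum_le_radialSum _).trans (hR e he2)
    refine (mul_le_mul_right h1 c).trans (le_of_eq ?_)
    rw [← mul_assoc, ENNReal.mul_inv_cancel hc0 hct, one_mul]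

/-- The inverse belongs to the class with the submultiplicative weight `V` if `V` is a member of a
family of equivalent submultiplicative weights that decreases to one. -/
theorem KernelInverse.radialSum_one_lt_top [NeZero d] {σ : ℝ → ℝ} {σT : ℕ → ℝ → ℝ} {cT : ℕ → ℝ}
    (hσ : MonotoneOn σ (Set.Ici 0)) (hσT : ∀ T, MonotoneOn (σT T) (Set.Ici 0))
    (hσ1 : ∀ T r, 0 ≤ r → 1 ≤ σT T r) (hle : ∀ T r, 0 ≤ r → σT T r ≤ σ r)
    (hge : ∀ T r, 0 ≤ r → σ r ≤ cT T * σT T r)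
    (hlim : ∀ r, 0 ≤ r → Tendsto (fun T => σT T r) atTop (𝓝 1))
    (hVV : ∀ x y : Fin d → ℤ, ‖y‖ ≤ ‖x‖ →
      radialWeight σ (x + y) ≤ radialWeight σ x * radialWeight σ y)
    (hVVT : ∀ T, ∀ x y : Fin d → ℤ, ‖y‖ ≤ ‖x‖ →
      radialWeight (σT T) (x + y) ≤ radialWeight (σT T) x * radialWeight (σT T) y)
    (hinv : KernelInverse h f) (hhV : radialSum 1 (fun x => h x * radialWeight σ x) < ∞)
    (hf1 : radialSum 1 f < ∞) :
    radialSum 1 (fun x => f x * radialWeight σ x) < ∞ := by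
  have hσσ : ∀ r, 0 ≤ r → 1 ≤ σ r := fun r hr => (hσ1 0 r hr).trans (hle 0 r hr)
  have hV1 : ∀ x : Fin d → ℤ, 1 ≤ radialWeight σ x := fun x => by
    rw [radialWeight, ENNReal.one_le_ofReal]
    exact hσσ _ (norm_nonneg x)
  have hh1 : radialSum 1 h < ∞ := lt_of_le_of_lt
    (radialSum_mono zero_le_one fun x => le_mul_of_one_le_right' (hV1 x)) hhV
  have hct : (8 * (5 ^ d : ℕ) : ℝ≥0∞) ≠ ∞ := ENNReal.mul_ne_top (by simp) (ENNReal.natCast_ne_top _)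
  have hc0 : (8 * (5 ^ d : ℕ) : ℝ≥0∞) ≠ 0 := by simp
  set c : ℝ≥0∞ := 8 * (5 ^ d : ℕ) with hc
  set ε : ℝ≥0∞ := c⁻¹ * 2⁻¹ with hε
  have hε0 : ε ≠ 0 := mul_ne_zero (ENNReal.inv_ne_zero.2 hct) (by simp)
  have hε4 : 0 < ε / 2 / 2 := ENNReal.div_pos (ENNReal.div_pos hε0 (by simp)).ne' (by simp)
  -- R is chosen without weight, as nothing more is known about `f`. The parameter T of the weights
  -- is chosen only after `e` is fixed.
  obtain ⟨R, hR⟩ := exists_tail_small (V := fun _ => 1) (f := f) (h := h) (fun _ _ _ => by simp)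
    (by simpa using hh1) (by simpa using hf1) hε4
  obtain ⟨e, he1, he2, he3⟩ := hinv R
  have heR := hR e he2
  simp only [mul_one] at heR
  have heV : radialSum 1 (fun x => e x * radialWeight σ x) < ∞ := by
    refine (radialSum_add_conv_mul_le le_rfl hVV he3).trans_lt ?_
    simp only [ENNReal.rpow_one]
    have hheadV := radialSum_kernelHead_lt_top zero_lt_one hσ hf1 R
    refine ENNReal.mul_lt_top (by simp) (ENNReal.add_lt_top.2
      ⟨radialSum_kernelOne_lt_top zero_lt_one σ,
      ENNReal.mul_lt_top (ENNReal.mul_lt_top (by simp) (by simp)) (ENNReal.add_lt_top.2 ⟨?_, ?_⟩)⟩)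
    · exact ENNReal.mul_lt_top hhV ((tsum_le_radialSum _).trans_lt hheadV)
    · exact ENNReal.mul_lt_top hheadV ((tsum_le_radialSum _).trans_lt hhV)
  have htail := tendsto_tsum_antitone_max
    (radialSup_antitone fun x : Fin d → ℤ => e x * radialWeight σ x)
    (by rw [← radialSum_one]; exact heV.ne)
  -- Beyond X the tail of `e` with weight σ is at most ε/2. On [0, X] the weight σ_T is at most 2
  -- for suitable T, and the unweighted sum of `e` is at most ε/4.
  obtain ⟨X, hX⟩ := (htail.eventually_le_const (ENNReal.div_pos hε0 (by simp : (2 : ℝ≥0∞) ≠ ∞))).exists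
  obtain ⟨T, hT⟩ := ((hlim X (by positivity)).eventually_le_const (by norm_num : (1 : ℝ) < 2)).exists
  have hsmall : radialSum 1 (fun x => e x * radialWeight (σT T) x) ≤ ε := by
    calc radialSum 1 (fun x => e x * radialWeight (σT T) x)
        ≤ 2 * radialSum 1 e +
          ∑' k : Fin d → ℤ, radialSup (fun x => e x * radialWeight σ x) (max ‖k‖ X) := by
          rw [radialSum_one, radialSum_one, ← ENNReal.tsum_mul_left, ← ENNReal.tsum_add]
          refine ENNReal.tsum_le_tsum fun k => radialSup_le fun x hx => ?_
          rcases le_total ‖x‖ X with hxX | hxX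
          · refine le_trans ?_ le_self_add
            rw [mul_comm]
            refine mul_le_mul' ?_ (le_radialSup hx)
            rw [radialWeight, ← ENNReal.ofReal_ofNat]
            exact ENNReal.ofReal_le_ofReal
              ((hσT T (norm_nonneg x) (Set.mem_Ici.2 (by positivity)) hxX).trans hT)
          · refine le_trans ?_ le_add_self
            refine le_trans ?_ (le_radialSup (f := fun x => e x * radialWeight σ x) (max_le hx hxX))
            exact mul_le_mul_right (ENNReal.ofReal_le_ofReal (hle T _ (norm_nonneg x))) _
      _ ≤ 2 * (ε / 2 / 2) + ε / 2 := by gcongr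
      _ = ε := by
          rw [ENNReal.mul_div_cancel (by simp) (by simp), ENNReal.add_halves]
  have hfT : radialSum 1 (fun x => f x * radialWeight (σT T) x) < ∞ := by
    refine radialSum_one_weight_lt_top (fun x => ?_) (fun _ => ENNReal.ofReal_ne_top) (hVVT T) hf1 he1
      (radialSum_kernelHead_lt_top zero_lt_one (hσT T) hf1 R) ?_
    · rw [radialWeight, ENNReal.one_le_ofReal]
      exact hσ1 T _ (norm_nonneg x)
    · refine (mul_le_mul_right hsmall c).trans (le_of_eq ?_)
      rw [hε, ← mul_assoc, ENNReal.mul_inv_cancel hc0 hct, one_mul]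
  have hcT : 0 ≤ cT T := by
    have h1 := hge T 0 le_rfl
    have h2 := hσσ 0 le_rfl
    have h3 := hσ1 T 0 le_rfl
    by_contra hneg
    nlinarith
  refine lt_of_le_of_lt (le_trans (radialSum_mono zero_le_one fun x => ?_)
    (radialSum_const_mul_le (p := 1) zero_le_one (ENNReal.ofReal (cT T))
      (f := fun x => f x * radialWeight (σT T) x)))
    (ENNReal.mul_lt_top (by simp) hfT)
  rw [mul_left_comm]
  refine mul_le_mul_right ?_ _
  rw [radialWeight, radialWeight, ← ENNReal.ofReal_mul hcT]
  exact ENNReal.ofReal_le_ofReal (hge T _ (norm_nonneg x))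

/-- The Beurling class embeds into the class of weighted summable majorants. -/
theorem radialSum_one_lt_top_of_mul_le (hp : 1 ≤ p) {Θ : ℝ → ℝ≥0∞} (hΘ : Antitone Θ)
    (hUV : ∀ x, V x ≤ U x * Θ ‖x‖)
    (hsum : (p = 1 ∧ Θ 0 < ∞) ∨ (1 < p ∧ ∑' k : Fin d → ℤ, Θ ‖k‖ ^ (p / (p - 1)) < ∞))
    (hf : radialSum p (fun x => f x * U x) < ∞) : radialSum 1 (fun x => f x * V x) < ∞ := by
  have hpt : ∀ k : Fin d → ℤ, radialSup (fun x => f x * V x) ‖k‖ ≤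
      radialSup (fun x => f x * U x) ‖k‖ * Θ ‖k‖ := by
    intro k
    refine radialSup_le fun x hx => ?_
    calc f x * V x ≤ f x * (U x * Θ ‖x‖) := mul_le_mul_right (hUV x) _
      _ = f x * U x * Θ ‖x‖ := by ring
      _ ≤ _ := mul_le_mul' (le_radialSup (f := fun x => f x * U x) hx) (hΘ hx)
  rw [radialSum_one]
  refine lt_of_le_of_lt (ENNReal.tsum_le_tsum hpt) ?_
  rcases hsum with ⟨rfl, h0⟩ | ⟨hp1, hs⟩
  · refine lt_of_le_of_lt (ENNReal.tsum_le_tsum fun k => mul_le_mul_right (hΘ (norm_nonneg k)) _) ?_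
    rw [ENNReal.tsum_mul_right, ← radialSum_one]
    exact ENNReal.mul_lt_top hf h0
  · have hpq : p.HolderConjugate (p / (p - 1)) := Real.HolderConjugate.conjExponent hp1
    -- Only finiteness is claimed, so Young's inequality termwise replaces Hölder's.
    have hy : ∀ a b : ℝ≥0∞, a * b ≤ a ^ p + b ^ (p / (p - 1)) := by
      intro a b
      refine (ENNReal.young_inequality a b hpq).trans (add_le_add ?_ ?_)
      · exact ENNReal.div_le_of_le_mul (le_mul_of_one_le_right' (ENNReal.one_le_ofReal.2 hp))
      · exact ENNReal.div_le_of_le_mul (le_mul_of_one_le_right'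
          (ENNReal.one_le_ofReal.2 hpq.symm.lt.le))
    refine lt_of_le_of_lt (ENNReal.tsum_le_tsum fun k => hy _ _) ?_
    rw [ENNReal.tsum_add]
    exact ENNReal.add_lt_top.2 ⟨hf, hs⟩

end Bootstrap

/-! ### Admissible weights -/

/-- The properties of a radial weight `ρ` and an auxiliary weight `σ` that give
inverse-closedness. -/
structure IsAdmissibleWeight (d : ℕ) (p : ℝ) (ρ σ : ℝ → ℝ) : Prop where
  mono : MonotoneOn ρ (Set.Ici 0)
  mono_aux : MonotoneOn σ (Set.Ici 0)
  one_le_aux : ∀ r, 0 ≤ r → 1 ≤ σ r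
  submul : ∀ x y : Fin d → ℤ, ‖y‖ ≤ ‖x‖ →
    radialWeight ρ (x + y) ≤ radialWeight ρ x * radialWeight σ y
  submul_aux : ∀ x y : Fin d → ℤ, ‖y‖ ≤ ‖x‖ →
    radialWeight σ (x + y) ≤ radialWeight σ x * radialWeight σ y
  embed : ∀ f : (Fin d → ℤ) → ℝ≥0∞, radialSum p (fun x => f x * radialWeight ρ x) < ∞ →
    radialSum 1 (fun x => f x * radialWeight σ x) < ∞
  inverse_aux : ∀ h f : (Fin d → ℤ) → ℝ≥0∞, KernelInverse h f →
    radialSum 1 (fun x => h x * radialWeight σ x) < ∞ → radialSum 1 f < ∞ →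
      radialSum 1 (fun x => f x * radialWeight σ x) < ∞

theorem radialWeight_submul {d : ℕ} {ρ σ : ℝ → ℝ} (hρ : MonotoneOn ρ (Set.Ici 0))
    (h0 : ∀ r, 0 ≤ r → 0 ≤ ρ r) (h : ∀ r s, 0 ≤ s → s ≤ r → ρ (r + s) ≤ ρ r * σ s)
    (x y : Fin d → ℤ) (hxy : ‖y‖ ≤ ‖x‖) :
    radialWeight ρ (x + y) ≤ radialWeight ρ x * radialWeight σ y := by
  unfold radialWeight
  rw [← ENNReal.ofReal_mul (h0 _ (norm_nonneg x))]
  refine ENNReal.ofReal_le_ofReal (le_trans (hρ (norm_nonneg _) (Set.mem_Ici.2 (by positivity))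
    (norm_add_le x y)) (h _ _ (norm_nonneg _) hxy))

/-- For s ≤ r one has 1 + r + s ≤ 2(1 + r), so the auxiliary weight is constant and its
inverse-closedness is trivial. The embedding needs αp/(p-1) > d when p > 1, which is the assumption
on α. -/
theorem isAdmissibleWeight_polynomial {d : ℕ} {p α : ℝ} (hp : 1 ≤ p)
    (hα : (d : ℝ) * (1 - 1 / p) < α) :
    IsAdmissibleWeight d p (fun r => (1 + r) ^ α) (fun _ => 2 ^ α) := by
  have hp0 : 0 < p := by linarith
  have hα0 : 0 < α := by
    refine lt_of_le_of_lt ?_ hα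
    have : 1 / p ≤ 1 := by rw [div_le_one hp0]; exact hp
    exact mul_nonneg (by positivity) (by linarith)
  have h2 : (1 : ℝ) ≤ 2 ^ α := Real.one_le_rpow (by norm_num) hα0.le
  have hmono : MonotoneOn (fun r : ℝ => (1 + r) ^ α) (Set.Ici 0) := by
    intro r hr s _ hrs
    have : (0 : ℝ) ≤ r := hr
    exact Real.rpow_le_rpow (by linarith) (by linarith) hα0.le
  have hmono' : MonotoneOn (fun _ : ℝ => (2 : ℝ) ^ α) (Set.Ici 0) := fun _ _ _ _ _ => le_rfl
  refine ⟨hmono, hmono', fun _ _ => h2, ?_, ?_,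
    ?_, ?_⟩
  · refine radialWeight_submul hmono (fun r hr => Real.rpow_nonneg (by linarith) _) ?_
    intro r s hs hsr
    rw [← Real.mul_rpow (by linarith) (by norm_num)]
    exact Real.rpow_le_rpow (by linarith) (by linarith) hα0.le
  · exact radialWeight_submul hmono' (fun r hr => by linarith)
      fun _ _ _ _ => le_mul_of_one_le_left (by linarith) h2
  · intro f hf
    refine radialSum_one_lt_top_of_mul_le hp (Θ := fun r => ENNReal.ofReal (2 ^ α * (1 + max r 0) ^ (-α)))
      ?_ ?_ ?_ hf
    · intro r s hrs
      refine ENNReal.ofReal_le_ofReal (mul_le_mul_of_nonneg_left ?_ (by linarith))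
      exact Real.rpow_le_rpow_of_nonpos (by positivity) (by gcongr) (by linarith)
    · intro x
      have hpos : 0 < 1 + ‖x‖ := by positivity
      unfold radialWeight
      rw [← ENNReal.ofReal_mul (by positivity), max_eq_left (norm_nonneg x), mul_left_comm,
        ← Real.rpow_add hpos, add_neg_cancel, Real.rpow_zero, mul_one]
    · rcases hp.eq_or_lt with rfl | hp1
      · exact Or.inl ⟨rfl, ENNReal.ofReal_lt_top⟩
      · refine Or.inr ⟨hp1, ?_⟩
        have hp1' : 0 < p - 1 := by linarith
        have hs : (d : ℝ) < α * (p / (p - 1)) := by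
          have : (1 - 1 / p) * (p / (p - 1)) = 1 := by field_simp
          calc (d : ℝ) = d * (1 - 1 / p) * (p / (p - 1)) := by rw [mul_assoc, this, mul_one]
            _ < _ := mul_lt_mul_of_pos_right hα (by positivity)
        have hsum := (summable_one_add_norm_rpow (d := d) hs).mul_left ((2 ^ α) ^ (p / (p - 1)))
        have heq : ∀ k : Fin d → ℤ, ENNReal.ofReal (2 ^ α * (1 + max ‖k‖ 0) ^ (-α)) ^ (p / (p - 1)) =
            ENNReal.ofReal ((2 ^ α) ^ (p / (p - 1)) * (1 + ‖k‖) ^ (-(α * (p / (p - 1))))) := by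
          intro k
          rw [max_eq_left (norm_nonneg k), ENNReal.ofReal_rpow_of_nonneg (by positivity)
            (by positivity), Real.mul_rpow (by positivity) (by positivity), ← Real.rpow_mul
            (by positivity : 0 ≤ 1 + ‖k‖), neg_mul]
        simp only [heq]
        exact hsum.tsum_ofReal_lt_top
  · intro h f _ _ hf
    have h1 := radialSum_const_mul_le (p := 1) zero_le_one (ENNReal.ofReal (2 ^ α)) (f := f)
    simp only [radialWeight, mul_comm (f _)]
    exact h1.trans_lt (ENNReal.mul_lt_top (by simp) hf)

/-- Concavity: a + h and b are convex combinations of a and b + h with interchanged coefficients;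
add the two inequalities. -/
theorem rpow_increment_le {δ : ℝ} (hδ0 : 0 < δ) (hδ1 : δ < 1) {a b h : ℝ} (ha : 0 ≤ a) (hab : a ≤ b)
    (hh : 0 ≤ h) : (b + h) ^ δ - b ^ δ ≤ (a + h) ^ δ - a ^ δ := by
  have hc := Real.concaveOn_rpow hδ0.le hδ1.le
  rcases (add_nonneg (sub_nonneg.2 hab) hh).eq_or_lt with h0 | hpos
  · have h1 : b = a := by linarith
    have h2 : h = 0 := by linarith
    simp [h1, h2]
  set t := h / (b - a + h) with ht
  have ht0 : 0 ≤ t := div_nonneg hh hpos.le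
  have ht1 : 0 ≤ 1 - t := by
    rw [sub_nonneg, ht, div_le_one hpos]
    linarith
  have hbh : 0 ≤ b + h := by linarith
  have e1 : (1 - t) * a + t * (b + h) = a + h := by
    rw [ht]; field_simp; ring
  have e2 : t * a + (1 - t) * (b + h) = b := by
    rw [ht]; field_simp; ring
  have c1 := hc.2 (Set.mem_Ici.2 ha) (Set.mem_Ici.2 hbh) ht1 ht0 (by ring)
  have c2 := hc.2 (Set.mem_Ici.2 ha) (Set.mem_Ici.2 hbh) ht0 ht1 (by ring)
  simp only [smul_eq_mul] at c1 c2
  rw [e1] at c1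
  rw [e2] at c2
  linarith

/-- With δn ≥ s, take the n-th power of (1 + r)^δ ≤ 1 + r^δ ≤ t⁻¹ exp((c/n) r^δ). -/
theorem exists_exp_neg_rpow_le {c δ : ℝ} (hc : 0 < c) (hδ0 : 0 < δ) (hδ1 : δ < 1) (s : ℝ) :
    ∃ C : ℝ, ∀ r : ℝ, 0 ≤ r → Real.exp (-(c * r ^ δ)) ≤ C * (1 + r) ^ (-s) := by
  obtain ⟨n, hn⟩ := exists_nat_ge (max (s / δ) 1)
  have hn1 : (1 : ℝ) ≤ n := (le_max_right _ _).trans hn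
  have hns : s ≤ δ * n := by
    have := (le_max_left _ _).trans hn
    rwa [div_le_iff₀' hδ0] at this
  set t := min (c / n) 1 with ht
  have ht0 : 0 < t := lt_min (by positivity) one_pos
  refine ⟨(t⁻¹) ^ n, fun r hr => ?_⟩
  have hrδ : 0 ≤ r ^ δ := Real.rpow_nonneg hr _
  have h1 : (1 + r) ^ δ ≤ 1 + r ^ δ := by
    have := rpow_increment_le hδ0 hδ1 le_rfl (zero_le_one' ℝ) hr
    rw [Real.one_rpow, Real.zero_rpow hδ0.ne', zero_add] at this
    linarith
  have h2 : 1 + r ^ δ ≤ t⁻¹ * Real.exp (c / n * r ^ δ) := by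
    rw [inv_mul_eq_div, le_div_iff₀ ht0]
    have h3 := Real.add_one_le_exp (c / n * r ^ δ)
    have h4 : t ≤ 1 := min_le_right _ _
    have h5 : t ≤ c / n := min_le_left _ _
    nlinarith
  have h3 : (1 + r) ^ s ≤ (t⁻¹) ^ n * Real.exp (c * r ^ δ) := by
    calc (1 + r) ^ s ≤ (1 + r) ^ (δ * n) := Real.rpow_le_rpow_of_exponent_le (by linarith) hns
      _ = ((1 + r) ^ δ) ^ n := by rw [Real.rpow_mul (by linarith), Real.rpow_natCast]
      _ ≤ (t⁻¹ * Real.exp (c / n * r ^ δ)) ^ n := by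
          gcongr
          exact h1.trans h2
      _ = _ := by
          rw [mul_pow, ← Real.exp_nat_mul]
          congr 2
          field_simp
  rw [Real.exp_neg, Real.rpow_neg (by linarith), ← div_eq_mul_inv,
    le_div_iff₀ (Real.rpow_pos_of_pos (by linarith) _), inv_mul_le_iff₀ (Real.exp_pos _)]
  rwa [mul_comm] at h3

/-- Bernoulli's inequality bounds the increment by δrT^{δ-1}. -/
theorem tendsto_rpow_increment {δ : ℝ} (hδ0 : 0 < δ) (hδ1 : δ < 1) {r : ℝ} (hr : 0 ≤ r) :
    Tendsto (fun T : ℕ => (r + T) ^ δ - (T : ℝ) ^ δ) atTop (𝓝 0) := by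
  have h1 : Tendsto (fun T : ℕ => δ * r * (T : ℝ) ^ (-(1 - δ))) atTop (𝓝 0) := by
    have := ((tendsto_rpow_neg_atTop (by linarith : 0 < 1 - δ)).comp
      tendsto_natCast_atTop_atTop).const_mul (δ * r)
    rw [mul_zero] at this
    exact this
  refine squeeze_zero' (Eventually.of_forall fun T => ?_) ?_ h1
  · exact sub_nonneg.2 (Real.rpow_le_rpow (by positivity) (by linarith) hδ0.le)
  · filter_upwards [eventually_ge_atTop 1] with T hT
    have hT0 : (0 : ℝ) < T := by exact_mod_cast hT
    have h2 : (r + T) ^ δ = (T : ℝ) ^ δ * (1 + r / T) ^ δ := by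
      rw [← Real.mul_rpow hT0.le (by positivity)]
      congr 1
      field_simp
      ring
    have h3 := _root_.rpow_one_add_le_one_add_mul_self (s := r / T)
      (by have : 0 ≤ r / T := by positivity
          linarith) hδ0.le hδ1.le
    have h4 : (T : ℝ) ^ (-(1 - δ)) = (T : ℝ) ^ δ / T := by
      rw [neg_sub, Real.rpow_sub_one hT0.ne']
    rw [h2, h4]
    have h5 : 0 ≤ (T : ℝ) ^ δ := by positivity
    calc (T : ℝ) ^ δ * (1 + r / T) ^ δ - (T : ℝ) ^ δ
        ≤ (T : ℝ) ^ δ * (1 + δ * (r / T)) - (T : ℝ) ^ δ := by gcongr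
      _ = _ := by ring

/-- For s ≤ r concavity gives (r + s)^δ - r^δ ≤ (2s)^δ - s^δ = θs^δ with θ = 2^δ - 1 < 1. The gap 1
- θ yields the embedding into summable majorants, and the shifted exponents θ((r + T)^δ - T^δ) form
the family that tends to the trivial weight. -/
theorem isAdmissibleWeight_subexponential {d : ℕ} [NeZero d] {p δ : ℝ} (hp : 1 ≤ p) (hδ0 : 0 < δ)
    (hδ1 : δ < 1) :
    IsAdmissibleWeight d p (fun r => Real.exp (r ^ δ)) (fun r => Real.exp ((2 ^ δ - 1) * r ^ δ)) := by
  set θ : ℝ := 2 ^ δ - 1 with hθ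
  have hθ0 : 0 < θ := by
    have := Real.one_lt_rpow (by norm_num : (1 : ℝ) < 2) hδ0
    linarith
  have hθ1 : θ < 1 := by
    have := Real.rpow_lt_rpow_of_exponent_lt (by norm_num : (1 : ℝ) < 2) hδ1
    rw [Real.rpow_one] at this
    linarith
  have hpow : MonotoneOn (fun r : ℝ => r ^ δ) (Set.Ici 0) :=
    fun r hr s _ hrs => Real.rpow_le_rpow hr hrs hδ0.le
  have hmono : MonotoneOn (fun r : ℝ => Real.exp (r ^ δ)) (Set.Ici 0) :=
    fun r hr s hs hrs => Real.exp_le_exp.2 (hpow hr hs hrs)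
  have hmono' : MonotoneOn (fun r : ℝ => Real.exp (θ * r ^ δ)) (Set.Ici 0) :=
    fun r hr s hs hrs => Real.exp_le_exp.2 (mul_le_mul_of_nonneg_left (hpow hr hs hrs) hθ0.le)
  have hadd : ∀ r s : ℝ, 0 ≤ s → s ≤ r → (r + s) ^ δ ≤ r ^ δ + θ * s ^ δ := by
    intro r s hs hsr
    have h1 := rpow_increment_le hδ0 hδ1 hs hsr hs
    rw [← two_mul, Real.mul_rpow (by norm_num) hs] at h1
    rw [hθ]
    linarith
  have hsubadd : ∀ r s : ℝ, 0 ≤ s → s ≤ r → (r + s) ^ δ ≤ r ^ δ + s ^ δ := by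
    intro r s hs hsr
    have h2 := mul_le_mul_of_nonneg_right hθ1.le (Real.rpow_nonneg hs δ)
    linarith [hadd r s hs hsr]
  have hVV := radialWeight_submul (d := d) (σ := fun r => Real.exp (θ * r ^ δ)) hmono'
    (fun r _ => (Real.exp_pos _).le) fun r s hs hsr => by
      rw [← Real.exp_add, Real.exp_le_exp, ← mul_add]
      exact mul_le_mul_of_nonneg_left (hsubadd r s hs hsr) hθ0.le
  refine ⟨hmono, hmono', fun r hr => ?_, ?_, hVV, ?_, ?_⟩
  · exact Real.one_le_exp (mul_nonneg hθ0.le (Real.rpow_nonneg hr _))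
  · refine radialWeight_submul hmono (fun r _ => (Real.exp_pos _).le) fun r s hs hsr => ?_
    rw [← Real.exp_add, Real.exp_le_exp]
    exact hadd r s hs hsr
  · intro f hf
    refine radialSum_one_lt_top_of_mul_le hp
      (Θ := fun r => ENNReal.ofReal (Real.exp (-((1 - θ) * (max r 0) ^ δ)))) ?_ ?_ ?_ hf
    · intro r s hrs
      refine ENNReal.ofReal_le_ofReal (Real.exp_le_exp.2 (neg_le_neg ?_))
      refine mul_le_mul_of_nonneg_left ?_ (by linarith)
      exact hpow (Set.mem_Ici.2 (le_max_right r 0)) (Set.mem_Ici.2 (le_max_right s 0))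
        (max_le_max_right _ hrs)
    · intro x
      unfold radialWeight
      rw [← ENNReal.ofReal_mul (Real.exp_pos _).le, ← Real.exp_add, max_eq_left (norm_nonneg x)]
      refine ENNReal.ofReal_le_ofReal (Real.exp_le_exp.2 (le_of_eq ?_))
      ring
    · rcases hp.eq_or_lt with rfl | hp1
      · exact Or.inl ⟨rfl, ENNReal.ofReal_lt_top⟩
      · refine Or.inr ⟨hp1, ?_⟩
        have hp1' : 0 < p - 1 := by linarith
        have hp0 : 0 < p := by linarith
        have hp' : 0 < p / (p - 1) := by positivity
        obtain ⟨C, hC⟩ := exists_exp_neg_rpow_le (c := (1 - θ) * (p / (p - 1)))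
          (mul_pos (by linarith) hp') hδ0 hδ1 (d + 1)
        have hsum := (summable_one_add_norm_rpow (d := d) (s := d + 1) (by linarith)).mul_left C
        refine lt_of_le_of_lt (ENNReal.tsum_le_tsum fun k => ?_) hsum.tsum_ofReal_lt_top
        rw [max_eq_left (norm_nonneg k), ENNReal.ofReal_rpow_of_nonneg (Real.exp_pos _).le hp'.le,
          ← Real.exp_mul]
        refine ENNReal.ofReal_le_ofReal (le_trans (le_of_eq ?_) (hC ‖k‖ (norm_nonneg k)))
        congr 1
        ring
  · intro h f hinv hhV hf
    refine hinv.radialSum_one_lt_top (σ := fun r => Real.exp (θ * r ^ δ))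
      (σT := fun T r => Real.exp (θ * ((r + T) ^ δ - (T : ℝ) ^ δ)))
      (cT := fun T => Real.exp (θ * (T : ℝ) ^ δ)) hmono' ?_ ?_ ?_ ?_ ?_ hVV ?_ hhV hf
    · intro T r hr s _ hrs
      have hr' : (0 : ℝ) ≤ r := hr
      refine Real.exp_le_exp.2 (mul_le_mul_of_nonneg_left (sub_le_sub_right ?_ _) hθ0.le)
      exact Real.rpow_le_rpow (by positivity) (by linarith) hδ0.le
    · intro T r hr
      refine Real.one_le_exp (mul_nonneg hθ0.le (sub_nonneg.2 ?_))
      exact Real.rpow_le_rpow (by positivity) (by linarith) hδ0.le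
    · intro T r hr
      refine Real.exp_le_exp.2 (mul_le_mul_of_nonneg_left ?_ hθ0.le)
      have := rpow_increment_le hδ0 hδ1 le_rfl (Nat.cast_nonneg (α := ℝ) T) hr
      rwa [zero_add, Real.zero_rpow hδ0.ne', sub_zero, add_comm] at this
    · intro T r hr
      rw [← Real.exp_add, Real.exp_le_exp, ← mul_add]
      refine mul_le_mul_of_nonneg_left ?_ hθ0.le
      have : r ^ δ ≤ (r + T) ^ δ := Real.rpow_le_rpow hr (by linarith [Nat.cast_nonneg (α := ℝ) T]) hδ0.le
      linarith
    · intro r hr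
      have := ((tendsto_rpow_increment hδ0 hδ1 hr).const_mul θ).rexp
      rwa [mul_zero, Real.exp_zero] at this
    · intro T
      refine radialWeight_submul ?_ (fun r _ => (Real.exp_pos _).le) fun r s hs hsr => ?_
      · intro r hr s _ hrs
        have hr' : (0 : ℝ) ≤ r := hr
        refine Real.exp_le_exp.2 (mul_le_mul_of_nonneg_left (sub_le_sub_right ?_ _) hθ0.le)
        exact Real.rpow_le_rpow (by positivity) (by linarith) hδ0.le
      · rw [← Real.exp_add, Real.exp_le_exp, ← mul_add]
        refine mul_le_mul_of_nonneg_left ?_ hθ0.le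
        -- The increment of length s starting at r + T is at most the one starting at T, so the
        -- shifted exponent is subadditive.
        have := rpow_increment_le hδ0 hδ1 (Nat.cast_nonneg (α := ℝ) T)
          (by linarith : (T : ℝ) ≤ r + T) hs
        rw [show r + T + s = r + s + T by ring, show (T : ℝ) + s = s + T by ring] at this
        linarith

/-! ### The Beurling class as an inverse-closed subalgebra -/

section Algebra

variable {d : ℕ} {p q : ℝ} {w : (Fin d → ℤ) → ℝ} [hq : Fact (1 ≤ q)] [hw : Fact (∀ i, 0 < w i)]
  {C K : ℝ≥0∞} {A : Matrix (Fin d → ℤ) (Fin d → ℤ) ℂ} {T G : Wlp q w →L[ℂ] Wlp q w}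

theorem kernelConv_sub (f g : (Fin d → ℤ) → ℝ≥0∞) (i j : Fin d → ℤ) :
    kernelConv f g (i - j) = ∑' k, f (i - k) * g (k - j) := by
  unfold kernelConv
  rw [← (Equiv.subLeft i).tsum_eq]
  refine tsum_congr fun k => ?_
  simp only [Equiv.subLeft_apply]
  congr 2
  abel

/-- With S the band truncation of G, the error TS - 1 equals -T(G - S), and G = S - G(TS - 1). The
three estimates are read off from these identities and from TS - 1 itself. -/
theorem kernelInverse_opMatrix (hK : KernelBound q w K) (hKt : K ≠ ∞) (hA : IsMatrixOf A T)
    (hTG : T * G = 1) (hGT : G * T = 1) (hG : radialSum 1 (matrixKernel (opMatrix G)) < ∞) :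
    KernelInverse (matrixKernel A) (matrixKernel (opMatrix G)) := by
  intro R
  set f := matrixKernel (opMatrix G) with hf
  set GR : Matrix (Fin d → ℤ) (Fin d → ℤ) ℂ := fun i j => if ‖i - j‖ ≤ R then opMatrix G i j else 0
    with hGR
  have hGRle : ∀ i j, ‖GR i j‖ₑ ≤ kernelHead R f (i - j) := by
    intro i j
    simp only [hGR, kernelHead]
    split_ifs with h
    · exact enorm_le_matrixKernel _ i j
    · simp
  have hGRtail : ∀ i j, ‖opMatrix G i j - GR i j‖ₑ ≤ kernelTail R f (i - j) := by
    intro i j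
    simp only [hGR, kernelTail]
    split_ifs with h
    · simp
    · rw [sub_zero]
      exact enorm_le_matrixKernel _ i j
  have hGRs : radialSum 1 (matrixKernel GR) < ∞ := by
    refine lt_of_le_of_lt (radialSum_mono zero_le_one fun x =>
      (matrixKernel_le hGRle x).trans ?_) hG
    unfold kernelHead
    split_ifs
    · exact le_rfl
    · exact zero_le
  obtain ⟨S, hS⟩ := exists_isMatrixOf hKt hK hGRs
  have hGm : IsMatrixOf (opMatrix G) G := isMatrixOf_of_single hKt hK hG fun _ _ => rfl
  refine ⟨matrixKernel (opMatrix (T * S - 1)), ?_, ?_, ?_⟩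
  · refine matrixKernel_le (f := fun x => kernelHead R f x +
      kernelConv f (matrixKernel (opMatrix (T * S - 1))) x) fun i j => ?_
    have h1 : G = S - G * (T * S - 1) := by
      rw [mul_sub, mul_one, ← mul_assoc, hGT, one_mul, sub_sub_cancel]
    have h2 : opMatrix G i j = GR i j - G ((T * S - 1) (wlpSingle j)) i := by
      rw [← hS.apply_single i j]
      exact congrArg (fun Y : Wlp q w →L[ℂ] Wlp q w => Y (wlpSingle j) i) h1
    rw [h2]
    refine (enorm_sub_le).trans (add_le_add (hGRle i j) ?_)
    rw [kernelConv_sub]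
    refine (hGm.enorm_apply_coord_le _ i).trans (ENNReal.tsum_le_tsum fun k => ?_)
    gcongr
    exact enorm_le_matrixKernel (opMatrix (T * S - 1)) k j
  · refine matrixKernel_le fun i j => ?_
    have h1 : T * S - 1 = -(T * (G - S)) := by
      rw [mul_sub, hTG, neg_sub]
    have h2 : opMatrix (T * S - 1) i j = -(T ((G - S) (wlpSingle j)) i) :=
      congrArg (fun Y : Wlp q w →L[ℂ] Wlp q w => Y (wlpSingle j) i) h1
    rw [h2, enorm_neg, kernelConv_sub]
    refine (hA.enorm_apply_coord_le _ i).trans (ENNReal.tsum_le_tsum fun k => ?_)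
    gcongr
    have h3 : (G - S) (wlpSingle j) k = opMatrix G k j - GR k j := by
      rw [← hS.apply_single k j]
      rfl
    rw [h3]
    exact hGRtail k j
  · refine matrixKernel_le (f := fun x => kernelOne x + kernelConv (matrixKernel A) (kernelHead R f) x)
      fun i j => ?_
    have h2 : opMatrix (T * S - 1) i j = T (S (wlpSingle j)) i - (wlpSingle j : Wlp q w) i := rfl
    rw [h2, add_comm]
    refine (enorm_sub_le).trans (add_le_add ?_ ?_)
    · rw [kernelConv_sub]
      refine (hA.enorm_apply_coord_le _ i).trans (ENNReal.tsum_le_tsum fun k => ?_)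
      gcongr
      rw [hS.apply_single]
      exact hGRle k j
    · rw [wlpSingle_apply, kernelOne, Pi.single_apply]
      by_cases hij : i = j <;> simp [hij, sub_eq_zero]

/-- The weight depends on i - j only, so the supremum may be taken first along each diagonal. -/
theorem mem_beurlingClass_iff (hp : 1 ≤ p) {ρ : ℝ → ℝ} :
    A ∈ BeurlingClass p (fun i j => ρ ‖i - j‖) ↔
      radialSum p (fun x => matrixKernel A x * radialWeight ρ x) < ∞ := by
  have hsup : ∀ k, beurlingSup (fun i j => ρ ‖i - j‖) A k =
      radialSup (fun x => matrixKernel A x * radialWeight ρ x) ‖k‖ := by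
    intro k
    have hmul : ∀ i j, ENNReal.ofReal (‖A i j‖ * ρ ‖i - j‖) = ‖A i j‖ₑ * radialWeight ρ (i - j) := by
      intro i j
      rw [ENNReal.ofReal_mul (norm_nonneg _), ofReal_norm, radialWeight]
    refine le_antisymm (iSup_le fun i => iSup₂_le fun j h => ?_) (radialSup_le fun x hx => ?_)
    · rw [hmul]
      refine le_trans ?_ (le_radialSup (f := fun x => matrixKernel A x * radialWeight ρ x) h)
      exact mul_le_mul_left (enorm_le_matrixKernel A i j) _
    · rw [matrixKernel, ENNReal.iSup_mul]
      refine iSup_le fun j => ?_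
      refine le_trans (le_of_eq ?_) (le_iSup_of_le (x + j) (le_iSup₂_of_le j (by simpa using hx) le_rfl))
      rw [hmul, add_sub_cancel_right]
  have hp0 : 0 < p := by linarith
  change beurlingNorm p (fun i j => ρ ‖i - j‖) A < ∞ ↔ _
  rw [beurlingNorm, ENNReal.rpow_lt_top_iff_of_pos (by positivity), radialSum]
  simp only [hsup]

/-- The subalgebra consists of the operators whose entries form a matrix of the class; such
operators really are given by their matrices, because the class embeds into the kernels with
summable majorant. -/
theorem exists_inverseClosed_subalgebra [NeZero d] (hp : 1 ≤ p) (hAq : IsDiscreteAqWeight q w)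
    {ρ σ : ℝ → ℝ} (hρ : IsAdmissibleWeight d p ρ σ) :
    ∃ (S : Subalgebra ℂ (Wlp q w →L[ℂ] Wlp q w))
      (Φ : BeurlingClass p (fun i j : Fin d → ℤ => ρ ‖i - j‖) ≃ S),
      (∀ A : BeurlingClass p (fun i j : Fin d → ℤ => ρ ‖i - j‖), IsMatrixOf A.1 (Φ A).1) ∧
      (∀ (A B : BeurlingClass p (fun i j : Fin d → ℤ => ρ ‖i - j‖)) (i j : Fin d → ℤ),
        HasSum (fun k => A.1 i k * B.1 k j) ((Φ.symm (Φ A * Φ B)).1 i j)) ∧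
      IsInverseClosed S := by
  obtain ⟨C, hCt, hC⟩ := hAq.exists_cubeBound
  obtain ⟨K, hKt, hK⟩ := hC.exists_kernelBound hCt
  have hp0 : 0 < p := by linarith
  have h2p : (2 : ℝ≥0∞) ^ p < ∞ := ENNReal.rpow_lt_top_of_nonneg hp0.le (by simp)
  set 𝓑 := BeurlingClass p (fun i j : Fin d → ℤ => ρ ‖i - j‖) with h𝓑
  have hmem : ∀ A : Matrix (Fin d → ℤ) (Fin d → ℤ) ℂ,
      A ∈ 𝓑 ↔ radialSum p (fun x => matrixKernel A x * radialWeight ρ x) < ∞ :=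
    fun A => mem_beurlingClass_iff hp
  have hV : ∀ A ∈ 𝓑, radialSum 1 (fun x => matrixKernel A x * radialWeight σ x) < ∞ :=
    fun A hA => hρ.embed _ ((hmem A).1 hA)
  have h1 : ∀ A ∈ 𝓑, radialSum 1 (matrixKernel A) < ∞ := fun A hA => lt_of_le_of_lt
    (radialSum_mono zero_le_one fun x => le_mul_of_one_le_right' (by
      rw [radialWeight, ENNReal.one_le_ofReal]
      exact hρ.one_le_aux _ (norm_nonneg x))) (hV A hA)
  have hmat : ∀ T : Wlp q w →L[ℂ] Wlp q w, opMatrix T ∈ 𝓑 → IsMatrixOf (opMatrix T) T :=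
    fun T hT => isMatrixOf_of_single hKt hK (h1 _ hT) fun _ _ => rfl
  let S : Subalgebra ℂ (Wlp q w →L[ℂ] Wlp q w) :=
    { carrier := {T | opMatrix T ∈ 𝓑}
      mul_mem' := by
        intro T U hT hU
        change opMatrix (T * U) ∈ 𝓑
        have heq : opMatrix (T * U) = matrixProd (opMatrix T) (opMatrix U) :=
          funext fun i => funext fun j => (hmat T hT).mul_single (hmat U hU) i j
        rw [heq, hmem]
        refine lt_of_le_of_lt ((radialSum_mono hp0.le fun x =>
          mul_le_mul_left (matrixKernel_prod_le x) _).trans (radialSum_conv_le hp hρ.submul)) ?_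
        refine ENNReal.mul_lt_top (ENNReal.mul_lt_top h2p (by simp)) (ENNReal.add_lt_top.2 ⟨?_, ?_⟩)
        · exact ENNReal.mul_lt_top ((hmem _).1 hT) (ENNReal.rpow_lt_top_of_nonneg hp0.le
            ((tsum_le_radialSum _).trans_lt (hV _ hU)).ne)
        · exact ENNReal.mul_lt_top ((hmem _).1 hU) (ENNReal.rpow_lt_top_of_nonneg hp0.le
            ((tsum_le_radialSum _).trans_lt (hV _ hT)).ne)
      add_mem' := by
        intro T U hT hU
        change opMatrix (T + U) ∈ 𝓑
        have heq : opMatrix (T + U) = opMatrix T + opMatrix U := rfl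
        rw [heq, hmem]
        refine lt_of_le_of_lt ((radialSum_mono hp0.le fun x => ?_).trans (radialSum_add_le hp
          (f := fun x => matrixKernel (opMatrix T) x * radialWeight ρ x)
          (g := fun x => matrixKernel (opMatrix U) x * radialWeight ρ x))) ?_
        · rw [← add_mul]
          exact mul_le_mul_left (matrixKernel_add_le x) _
        · exact ENNReal.mul_lt_top h2p (ENNReal.add_lt_top.2 ⟨(hmem _).1 hT, (hmem _).1 hU⟩)
      algebraMap_mem' := by
        intro r
        change opMatrix (algebraMap ℂ (Wlp q w →L[ℂ] Wlp q w) r) ∈ 𝓑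
        rw [hmem]
        have hle : ∀ x, matrixKernel (opMatrix (algebraMap ℂ (Wlp q w →L[ℂ] Wlp q w) r)) x ≤
            ‖r‖ₑ * kernelOne x := by
          refine matrixKernel_le (f := fun x => ‖r‖ₑ * kernelOne x) fun i j => ?_
          have : opMatrix (algebraMap ℂ (Wlp q w →L[ℂ] Wlp q w) r) i j =
              r * (Pi.single j 1 : (Fin d → ℤ) → ℂ) i := rfl
          rw [this, Pi.single_apply, kernelOne]
          by_cases hij : i = j <;> simp [hij, sub_eq_zero]
        refine lt_of_le_of_lt ((radialSum_mono hp0.le fun x => ?_).trans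
          (radialSum_const_mul_le hp0.le ‖r‖ₑ (f := fun x => kernelOne x * radialWeight ρ x))) ?_
        · rw [← mul_assoc]
          exact mul_le_mul_left (hle x) _
        · exact ENNReal.mul_lt_top (ENNReal.rpow_lt_top_of_nonneg hp0.le enorm_ne_top)
            (radialSum_kernelOne_lt_top hp0 ρ) }
  choose τ hτ using fun A : 𝓑 => exists_isMatrixOf (q := q) (w := w) hKt hK (h1 A.1 A.2)
  have hop : ∀ A : 𝓑, opMatrix (τ A) = A.1 :=
    fun A => funext fun i => funext fun j => (hτ A).apply_single i j
  let Φ : 𝓑 ≃ S :=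
    { toFun := fun A => ⟨τ A, show opMatrix (τ A) ∈ 𝓑 by rw [hop]; exact A.2⟩
      invFun := fun T => ⟨opMatrix T.1, T.2⟩
      left_inv := fun A => Subtype.ext (hop A)
      right_inv := fun T => Subtype.ext (wlp_clm_ext fun j => wlp_ext fun i =>
        (hτ ⟨opMatrix T.1, T.2⟩).apply_single i j) }
  refine ⟨S, Φ, hτ, fun A B i j => (hτ A).hasSum_mul_single (hτ B) i j, fun a ha => ?_⟩
  have ha' : opMatrix (a : Wlp q w →L[ℂ] Wlp q w) ∈ 𝓑 := ha
  have hA := hmat _ ha'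
  have hG := radialSum_opMatrix_inverse_lt_top hC hCt hK hKt hA (h1 _ ha') a.mul_inv a.inv_mul
  have hinv := kernelInverse_opMatrix hK hKt hA a.mul_inv a.inv_mul hG
  change opMatrix ((a⁻¹ : (Wlp q w →L[ℂ] Wlp q w)ˣ) : Wlp q w →L[ℂ] Wlp q w) ∈ 𝓑
  rw [hmem]
  -- The inverse climbs from the unweighted class to the auxiliary weight and then to the full one.
  exact hinv.radialSum_lt_top hp hρ.mono hρ.mono_aux hρ.one_le_aux hρ.submul hρ.submul_aux
    ((hmem _).1 ha') (hV _ ha') (hρ.inverse_aux _ _ hinv (hV _ ha') hG)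

end Algebra

theorem mainTheorem9 (d : ℕ) (hd : 1 ≤ d) (p q : ℝ) (hp : 1 ≤ p) [Fact (1 ≤ q)]
    (w : (Fin d → ℤ) → ℝ) [Fact (∀ i, 0 < w i)] (hw : IsDiscreteAqWeight q w)
    (u : (Fin d → ℤ) → (Fin d → ℤ) → ℝ)
    (hu : (∃ α : ℝ, (d : ℝ) * (1 - 1 / p) < α ∧ u = polynomialWeight d α) ∨
      (∃ δ : ℝ, 0 < δ ∧ δ < 1 ∧ u = subexponentialWeight d δ)) :
    ∃ (S : Subalgebra ℂ (Wlp q w →L[ℂ] Wlp q w)) (Φ : BeurlingClass p u ≃ S),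
      (∀ A : BeurlingClass p u, IsMatrixOf A.1 (Φ A).1) ∧
      (∀ (A B : BeurlingClass p u) (i j : Fin d → ℤ),
        HasSum (fun k => A.1 i k * B.1 k j) ((Φ.symm (Φ A * Φ B)).1 i j)) ∧
      IsInverseClosed S := by
  have : NeZero d := ⟨by omega⟩
  rcases hu with ⟨α, hα, hu⟩ | ⟨δ, hδ0, hδ1, hu⟩
  · have hu' : u = fun i j => (1 + ‖i - j‖) ^ α := hu
    subst hu'
    exact exists_inverseClosed_subalgebra (ρ := fun r => (1 + r) ^ α) hp hw
      (isAdmissibleWeight_polynomial hp hα)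
  · have hu' : u = fun i j => Real.exp (‖i - j‖ ^ δ) := hu
    subst hu'
    exact exists_inverseClosed_subalgebra (ρ := fun r => Real.exp (r ^ δ)) hp hw
      (isAdmissibleWeight_subexponential hp hδ0 hδ1)
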